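/- **Setting.** Let $\tau:(0,\infty)\to(0,\infty)$ be $C^1$ with $1/\tau\in L^1(0,1)$ and $\tau_0\mathbf 1_{x\ge1}x^{\nu_0}\le\tau(x)\le\tau_1\max(1,x)$ for all $x>0$, for some $\nu_0\le 1$ and $\tau_1\ge\tau_0>0$. Let $B:(0,\infty)\to[0,\infty)$ be continuous with connected support and $B_0\mathbf 1_{x\ge x_0}x^{\gamma_0}\le B(x)\le B_1\max(1,x^{\gamma_1})$ for all $x>0$, for some $\gamma_1\ge\gamma_0>0$, $B_1\ge B_0>0$, $x_0>0$. Let $\wp$ be a finite positive measure on $(0,1)$ with $\int_0^1 z\,\wp(dz)=1$. Put $$\mathcal F_+f(x)=\int_0^1B\Bigl(\frac xz\Bigr)f\Bigl(\frac xz\Bigr)\frac{\wp(dz)}z,\qquad \mathcal F_+^*\phi(x)=B(x)\int_0^1\phi(zx)\,\wp(dz).$$ For a weight $\psi$ on $(0,\infty)$ let $L^1(\psi)=L^1((0,\infty);\psi\,dx)$ with norm $\int_0^\infty|f|\psi\,dx$, and $L^1_\alpha=L^1((1+x)^\alpha)$. Let $(\lambda,G,\phi)$ solve the Perron eigenvalue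 problem: $\lambda\in\mathbb R$; $G\ge0$, $G\in L^1_1$, $BG\in L^1_1$ and $$(\tau G)'+\lambda G+BG=\mathcal F_+G\ \text{ in the distributional sense},\qquad (\tau G)(0)=0,\qquad \int_0^\infty G\,dx=1;$$ $\phi\in C^1(0,\infty)$, $\phi\ge0$, $z\mapsto\phi(zx)$ is $\wp$-integrable for every $x>0$, and $$-\tau\phi'+\lambda\phi+B\phi=\mathcal F_+^*\phi\ \text{ on }(0,\infty),\qquad \int_0^\infty G\phi\,dx=1.$$ On $L^1(\phi)$ let $\mathcal A_0f=-(\tau f)'-\lambda f-Bf$ with domain $$D(\mathcal A_0)=\{f\in L^1(\phi):(\tau f)'\in L^1(\phi),\ (\tau f)(0)=0,\ Bf\in L^1(\phi)\}.$$ **Lemma 2.6.** The closure of $(\mathcal A_0+\mathcal F_+,D(\mathcal A_0))$ in $L^1(\phi)$ generates a $C_0$-semigroup $(T_t)_{t\ge0}$ on $L^1(\phi)$. For every $\alpha>1$, the space $L^1_\alpha$ is contained in $L^1(\phi)$ and invariant under $(T_t)_{t\ge0}$; the restrictions of the $T_t$ to $L^1_\alpha$ are bounded operators on $L^1_\alpha$,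 there exists $C>0$ such that $$\|T_t\|_{\mathscr L(L^1_\alpha)}\le C(1+t)\qquad\text{for all }t\ge0,$$ and $(T_t)_{t\ge0}$ is a $C_0$-semigroup on $L^1_\alpha$. -/

import Mathlib

open MeasureTheory Set Filter Topology
open scoped NNReal ENNReal

noncomputable section

namespace GrowthFrag

/-- Hypotheses on the growth rate `τ : (0,∞) → (0,∞)`; values outside `(0,∞)` are never used. -/
structure IsGrowthRate (τ : ℝ → ℝ) : Prop where
  pos : ∀ x, 0 < x → 0 < τ x
  contDiffOn : ContDiffOn ℝ 1 τ (Ioi 0)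
  inv_integrable : IntegrableOn (fun x => 1 / τ x) (Ioo 0 1)
  bounds : ∃ ν₀ τ₀ τ₁ : ℝ, ν₀ ≤ 1 ∧ 0 < τ₀ ∧ τ₀ ≤ τ₁ ∧
    (∀ x, 1 ≤ x → τ₀ * x ^ ν₀ ≤ τ x) ∧ (∀ x, 0 < x → τ x ≤ τ₁ * max 1 x)

/-- Hypotheses on the total fragmentation rate `B : (0,∞) → [0,∞)`.
The support is the closure, relative to `(0,∞)`, of `{B ≠ 0}`. -/
structure IsFragRate (B : ℝ → ℝ) : Prop where
  nonneg : ∀ x, 0 < x → 0 ≤ B x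
  continuousOn : ContinuousOn B (Ioi 0)
  support_connected : IsConnected (closure {x | 0 < x ∧ B x ≠ 0} ∩ Ioi 0)
  bounds : ∃ γ₀ γ₁ B₀ B₁ x₀ : ℝ, 0 < γ₀ ∧ γ₀ ≤ γ₁ ∧ 0 < B₀ ∧ B₀ ≤ B₁ ∧ 0 < x₀ ∧
    (∀ x, 0 < x → x₀ ≤ x → B₀ * x ^ γ₀ ≤ B x) ∧ (∀ x, 0 < x → B x ≤ B₁ * max 1 (x ^ γ₁))

/-- Hypotheses on the fragmentation kernel: a finite positive measure on the open interval `(0,1)`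
(a measure on `ℝ` that does not charge the complement) with first moment one. -/
structure IsFragKernel (κ : Measure ℝ) : Prop where
  finite : IsFiniteMeasure κ
  concentrated : κ (Ioo 0 1)ᶜ = 0
  mass : ∫ z, z ∂κ = 1

/-- Lebesgue measure on `(0,∞)`. -/
def halfLine : Measure ℝ := volume.restrict (Ioi 0)

/-- The measure `ψ(x) dx` on `(0,∞)`. -/
def weightMeasure (ψ : ℝ → ℝ) : Measure ℝ :=
  halfLine.withDensity (fun x => ENNReal.ofReal (ψ x))

/-- The weighted space `L¹(ψ) = L¹((0,∞); ψ dx)`, with norm `∫ |f| ψ dx`. -/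
abbrev WL1 (ψ : ℝ → ℝ) : Type := Lp ℝ 1 (weightMeasure ψ)

/-- The weight `(1+x)^α`; the space `L¹_α` is `WL1 (powWeight α)`. -/
def powWeight (α : ℝ) : ℝ → ℝ := fun x => (1 + x) ^ α

/-- The gain operator `𝓕₊ f (x) = ∫₀¹ B(x/z) f(x/z) κ(dz)/z`. When `(1+B) f` belongs to `L¹_α`
with `α ≥ 0`, the integral converges for almost every `x > 0` and, up to null sets, depends only
on the class of `f`; it is then the continuous extension of the operator from `C_c(0,∞)`. -/
def fragPlus (B : ℝ → ℝ) (κ : Measure ℝ) (f : ℝ → ℝ) : ℝ → ℝ :=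
  fun x => ∫ z, B (x / z) * f (x / z) / z ∂κ

/-- `(τ f)' = d` in the distributional sense on `(0,∞)` and `(τ f)(0) = 0`: the product `τ f`
agrees almost everywhere with the absolutely continuous function `x ↦ ∫₀ˣ d`. -/
def HasFluxDeriv (τ f d : ℝ → ℝ) : Prop :=
  (∀ x, 0 < x → IntegrableOn d (Ioc 0 x)) ∧
    ∀ᵐ x ∂halfLine, τ x * f x = ∫ y in Ioc 0 x, d y

/-- The direct Perron problem: `(τG)' + λG + BG = 𝓕₊ G`, `(τG)(0) = 0`, `G ≥ 0`, `∫ G = 1`, for a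
function `G` such that `G` and `B G` are integrable with weight `1 + x`. -/
structure IsDirectPerron (τ B : ℝ → ℝ) (κ : Measure ℝ) (lam : ℝ) (G : ℝ → ℝ) : Prop where
  integrable : Integrable (fun x => (1 + x) * G x) halfLine
  integrable_rate : Integrable (fun x => (1 + x) * (B x * G x)) halfLine
  nonneg : ∀ᵐ x ∂halfLine, 0 ≤ G x
  mass : ∫ x, G x ∂halfLine = 1
  equation : HasFluxDeriv τ G (fun x => fragPlus B κ G x - lam * G x - B x * G x)

/-- The dual Perron problem: `-τφ' + λφ + Bφ = 𝓕₊* φ`, `φ ≥ 0`, `∫ G φ = 1` for `φ ∈ C¹(0,∞)`,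
where `𝓕₊* φ (x) = B(x) ∫₀¹ φ(zx) κ(dz)`. -/
structure IsDualPerron (τ B : ℝ → ℝ) (κ : Measure ℝ) (lam : ℝ) (G φ : ℝ → ℝ) : Prop where
  contDiffOn : ContDiffOn ℝ 1 φ (Ioi 0)
  nonneg : ∀ x, 0 < x → 0 ≤ φ x
  integrable : ∀ x, 0 < x → Integrable (fun z => φ (z * x)) κ
  equation : ∀ x, 0 < x →
    -(τ x * deriv φ x) + lam * φ x + B x * φ x = B x * ∫ z, φ (z * x) ∂κ
  normalized : ∫ x, G x * φ x ∂halfLine = 1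

/-- The graph, in `L¹(φ) × L¹(φ)`, of the operator `𝓐₀ + 𝓕₊` with domain
`D(𝓐₀) = {f ∈ L¹(φ) : (τf)' ∈ L¹(φ), (τf)(0) = 0, Bf ∈ L¹(φ)}`,
where `𝓐₀ f = -(τf)' - λf - Bf`. -/
def operatorGraph (τ B : ℝ → ℝ) (κ : Measure ℝ) (lam : ℝ) (φ : ℝ → ℝ) :
    Set (WL1 φ × WL1 φ) :=
  {p | ∃ d : ℝ → ℝ, Integrable d (weightMeasure φ) ∧ HasFluxDeriv τ p.1 d ∧
    Integrable (fun x => B x * p.1 x) (weightMeasure φ) ∧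
    ∀ᵐ x ∂halfLine, p.2 x = -d x - lam * p.1 x - B x * p.1 x + fragPlus B κ p.1 x}

section Semigroup

variable {E : Type*} [NormedAddCommGroup E] [NormedSpace ℝ E]

/-- Strongly continuous one-parameter semigroups of bounded operators. -/
structure IsC0Semigroup (T : ℝ≥0 → E →L[ℝ] E) : Prop where
  map_zero : T 0 = ContinuousLinearMap.id ℝ E
  map_add : ∀ s t, T (s + t) = (T s).comp (T t)
  strongly_continuous : ∀ f, Tendsto (fun t => T t f) (𝓝 0) (𝓝 f)

/-- The graph of the infinitesimal generator: `(f, g)` with `(T_t f - f)/t → g` as `t ↓ 0`. -/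
def generatorGraph (T : ℝ≥0 → E →L[ℝ] E) : Set (E × E) :=
  {p | Tendsto (fun t : ℝ≥0 => (t : ℝ)⁻¹ • (T t p.1 - p.1)) (𝓝[>] 0) (𝓝 p.2)}

end Semigroup

/-- `T` is the `C₀`-semigroup on `L¹(φ)` generated by the closure of `(𝓐₀ + 𝓕₊, D(𝓐₀))`. -/
def IsGrowthFragSemigroup (τ B : ℝ → ℝ) (κ : Measure ℝ) (lam : ℝ) (φ : ℝ → ℝ)
    (T : ℝ≥0 → WL1 φ →L[ℝ] WL1 φ) : Prop :=
  IsC0Semigroup T ∧ generatorGraph T = closure (operatorGraph τ B κ lam φ)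

end GrowthFrag

end

/-! The key fact is that the dual eigenvector grows exactly linearly: `c * (1 + x) ≤ φ x ≤ C * (1 +
x)`. Since the kernel has first moment one, the gain of a power `x ^ β` exceeds its loss when `β <
1` and falls short of it when `β > 1`. As `B` grows at least like a positive power, suitable
sublinear corrections of the weight `x` are strict sub- or supersolutions of the dual equation at
infinity.

The lower bound (`IsDualPerron.exists_mul_one_add_le`) is a minimum principle comparing `φ + ε (1 +
x ^ 2)` with `x + (1 + x) ^ β`. No growth of `φ` is known beforehand, so the upper bound
(`IsDualPerron.exists_le_mul_one_add`) cannot be reached in this way. A supersolution `C * w` of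
linear growth is instead glued to `φ` by a bounded concave truncation and tested against `G`.
Because `G` solves the direct eigenvalue equation, the supersolution can be strict only where `G`
vanishes, so `φ ≤ C * w` where `G` is positive. On the remaining interval near the origin `B`
vanishes and `φ` is explicit.

Generation is of Lumer–Phillips type. Since `φ` is in the kernel of the adjoint, bounding `|f|` by
Duhamel's formula and integrating against `φ` makes the gain terms cancel: this is dissipativity
(`IsDualPerron.isDissipative`). For nonnegative data with finite `α`-moment the resolvent equation
is solved by monotone Picard iteration; such data and their differences are dense. The domain is
dense as well, and the semigroup of the closure is the limit of the Yosida semigroups.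

For the bound on `L¹_α`, the adjoint operator maps `W = 1 + x ^ α` below `D * φ`. Hence `s R(s)`
increases the moment `∫ W |h|` by at most `(D / s) ‖h‖`, the norm being that of `L¹(φ)`. The Yosida
semigroup at time `t` is an average of the powers of `s R(s)` with Poisson weights of mean `s t`;
the factors `s` cancel, the moment grows by at most `D t ‖f‖`, and lower semicontinuity carries this
to the limit (`ResolventFamily.apply_semigroup_le`). The increment is additive, which is why the
growth is linear in time. It also shows that moments do not jump up at `t = 0`; together with
convergence in `L¹(φ)` this yields strong continuity on `L¹_α`, by an argument in the spirit of
Scheffé's lemma. -/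

namespace GrowthFrag

noncomputable section

/-! ### Abstract semigroups: comparison and Taylor estimates -/

section AbstractSemigroup

set_option linter.unusedSectionVars false

variable {E : Type*} [NormedAddCommGroup E] [NormedSpace ℝ E]

/-- Semigroup law without any continuity requirement. -/
structure IsSemigroup (T : ℝ≥0 → E →L[ℝ] E) : Prop where
  map_zero : T 0 = ContinuousLinearMap.id ℝ E
  map_add : ∀ s t, T (s + t) = (T s).comp (T t)

theorem IsC0Semigroup.isSemigroup {T : ℝ≥0 → E →L[ℝ] E} (hT : IsC0Semigroup T) :
    IsSemigroup T := ⟨hT.map_zero, hT.map_add⟩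

theorem IsSemigroup.pow {T : ℝ≥0 → E →L[ℝ] E} (hT : IsSemigroup T) (t : ℝ≥0) (n : ℕ) :
    T t ^ n = T (n * t) := by
  induction n with
  | zero => simp [hT.map_zero]; rfl
  | succ n ih =>
    rw [pow_succ, ih]
    have : ((n + 1 : ℕ) : ℝ≥0) * t = n * t + t := by push_cast; ring
    rw [this, hT.map_add]; rfl

theorem pow_apply_sub_pow_apply_eq_sum {P Q : E →L[ℝ] E} (h : Commute P Q) (n : ℕ) (f : E) :
    (P ^ n) f - (Q ^ n) f =
      ∑ k ∈ Finset.range n, (P ^ k * Q ^ (n - 1 - k)) (P f - Q f) := by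
  have := h.geom_sum₂_mul n
  have h2 := congrArg (fun A : E →L[ℝ] E => A f) this
  simp only [mul_apply_eq_comp, sub_apply, sum_apply] at h2
  rw [← h2]
  simp

/-- The difference quotient is sampled at step `t / (n + 1)`, so that it combines with the
factorisation of `T t` into `n + 1` equal steps. -/
theorem tendsto_smul_apply_sub {T : ℝ≥0 → E →L[ℝ] E} {f g : E}
    (h : (f, g) ∈ generatorGraph T) {t : ℝ≥0} (ht : 0 < t) :
    Tendsto (fun n : ℕ => ((n : ℝ) + 1) • (T (t / (n + 1)) f - f)) atTop (𝓝 ((t : ℝ) • g)) := by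
  have h0 : Tendsto (fun n : ℕ => t / ((n : ℝ≥0) + 1)) atTop (𝓝[>] 0) := by
    rw [tendsto_nhdsWithin_iff]
    constructor
    · rw [← NNReal.tendsto_coe]
      push_cast
      simpa using (tendsto_one_div_add_atTop_nhds_zero_nat (𝕜 := ℝ)).const_mul (t : ℝ) |>.congr
        (fun n => by rw [mul_one_div])
    · exact Eventually.of_forall fun n => by simp only [mem_Ioi]; positivity
  have h1 := ((show Tendsto _ _ _ from h).comp h0).const_smul (t : ℝ)
  refine h1.congr fun n => ?_
  simp only [Function.comp, smul_smul]
  congr 1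
  have : (t : ℝ) ≠ 0 := by exact_mod_cast ht.ne'
  push_cast
  field_simp

theorem IsSemigroup.eq_pow {T : ℝ≥0 → E →L[ℝ] E} (hT : IsSemigroup T) (t : ℝ≥0) (n : ℕ) :
    T t = T (t / (n + 1)) ^ (n + 1) := by
  rw [hT.pow]; congr 1; push_cast; field_simp

/-- Two commuting semigroups differ at `f` at most by the difference of their generators at `f`. -/
theorem norm_semigroup_sub_le {S T : ℝ≥0 → E →L[ℝ] E} (hS : IsSemigroup S) (hT : IsSemigroup T)
    (hc : ∀ s, Commute (S s) (T s)) {t : ℝ≥0} {M N : ℝ} (hM : ∀ s ≤ t, ‖S s‖ ≤ M)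
    (hN : ∀ s ≤ t, ‖T s‖ ≤ N) {f g g' : E} (hf : (f, g) ∈ generatorGraph S)
    (hf' : (f, g') ∈ generatorGraph T) :
    ‖S t f - T t f‖ ≤ M * N * (t * ‖g - g'‖) := by
  rcases eq_or_ne t 0 with rfl | ht
  · simp [hS.map_zero, hT.map_zero]
  have ht' : 0 < t := pos_iff_ne_zero.2 ht
  have hM0 : 0 ≤ M := (norm_nonneg _).trans (hM 0 zero_le)
  have hN0 : 0 ≤ N := (norm_nonneg _).trans (hN 0 zero_le)
  -- Telescoping over `n + 1` equal steps: each summand is a bounded operator applied to the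
  -- one-step error, and `n + 1` times that error tends to the difference of the generators.
  have key : ∀ n : ℕ, ‖S t f - T t f‖ ≤ M * N *
      ‖((n : ℝ) + 1) • (S (t / (n + 1)) f - f) - ((n : ℝ) + 1) • (T (t / (n + 1)) f - f)‖ := by
    intro n
    rw [hS.eq_pow t n, hT.eq_pow t n, pow_apply_sub_pow_apply_eq_sum (hc _)]
    rw [← smul_sub, sub_sub_sub_cancel_right, norm_smul]
    refine (norm_sum_le _ _).trans ?_
    have : ∀ k ∈ Finset.range (n + 1),
        ‖(S (t / (n + 1)) ^ k * T (t / (n + 1)) ^ (n + 1 - 1 - k))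
          (S (t / (n + 1)) f - T (t / (n + 1)) f)‖ ≤ M * N *
          ‖S (t / (n + 1)) f - T (t / (n + 1)) f‖ := by
      intro k hk
      have hk' : k ≤ n := by simpa [Nat.lt_succ_iff] using hk
      refine (ContinuousLinearMap.le_opNorm _ _).trans ?_
      gcongr
      refine (norm_mul_le _ _).trans ?_
      have aux : ∀ j : ℕ, j ≤ n → (j : ℝ≥0) * (t / (n + 1)) ≤ t := by
        intro j hj
        rw [← mul_div_assoc]
        refine div_le_of_le_mul₀ zero_le zero_le ?_
        rw [mul_comm]
        gcongr
        exact (Nat.cast_le.2 hj).trans (by simp)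
      rw [hS.pow, hT.pow]
      exact mul_le_mul (hM _ (aux k hk')) (hN _ (aux _ (by omega))) (norm_nonneg _) hM0
    refine (Finset.sum_le_sum this).trans ?_
    rw [Finset.sum_const, Finset.card_range, nsmul_eq_mul, Real.norm_of_nonneg (by positivity)]
    push_cast
    exact le_of_eq (by ring)
  have hlim := ((tendsto_smul_apply_sub hf ht').sub (tendsto_smul_apply_sub hf' ht')).norm.const_mul
    (M * N)
  have := ge_of_tendsto' hlim key
  rwa [← smul_sub, norm_smul, Real.norm_of_nonneg t.coe_nonneg] at this

/-- First-order Taylor estimate for a contraction semigroup. -/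
theorem norm_semigroup_sub_sub_le {S : ℝ≥0 → E →L[ℝ] E} (hS : IsSemigroup S)
    (hM : ∀ s, ‖S s‖ ≤ 1) {t : ℝ≥0} {f y g : E} (hf : (f, y) ∈ generatorGraph S) {b : ℝ}
    (hb : ∀ s ≤ t, ‖S s g - g‖ ≤ b) :
    ‖S t f - f - (t : ℝ) • g‖ ≤ t * (‖y - g‖ + b) := by
  rcases eq_or_ne t 0 with rfl | ht
  · simp [hS.map_zero]
  have ht' : 0 < t := pos_iff_ne_zero.2 ht
  have key : ∀ n : ℕ, ‖S t f - f - (t : ℝ) • g‖ ≤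
      ‖((n : ℝ) + 1) • (S (t / (n + 1)) f - f) - (t : ℝ) • g‖ + t * b := by
    intro n
    set P := S (t / (n + 1)) with hP
    have e0 : S t f - f = ∑ k ∈ Finset.range (n + 1), (P ^ k) (P f - f) := by
      have := pow_apply_sub_pow_apply_eq_sum (Commute.one_right P) (n + 1) f
      rw [hS.eq_pow t n]
      simpa using this
    -- Each step contributes a one-step error, transported by a contraction, and the displacement of
    -- `g` under the semigroup up to that time.
    have e1 : S t f - f - (t : ℝ) • g = ∑ k ∈ Finset.range (n + 1),
        ((P ^ k) (P f - f - ((t : ℝ) / (n + 1)) • g) +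
          ((t : ℝ) / (n + 1)) • ((P ^ k) g - g)) := by
      rw [e0]
      simp only [map_sub, map_smul, smul_sub, Finset.sum_add_distrib, Finset.sum_sub_distrib,
        Finset.sum_const, Finset.card_range]
      rw [← Nat.cast_smul_eq_nsmul ℝ, smul_smul]
      have : ((n + 1 : ℕ) : ℝ) * (t / (n + 1)) = t := by push_cast; field_simp
      rw [this]; abel
    have hPk : ∀ k, ‖P ^ k‖ ≤ 1 := fun k => by rw [hP, hS.pow]; exact hM _
    rw [e1]
    refine (norm_sum_le _ _).trans ?_
    have : ∀ k ∈ Finset.range (n + 1), ‖(P ^ k) (P f - f - ((t : ℝ) / (n + 1)) • g) +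
          ((t : ℝ) / (n + 1)) • ((P ^ k) g - g)‖ ≤
        ‖P f - f - ((t : ℝ) / (n + 1)) • g‖ + (t / (n + 1)) * b := by
      intro k hk
      have hk' : k ≤ n := by simpa [Nat.lt_succ_iff] using hk
      refine (norm_add_le _ _).trans (add_le_add ?_ ?_)
      · refine ((P ^ k).le_opNorm _).trans ?_
        exact mul_le_of_le_one_left (norm_nonneg _) (hPk k)
      · rw [norm_smul, Real.norm_of_nonneg (by positivity)]
        gcongr
        rw [hP, hS.pow]
        apply hb
        rw [← mul_div_assoc]
        refine div_le_of_le_mul₀ zero_le zero_le ?_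
        rw [mul_comm]
        gcongr
        exact (Nat.cast_le.2 hk').trans (by simp)
    refine (Finset.sum_le_sum this).trans ?_
    rw [Finset.sum_const, Finset.card_range, nsmul_eq_mul]
    have e2 : ((n : ℝ) + 1) • (P f - f) - (t : ℝ) • g =
        ((n : ℝ) + 1) • (P f - f - ((t : ℝ) / (n + 1)) • g) := by
      rw [smul_sub _ (P f - f), smul_smul]; congr 2; field_simp
    rw [e2, norm_smul, Real.norm_of_nonneg (by positivity)]
    push_cast
    exact le_of_eq (by field_simp)
  have hlim := (((tendsto_smul_apply_sub hf ht').sub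
    (tendsto_const_nhds (x := (t : ℝ) • g))).norm.add_const (t * b))
  have := ge_of_tendsto' hlim key
  rwa [← smul_sub, norm_smul, Real.norm_of_nonneg t.coe_nonneg, ← mul_add] at this

theorem generatorGraph_sub {T : ℝ≥0 → E →L[ℝ] E} {p q : E × E} (hp : p ∈ generatorGraph T)
    (hq : q ∈ generatorGraph T) : p - q ∈ generatorGraph T := by
  refine (Tendsto.sub (show Tendsto _ _ _ from hp) (show Tendsto _ _ _ from hq)).congr fun t => ?_
  simp only [Prod.fst_sub, map_sub, ← smul_sub]
  congr 1; abel

theorem generatorGraph_map {T : ℝ≥0 → E →L[ℝ] E} (hT : IsSemigroup T) (t : ℝ≥0) {f g : E}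
    (h : (f, g) ∈ generatorGraph T) : (T t f, T t g) ∈ generatorGraph T := by
  refine (((T t).continuous.tendsto _).comp (show Tendsto _ _ _ from h)).congr fun s => ?_
  simp only [Function.comp, map_smul, map_sub]
  have : (T t).comp (T s) = (T s).comp (T t) := by rw [← hT.map_add, ← hT.map_add, add_comm]
  have := congrArg (fun A : E →L[ℝ] E => A f) this
  simp only [ContinuousLinearMap.comp_apply] at this
  rw [this]

/-- The generator of a contraction semigroup is dissipative. -/
theorem le_norm_smul_sub_of_mem_generatorGraph {T : ℝ≥0 → E →L[ℝ] E} (hT : ∀ t, ‖T t‖ ≤ 1)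
    {f g : E} (h : (f, g) ∈ generatorGraph T) {s : ℝ} (hs : 0 < s) :
    s * ‖f‖ ≤ ‖s • f - g‖ := by
  have h1 : Tendsto (fun t : ℝ≥0 => ‖s • f - (t : ℝ)⁻¹ • (T t f - f)‖) (𝓝[>] 0)
      (𝓝 ‖s • f - g‖) := (tendsto_const_nhds.sub (show Tendsto _ _ _ from h)).norm
  refine ge_of_tendsto h1 ?_
  filter_upwards [self_mem_nhdsWithin] with t ht
  have ht' : (0 : ℝ) < t := by exact_mod_cast (mem_Ioi.1 ht)
  have e : s • f - (t : ℝ)⁻¹ • (T t f - f) = (s + (t : ℝ)⁻¹) • f - (t : ℝ)⁻¹ • T t f := by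
    rw [smul_sub, add_smul]; abel
  have h2 : ‖T t f‖ ≤ ‖f‖ := by
    simpa using (T t).le_of_opNorm_le (hT t) f
  rw [e]
  refine le_trans ?_ (norm_sub_norm_le _ _)
  rw [norm_smul, norm_smul, Real.norm_of_nonneg (by positivity), Real.norm_of_nonneg (by positivity)]
  have : (t : ℝ)⁻¹ * ‖T t f‖ ≤ (t : ℝ)⁻¹ * ‖f‖ := by gcongr
  linarith [add_mul s (t : ℝ)⁻¹ ‖f‖]

/-! ### Exponentials as Poisson averages and Yosida approximation -/

section Exponential

variable [CompleteSpace E]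

/-- Splitting off the scalar factor `exp (-a)` exhibits `exp (a (J - 1))`, for `a ≥ 0`, as the
average of the powers of `J` under the Poisson law of mean `a`. -/
theorem hasSum_exp_smul_sub_one (J : E →L[ℝ] E) (a : ℝ) (x : E) :
    HasSum (fun k : ℕ => (Real.exp (-a) * (a ^ k / k.factorial)) • (J ^ k) x)
      (NormedSpace.exp (a • (J - 1)) x) := by
  let _ : NormedAlgebra ℚ (E →L[ℝ] E) := NormedAlgebra.restrictScalars ℚ ℝ _
  have h1 : a • (J - 1) = a • J + algebraMap ℝ (E →L[ℝ] E) (-a) := by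
    rw [smul_sub, Algebra.algebraMap_eq_smul_one, neg_smul, sub_eq_add_neg]
  have hc : Commute (a • J) (algebraMap ℝ (E →L[ℝ] E) (-a)) := (Algebra.commutes _ _).symm
  have h2 : NormedSpace.exp (a • (J - 1)) = Real.exp (-a) • NormedSpace.exp (a • J) := by
    rw [h1, NormedSpace.exp_add_of_commute hc, ← NormedSpace.algebraMap_exp_comm,
      ← Real.exp_eq_exp_ℝ, ← Algebra.commutes, ← Algebra.smul_def]
  have h3 := (NormedSpace.exp_series_hasSum_exp' (𝕂 := ℝ) (a • J)).const_smul (Real.exp (-a))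
  have h4 := h3.mapL (ContinuousLinearMap.apply ℝ E x)
  rw [h2]
  convert h4 using 1
  · ext k
    simp [smul_pow, smul_smul, div_eq_mul_inv, mul_assoc, mul_comm]
  · rfl

theorem sum_exp_weights_le_one {a : ℝ} (ha : 0 ≤ a) (N : ℕ) :
    ∑ k ∈ Finset.range N, Real.exp (-a) * (a ^ k / k.factorial) ≤ 1 := by
  rw [← Finset.mul_sum, Real.exp_neg, inv_mul_le_iff₀ (Real.exp_pos a), mul_one]
  exact Real.sum_le_exp_of_nonneg ha N

/-- Partial sums of the Poisson mean: shifting the index turns `k a ^ k / k!` into `a` times the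
preceding weight. -/
theorem sum_exp_weights_mul_le {a : ℝ} (ha : 0 ≤ a) (N : ℕ) :
    ∑ k ∈ Finset.range N, Real.exp (-a) * (a ^ k / k.factorial) * k ≤ a := by
  cases N with
  | zero => simpa using ha
  | succ N =>
    rw [Finset.sum_range_succ']
    have : ∀ k ∈ Finset.range N, Real.exp (-a) * (a ^ (k + 1) / (k + 1).factorial) * (k + 1 : ℕ) =
        a * (Real.exp (-a) * (a ^ k / k.factorial)) := by
      intro k _
      have h2 : ((k : ℝ) + 1) ≠ 0 := by positivity
      rw [Nat.factorial_succ]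
      push_cast
      field_simp
      ring
    rw [Finset.sum_congr rfl this, ← Finset.mul_sum]
    simpa using mul_le_of_le_one_right ha (sum_exp_weights_le_one ha N)

/-- A lower semicontinuous sublinear functional that grows by at most `c ‖x‖` under each
application of a contraction `J` grows by at most `a c ‖x‖` under `exp (a (J - 1))`. -/
theorem apply_exp_smul_sub_one_le {J : E →L[ℝ] E} (hJ : ‖J‖ ≤ 1) {p : E → ℝ≥0∞}
    (hp : LowerSemicontinuous p) (hadd : ∀ x y, p (x + y) ≤ p x + p y)
    (hsmul : ∀ (r : ℝ) (x : E), 0 ≤ r → p (r • x) ≤ ENNReal.ofReal r * p x) {c : ℝ} (hc : 0 ≤ c)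
    (hpJ : ∀ x, p (J x) ≤ p x + ENNReal.ofReal (c * ‖x‖)) {a : ℝ} (ha : 0 ≤ a) (x : E) :
    p (NormedSpace.exp (a • (J - 1)) x) ≤ p x + ENNReal.ofReal (a * (c * ‖x‖)) := by
  have hJk : ∀ k, ‖(J ^ k) x‖ ≤ ‖x‖ := by
    intro k
    induction k with
    | zero => simp
    | succ k ih =>
      rw [pow_succ']
      refine le_trans ?_ ih
      simpa using J.le_of_opNorm_le hJ ((J ^ k) x)
  have hpk : ∀ k : ℕ, p ((J ^ k) x) ≤ p x + ENNReal.ofReal (k * (c * ‖x‖)) := by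
    intro k
    induction k with
    | zero => simp
    | succ k ih =>
      rw [pow_succ']
      refine (hpJ ((J ^ k) x)).trans ((add_le_add_left ih _).trans ?_)
      rw [add_assoc, ← ENNReal.ofReal_add (by positivity) (by positivity)]
      gcongr
      have := mul_le_mul_of_nonneg_left (hJk k) hc
      rw [Nat.cast_succ]
      linarith
  have h0 : p 0 = 0 := by simpa using hsmul 0 0 le_rfl
  have hsum : ∀ N : ℕ, p (∑ k ∈ Finset.range N, (Real.exp (-a) * (a ^ k / k.factorial)) • (J ^ k) x)
      ≤ p x + ENNReal.ofReal (a * (c * ‖x‖)) := by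
    intro N
    have h1 : p (∑ k ∈ Finset.range N, (Real.exp (-a) * (a ^ k / k.factorial)) • (J ^ k) x) ≤
        ∑ k ∈ Finset.range N, p ((Real.exp (-a) * (a ^ k / k.factorial)) • (J ^ k) x) :=
      Finset.le_sum_of_subadditive p h0.le hadd _ _
    refine h1.trans ?_
    have h2 : ∀ k ∈ Finset.range N, p ((Real.exp (-a) * (a ^ k / k.factorial)) • (J ^ k) x) ≤
        ENNReal.ofReal (Real.exp (-a) * (a ^ k / k.factorial)) * p x +
        ENNReal.ofReal (Real.exp (-a) * (a ^ k / k.factorial) * k * (c * ‖x‖)) := by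
      intro k _
      refine (hsmul _ _ (by positivity)).trans ((mul_le_mul_right (hpk k) _).trans ?_)
      rw [mul_add, ← ENNReal.ofReal_mul (by positivity), ← mul_assoc]
    refine (Finset.sum_le_sum h2).trans ?_
    rw [Finset.sum_add_distrib, ← Finset.sum_mul, ← ENNReal.ofReal_sum_of_nonneg
      (fun k _ => by positivity), ← ENNReal.ofReal_sum_of_nonneg (fun k _ => by positivity),
      ← Finset.sum_mul]
    gcongr
    · refine mul_le_of_le_one_left' ?_
      exact ENNReal.ofReal_le_one.2 (sum_exp_weights_le_one ha N)
    · exact sum_exp_weights_mul_le ha N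
  -- Subadditivity controls only finite sums; lower semicontinuity passes the bound to the whole
  -- series.
  have ht := (hasSum_exp_smul_sub_one J a x).tendsto_sum_nat
  by_contra hcon
  push Not at hcon
  obtain ⟨N, hN⟩ := (ht.eventually (hp _ _ hcon)).exists
  exact absurd (hsum N) (not_le.2 hN)

theorem norm_exp_smul_sub_one_le {J : E →L[ℝ] E} (hJ : ‖J‖ ≤ 1) {a : ℝ} (ha : 0 ≤ a) :
    ‖NormedSpace.exp (a • (J - 1))‖ ≤ 1 := by
  refine ContinuousLinearMap.opNorm_le_bound _ zero_le_one fun x => ?_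
  have := apply_exp_smul_sub_one_le hJ (p := fun x => ‖x‖ₑ)
    (continuous_enorm.lowerSemicontinuous) enorm_add_le
    (fun r x hr => by rw [enorm_smul, Real.enorm_of_nonneg hr]) le_rfl
    (fun x => by
      have := J.le_of_opNorm_le hJ x
      rw [one_mul] at this
      simpa using enorm_le_iff_norm_le.2 this) ha x
  simp only [zero_mul, mul_zero, ENNReal.ofReal_zero, add_zero] at this
  simpa using enorm_le_iff_norm_le.1 this

/-- The semigroup generated by a bounded operator. -/
def expSemigroup (Y : E →L[ℝ] E) (t : ℝ≥0) : E →L[ℝ] E := NormedSpace.exp ((t : ℝ) • Y)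

theorem expSemigroup_isSemigroup (Y : E →L[ℝ] E) : IsSemigroup (expSemigroup Y) where
  map_zero := by simp [expSemigroup]; rfl
  map_add s t := by
    let _ : NormedAlgebra ℚ (E →L[ℝ] E) := NormedAlgebra.restrictScalars ℚ ℝ _
    unfold expSemigroup
    rw [NNReal.coe_add, add_smul, NormedSpace.exp_add_of_commute
      (((Commute.refl Y).smul_left _).smul_right _)]
    rfl

theorem mem_generatorGraph_expSemigroup (Y : E →L[ℝ] E) (f : E) :
    (f, Y f) ∈ generatorGraph (expSemigroup Y) := by
  have h := hasDerivAt_exp_smul_const (𝕂 := ℝ) Y (0 : ℝ)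
  have h2 := h.tendsto_slope_zero_right
  have h3 := ((ContinuousLinearMap.apply ℝ E f).continuous.tendsto _).comp h2
  have h4 : Tendsto (fun t : ℝ≥0 => (t : ℝ)) (𝓝[>] 0) (𝓝[>] 0) := by
    rw [tendsto_nhdsWithin_iff]
    refine ⟨(NNReal.continuous_coe.tendsto' 0 0 rfl).mono_left nhdsWithin_le_nhds, ?_⟩
    filter_upwards [self_mem_nhdsWithin] with t ht
    exact_mod_cast (mem_Ioi.1 ht)
  show Tendsto _ _ _
  simpa [Function.comp_def, expSemigroup] using h3.comp h4

/-- A family of resolvents of the dissipative operator with graph `A`, at points tending to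
infinity. -/
structure ResolventFamily (A : Submodule ℝ (E × E)) where
  point : ℕ → ℝ
  resolvent : ℕ → E →L[ℝ] E
  point_pos : ∀ n, 0 < point n
  tendsto_point : Tendsto point atTop atTop
  norm_le : ∀ n, ‖resolvent n‖ ≤ (point n)⁻¹
  mem : ∀ n h, (resolvent n h, point n • resolvent n h - h) ∈ A
  apply_smul_sub : ∀ n, ∀ p ∈ A, resolvent n (point n • p.1 - p.2) = p.1
  dense : Dense {f | ∃ g, (f, g) ∈ A}

namespace ResolventFamily

variable {A : Submodule ℝ (E × E)} (r : ResolventFamily A)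

/-- The operator `σ R(σ)`. -/
def scaled (n : ℕ) : E →L[ℝ] E := r.point n • r.resolvent n

/-- The Yosida approximation `σ (σ R(σ) - 1)`. -/
def yosida (n : ℕ) : E →L[ℝ] E := r.point n • (r.scaled n - 1)

theorem norm_scaled_le (n : ℕ) : ‖r.scaled n‖ ≤ 1 := by
  rw [scaled, norm_smul, Real.norm_of_nonneg (r.point_pos n).le]
  calc _ ≤ r.point n * (r.point n)⁻¹ := by gcongr; exacts [(r.point_pos n).le, r.norm_le n]
    _ = 1 := mul_inv_cancel₀ (r.point_pos n).ne'

theorem norm_expSemigroup_le (n : ℕ) (t : ℝ≥0) : ‖expSemigroup (r.yosida n) t‖ ≤ 1 := by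
  rw [expSemigroup, yosida, smul_smul]
  exact norm_exp_smul_sub_one_le (r.norm_scaled_le n) (mul_nonneg t.coe_nonneg (r.point_pos n).le)

/-- The resolvent identity, obtained by applying one resolvent to the equation solved by the other,
gives commutation when the two points differ; when they coincide it gives equality. -/
theorem commute_resolvent (m n : ℕ) : Commute (r.resolvent m) (r.resolvent n) := by
  have key : ∀ m n h, r.resolvent n ((r.point n - r.point m) • r.resolvent m h + h) =
      r.resolvent m h := by
    intro m n h
    refine Eq.trans ?_ (r.apply_smul_sub n _ (r.mem m h))
    congr 1
    module
  rcases eq_or_ne (r.point n) (r.point m) with h | h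
  · have : r.resolvent m = r.resolvent n := by
      ext x
      simpa [h] using (key m n x).symm
    rw [this]
  · ext x
    have h1 := key m n x
    have h2 := key n m x
    simp only [map_add, map_smul] at h1 h2
    have h3 : (r.point n - r.point m) • (r.resolvent n (r.resolvent m x) -
        r.resolvent m (r.resolvent n x)) = 0 := by
      calc _ = ((r.point n - r.point m) • r.resolvent n (r.resolvent m x) + r.resolvent n x -
              r.resolvent m x) + ((r.point m - r.point n) • r.resolvent m (r.resolvent n x) +
              r.resolvent m x - r.resolvent n x) := by module
        _ = 0 := by rw [h1, h2]; abel
    have := (smul_eq_zero.1 h3).resolve_left (sub_ne_zero.2 h)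
    simpa using (sub_eq_zero.1 this).symm

theorem commute_expSemigroup_of_commute {S : E →L[ℝ] E} {n : ℕ}
    (h : Commute S (r.resolvent n)) (t : ℝ≥0) : Commute S (expSemigroup (r.yosida n) t) := by
  let _ : NormedAlgebra ℚ (E →L[ℝ] E) := NormedAlgebra.restrictScalars ℚ ℝ _
  unfold expSemigroup yosida scaled
  exact ((((h.smul_right _).sub_right (Commute.one_right _)).smul_right _).smul_right _).exp_right

theorem commute_expSemigroup (m n : ℕ) (s t : ℝ≥0) :
    Commute (expSemigroup (r.yosida m) s) (expSemigroup (r.yosida n) t) :=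
  r.commute_expSemigroup_of_commute
    (r.commute_expSemigroup_of_commute (r.commute_resolvent n m) s).symm t

theorem scaled_apply_eq (n : ℕ) {f g : E} (h : (f, g) ∈ A) :
    r.scaled n f = f + r.resolvent n g := by
  have := r.apply_smul_sub n _ h
  simp only [map_sub, map_smul] at this
  simpa [scaled] using eq_add_of_sub_eq this

/-- On the domain `σ R(σ) f - f = R(σ) g` has size `O(1 / σ)`; density and contractivity extend the
convergence to all of `E`. -/
theorem tendsto_scaled (g : E) : Tendsto (fun n => r.scaled n g) atTop (𝓝 g) := by
  rw [Metric.tendsto_atTop]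
  intro ε hε
  obtain ⟨f, ⟨f', hf⟩, hfg⟩ := r.dense.exists_dist_lt g (ε := ε / 3) (by positivity)
  have h1 : Tendsto (fun n => (r.point n)⁻¹ * ‖f'‖) atTop (𝓝 0) := by
    simpa using r.tendsto_point.inv_tendsto_atTop.mul_const ‖f'‖
  obtain ⟨N, hN⟩ := (h1.eventually (gt_mem_nhds (show (0 : ℝ) < ε / 3 by positivity))).exists_forall_of_atTop
  refine ⟨N, fun n hn => ?_⟩
  have e : r.scaled n g - g = r.scaled n (g - f) + r.resolvent n f' - (g - f) := by
    rw [map_sub, r.scaled_apply_eq n hf]; abel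
  rw [dist_eq_norm] at hfg ⊢
  have b1 : ‖r.scaled n (g - f)‖ ≤ ‖g - f‖ := by
    simpa using (r.scaled n).le_of_opNorm_le (r.norm_scaled_le n) (g - f)
  have b2 : ‖r.resolvent n f'‖ ≤ (r.point n)⁻¹ * ‖f'‖ :=
    (r.resolvent n).le_of_opNorm_le (r.norm_le n) f'
  rw [e]
  have := norm_sub_le (r.scaled n (g - f) + r.resolvent n f') (g - f)
  have := norm_add_le (r.scaled n (g - f)) (r.resolvent n f')
  linarith [hN n hn]

theorem tendsto_yosida {f g : E} (h : (f, g) ∈ A) :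
    Tendsto (fun n => r.yosida n f) atTop (𝓝 g) := by
  refine (r.tendsto_scaled g).congr fun n => ?_
  rw [yosida, smul_apply, sub_apply, r.scaled_apply_eq n h]
  simp [scaled]

/-- For `f` in the domain the Yosida approximations of `f` converge, and two commuting contraction
semigroups differ at `f` by at most `t` times the difference of their generators at `f`.
Contractivity then gives the Cauchy property on the closure of the domain. -/
theorem exists_tendsto_expSemigroup (t : ℝ≥0) (f : E) :
    ∃ y, Tendsto (fun n => expSemigroup (r.yosida n) t f) atTop (𝓝 y) := by
  apply cauchySeq_tendsto_of_complete
  rw [Metric.cauchySeq_iff']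
  intro ε hε
  obtain ⟨f', ⟨g, hf⟩, hfg⟩ := r.dense.exists_dist_lt f (ε := ε / 3) (by positivity)
  have h1 := (r.tendsto_yosida hf).cauchySeq
  rw [Metric.cauchySeq_iff'] at h1
  obtain ⟨N, hN⟩ := h1 (ε / (3 * (t + 1))) (by positivity)
  refine ⟨N, fun n hn => ?_⟩
  have h2 := norm_semigroup_sub_le (expSemigroup_isSemigroup (r.yosida n))
    (expSemigroup_isSemigroup (r.yosida N)) (fun s => r.commute_expSemigroup n N s s) (t := t)
    (fun s _ => r.norm_expSemigroup_le n s) (fun s _ => r.norm_expSemigroup_le N s)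
    (mem_generatorGraph_expSemigroup (r.yosida n) f')
    (mem_generatorGraph_expSemigroup (r.yosida N) f')
  have h3 := hN n hn
  rw [dist_eq_norm] at hfg h3 ⊢
  have h4 : (t : ℝ) * ‖r.yosida n f' - r.yosida N f'‖ < ε / 3 := by
    calc _ ≤ ((t : ℝ) + 1) * ‖r.yosida n f' - r.yosida N f'‖ := by gcongr; linarith
      _ < ((t : ℝ) + 1) * (ε / (3 * (t + 1))) := by gcongr
      _ = ε / 3 := by field_simp
  have e : expSemigroup (r.yosida n) t f - expSemigroup (r.yosida N) t f =
      expSemigroup (r.yosida n) t (f - f') + (expSemigroup (r.yosida n) t f' -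
        expSemigroup (r.yosida N) t f') - expSemigroup (r.yosida N) t (f - f') := by
    simp only [map_sub]; abel
  have b := fun n => (expSemigroup (r.yosida n) t).le_of_opNorm_le (r.norm_expSemigroup_le n t)
    (f - f')
  have b1 := b n
  have b2 := b N
  rw [one_mul] at b1 b2
  rw [e]
  refine (norm_sub_le _ _).trans_lt ?_
  have := norm_add_le (expSemigroup (r.yosida n) t (f - f')) (expSemigroup (r.yosida n) t f' -
        expSemigroup (r.yosida N) t f')
  linarith

/-- The contraction semigroup generated by `A`. -/
def semigroup (t : ℝ≥0) : E →L[ℝ] E :=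
  continuousLinearMapOfTendsto (l := atTop) (fun n => expSemigroup (r.yosida n) t)
    (f := fun x => (r.exists_tendsto_expSemigroup t x).choose)
    (tendsto_pi_nhds.2 fun x => (r.exists_tendsto_expSemigroup t x).choose_spec)

theorem tendsto_semigroup (t : ℝ≥0) (f : E) :
    Tendsto (fun n => expSemigroup (r.yosida n) t f) atTop (𝓝 (r.semigroup t f)) :=
  (r.exists_tendsto_expSemigroup t f).choose_spec

theorem norm_semigroup_le (t : ℝ≥0) : ‖r.semigroup t‖ ≤ 1 := by
  refine ContinuousLinearMap.opNorm_le_bound _ zero_le_one fun f => ?_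
  exact le_of_tendsto' (r.tendsto_semigroup t f).norm fun n =>
    (expSemigroup (r.yosida n) t).le_of_opNorm_le (r.norm_expSemigroup_le n t) f

theorem semigroup_isSemigroup : IsSemigroup r.semigroup where
  map_zero := by
    ext f
    refine tendsto_nhds_unique (r.tendsto_semigroup 0 f) ?_
    simp [(expSemigroup_isSemigroup _).map_zero]
  map_add s t := by
    ext f
    refine tendsto_nhds_unique (r.tendsto_semigroup (s + t) f) ?_
    have h1 := r.tendsto_semigroup s (r.semigroup t f)
    have h2 : Tendsto (fun n => expSemigroup (r.yosida n) s (expSemigroup (r.yosida n) t f -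
        r.semigroup t f)) atTop (𝓝 0) := by
      refine squeeze_zero_norm (fun n => (expSemigroup (r.yosida n) s).le_of_opNorm_le
        (r.norm_expSemigroup_le n s) _) ?_
      simpa using (tendsto_iff_norm_sub_tendsto_zero.1 (r.tendsto_semigroup t f))
    have h3 := h2.add h1
    simp only [map_sub, sub_add_cancel, zero_add] at h3
    refine h3.congr fun n => ?_
    rw [(expSemigroup_isSemigroup _).map_add]; rfl

theorem norm_expSemigroup_sub_le (n : ℕ) (t : ℝ≥0) (f : E) :
    ‖expSemigroup (r.yosida n) t f - f‖ ≤ t * ‖r.yosida n f‖ := by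
  have := norm_semigroup_sub_sub_le (expSemigroup_isSemigroup (r.yosida n))
    (r.norm_expSemigroup_le n) (t := t) (mem_generatorGraph_expSemigroup (r.yosida n) f)
    (g := 0) (b := 0) (by simp)
  simpa using this

theorem norm_semigroup_sub_le {f g : E} (h : (f, g) ∈ A) (t : ℝ≥0) :
    ‖r.semigroup t f - f‖ ≤ t * ‖g‖ :=
  le_of_tendsto_of_tendsto' ((r.tendsto_semigroup t f).sub_const f).norm
    ((r.tendsto_yosida h).norm.const_mul _) fun n => r.norm_expSemigroup_sub_le n t f

theorem isC0Semigroup : IsC0Semigroup r.semigroup where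
  map_zero := r.semigroup_isSemigroup.map_zero
  map_add := r.semigroup_isSemigroup.map_add
  strongly_continuous f := by
    rw [Metric.tendsto_nhds]
    intro ε hε
    obtain ⟨f', ⟨g, hf⟩, hfg⟩ := r.dense.exists_dist_lt f (ε := ε / 3) (by positivity)
    have h1 : Tendsto (fun t : ℝ≥0 => (t : ℝ) * ‖g‖) (𝓝 0) (𝓝 0) :=
      (NNReal.continuous_coe.mul_const ‖g‖).tendsto' 0 0 (by simp)
    filter_upwards [h1.eventually (gt_mem_nhds (show (0 : ℝ) < ε / 3 by positivity))] with t ht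
    have b := (r.semigroup t).le_of_opNorm_le (r.norm_semigroup_le t) (f - f')
    have b2 := r.norm_semigroup_sub_le hf t
    rw [one_mul] at b
    rw [dist_eq_norm] at hfg ⊢
    have e : r.semigroup t f - f = r.semigroup t (f - f') + (r.semigroup t f' - f') - (f - f') := by
      rw [map_sub]; abel
    rw [e]
    refine (norm_sub_le _ _).trans_lt ?_
    have := norm_add_le (r.semigroup t (f - f')) (r.semigroup t f' - f')
    linarith

/-- The Taylor estimate must be uniform in `n`, so that the limit in `n` can be taken at fixed `t`
before `t` tends to `0`. As `g` need not lie in the domain, its displacement is controlled through a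
nearby element `f'` that does. -/
theorem subset_generatorGraph {f g : E} (h : (f, g) ∈ A) :
    (f, g) ∈ generatorGraph r.semigroup := by
  show Tendsto _ _ _
  rw [Metric.tendsto_nhds]
  intro ε hε
  obtain ⟨f', ⟨g', hf⟩, hfg⟩ := r.dense.exists_dist_lt g (ε := ε / 3) (by positivity)
  have h1 : Tendsto (fun t : ℝ≥0 => (t : ℝ) * ‖g'‖) (𝓝[>] 0) (𝓝 0) :=
    ((NNReal.continuous_coe.mul_const ‖g'‖).tendsto' 0 0 (by simp)).mono_left nhdsWithin_le_nhds
  filter_upwards [h1.eventually (gt_mem_nhds (show (0 : ℝ) < ε / 3 by positivity)),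
    self_mem_nhdsWithin] with t ht ht0
  have ht0' : (0 : ℝ) < t := by exact_mod_cast (mem_Ioi.1 ht0)
  have key : ∀ n, ‖expSemigroup (r.yosida n) t f - f - (t : ℝ) • g‖ ≤
      t * (‖r.yosida n f - g‖ + (2 * ‖g - f'‖ + t * ‖r.yosida n f'‖)) := by
    intro n
    refine norm_semigroup_sub_sub_le (expSemigroup_isSemigroup (r.yosida n))
      (r.norm_expSemigroup_le n) (mem_generatorGraph_expSemigroup (r.yosida n) f) fun s hs => ?_
    have b := (expSemigroup (r.yosida n) s).le_of_opNorm_le (r.norm_expSemigroup_le n s) (g - f')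
    rw [one_mul] at b
    have e : expSemigroup (r.yosida n) s g - g = expSemigroup (r.yosida n) s (g - f') +
      (expSemigroup (r.yosida n) s f' - f') - (g - f') := by
      rw [map_sub]; abel
    rw [e]
    have b3 : ‖expSemigroup (r.yosida n) s f' - f'‖ ≤ t * ‖r.yosida n f'‖ :=
      (r.norm_expSemigroup_sub_le n s f').trans (by gcongr)
    refine (norm_sub_le _ _).trans ?_
    have := norm_add_le (expSemigroup (r.yosida n) s (g - f'))
      (expSemigroup (r.yosida n) s f' - f')
    linarith
  have hlim : Tendsto (fun n => (t : ℝ) * (‖r.yosida n f - g‖ +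
      (2 * ‖g - f'‖ + t * ‖r.yosida n f'‖))) atTop
      (𝓝 ((t : ℝ) * (0 + (2 * ‖g - f'‖ + t * ‖g'‖)))) :=
    ((tendsto_iff_norm_sub_tendsto_zero.1 (r.tendsto_yosida h)).add
      (((r.tendsto_yosida hf).norm.const_mul _).const_add _)).const_mul _
  have hle := le_of_tendsto_of_tendsto' (((r.tendsto_semigroup t f).sub_const f).sub_const
    ((t : ℝ) • g)).norm hlim key
  rw [dist_eq_norm] at hfg ⊢
  have e : (t : ℝ)⁻¹ • (r.semigroup t f - f) - g = (t : ℝ)⁻¹ • (r.semigroup t f - f - (t : ℝ) • g) := by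
    rw [smul_sub _ _ ((t : ℝ) • g), smul_smul, inv_mul_cancel₀ ht0'.ne', one_smul]
  rw [e, norm_smul, norm_inv, Real.norm_of_nonneg ht0'.le, inv_mul_lt_iff₀ ht0']
  refine hle.trans_lt ?_
  gcongr
  linarith

/-- The generator extends `A` and is dissipative, while `A` already has full range at the resolvent
points; a dissipative extension of such a relation is trivial. -/
theorem generatorGraph_semigroup : generatorGraph r.semigroup = (A : Set (E × E)) := by
  refine Subset.antisymm ?_ fun p hp => r.subset_generatorGraph hp
  rintro ⟨f, g⟩ h
  have h1 := generatorGraph_sub h (r.subset_generatorGraph (r.mem 0 (r.point 0 • f - g)))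
  have h2 := le_norm_smul_sub_of_mem_generatorGraph r.norm_semigroup_le h1 (r.point_pos 0)
  set u := r.resolvent 0 (r.point 0 • f - g) with hu
  have e : r.point 0 • (f - u) - (g - (r.point 0 • u - (r.point 0 • f - g))) = 0 := by
    rw [smul_sub]; abel
  simp only at h2
  rw [e, norm_zero] at h2
  have h3 : ‖f - u‖ = 0 := le_antisymm (nonpos_of_mul_nonpos_right h2 (r.point_pos 0)) (norm_nonneg _)
  have h4 : f = u := sub_eq_zero.1 (norm_eq_zero.1 h3)
  have h5 := r.mem 0 (r.point 0 • f - g)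
  rw [← hu, ← h4] at h5
  simpa using h5

/-- `T t` maps the graph of its generator into itself, so it carries solutions of the resolvent
equation to solutions. -/
theorem commute_of_generatorGraph_eq {T : ℝ≥0 → E →L[ℝ] E} (hT : IsSemigroup T)
    (hA : generatorGraph T = (A : Set (E × E))) (t : ℝ≥0) (n : ℕ) :
    Commute (T t) (r.resolvent n) := by
  ext h
  have h1 : (r.resolvent n h, r.point n • r.resolvent n h - h) ∈ generatorGraph T := by
    rw [hA]; exact r.mem n h
  have h2 := generatorGraph_map hT t h1
  rw [hA] at h2
  have h3 := r.apply_smul_sub n _ h2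
  simp only [map_sub, map_smul, sub_sub_cancel] at h3
  simpa using h3.symm

end ResolventFamily

/-- If no neighbourhood of `0` carried a uniform bound, a sequence of times tending to `0` with
unbounded norms would contradict Banach–Steinhaus. The semigroup law extends the local bound to `[0,
t]`. -/
theorem IsC0Semigroup.exists_norm_le {T : ℝ≥0 → E →L[ℝ] E} (hT : IsC0Semigroup T) (t : ℝ≥0) :
    ∃ M, ∀ s ≤ t, ‖T s‖ ≤ M := by
  obtain ⟨δ, hδ, M, hM⟩ : ∃ δ : ℝ≥0, 0 < δ ∧ ∃ M, ∀ s ≤ δ, ‖T s‖ ≤ M := by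
    by_contra! hcon
    choose s hs hs' using fun n : ℕ => hcon (1 / ((n : ℝ≥0) + 1)) (by positivity) n
    have hs0 : Tendsto s atTop (𝓝 0) :=
      tendsto_of_tendsto_of_tendsto_of_le_of_le tendsto_const_nhds
        tendsto_one_div_add_atTop_nhds_zero_nat (fun _ => zero_le) hs
    obtain ⟨C, hC⟩ := banach_steinhaus (g := fun n => T (s n)) fun f => by
      obtain ⟨C, hC⟩ := ((hT.strongly_continuous f).comp hs0).norm.bddAbove_range
      exact ⟨C, fun n => hC ⟨n, rfl⟩⟩
    obtain ⟨n, hn⟩ := exists_nat_gt C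
    exact absurd (hn.trans (hs' n)) (not_lt.2 (hC n))
  obtain ⟨N, hN⟩ := exists_nat_gt (t / δ)
  refine ⟨(max M 1) ^ (N + 1), fun s hs => ?_⟩
  rw [hT.isSemigroup.eq_pow s N]
  refine (norm_pow_le' _ N.succ_pos).trans ?_
  gcongr
  refine le_trans (hM _ ?_) (le_max_left _ _)
  rw [div_le_iff₀ (by positivity)]
  rw [div_lt_iff₀ hδ] at hN
  calc s ≤ t := hs
    _ ≤ N * δ := hN.le
    _ ≤ δ * (N + 1) := by rw [mul_comm]; gcongr; simp

namespace ResolventFamily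

variable {A : Submodule ℝ (E × E)} (r : ResolventFamily A)

/-- A `C₀`-semigroup with generator `A` is the limit of the Yosida semigroups. -/
theorem tendsto_expSemigroup_of_generatorGraph_eq {T : ℝ≥0 → E →L[ℝ] E} (hT : IsC0Semigroup T)
    (hA : generatorGraph T = (A : Set (E × E))) (t : ℝ≥0) (f : E) :
    Tendsto (fun n => expSemigroup (r.yosida n) t f) atTop (𝓝 (T t f)) := by
  suffices r.semigroup t f = T t f by rw [← this]; exact r.tendsto_semigroup t f
  obtain ⟨M, hM⟩ := hT.exists_norm_le t
  refine congrFun (Continuous.ext_on r.dense (r.semigroup t).continuous (T t).continuous ?_) f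
  rintro f ⟨g, hf⟩
  refine tendsto_nhds_unique (r.tendsto_semigroup t f) (tendsto_iff_norm_sub_tendsto_zero.2 ?_)
  have hlim : Tendsto (fun n => M * 1 * ((t : ℝ) * ‖g - r.yosida n f‖)) atTop (𝓝 0) := by
    have := ((r.tendsto_yosida hf).const_sub g).norm.const_mul (t : ℝ) |>.const_mul (M * 1)
    simpa using this
  refine squeeze_zero (fun _ => norm_nonneg _) (fun n => ?_) hlim
  rw [norm_sub_rev]
  exact GrowthFrag.norm_semigroup_sub_le hT.isSemigroup (expSemigroup_isSemigroup (r.yosida n))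
    (fun s => r.commute_expSemigroup_of_commute
      (r.commute_of_generatorGraph_eq hT.isSemigroup hA s n) s) hM
    (fun s _ => r.norm_expSemigroup_le n s) (by rw [hA]; exact hf)
    (mem_generatorGraph_expSemigroup (r.yosida n) f)

/-- Growth of a lower semicontinuous sublinear functional along a semigroup, from its growth under
the resolvents of the generator. -/
theorem apply_semigroup_le (r : ResolventFamily A) {T : ℝ≥0 → E →L[ℝ] E} (hT : IsC0Semigroup T)
    (hA : generatorGraph T = (A : Set (E × E))) {p : E → ℝ≥0∞}
    (hp : LowerSemicontinuous p) (hadd : ∀ x y, p (x + y) ≤ p x + p y)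
    (hsmul : ∀ (c : ℝ) (x : E), 0 ≤ c → p (c • x) ≤ ENNReal.ofReal c * p x) {C : ℝ} (hC : 0 ≤ C)
    (hpr : ∀ᶠ s : ℝ in atTop, ∀ h, p h < ∞ → ∃ q ∈ A, s • q.1 - q.2 = h ∧
      p (s • q.1) ≤ p h + ENNReal.ofReal (C / s * ‖h‖)) (t : ℝ≥0) (f : E) :
    p (T t f) ≤ p f + ENNReal.ofReal (C * t * ‖f‖) := by
  by_contra hcon
  push Not at hcon
  have h1 := (r.tendsto_expSemigroup_of_generatorGraph_eq hT hA t f).eventually (hp _ _ hcon)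
  obtain ⟨n, hn1, hn2⟩ := (h1.and (r.tendsto_point.eventually hpr)).exists
  have hpos := r.point_pos n
  refine absurd hn1 (not_lt.2 ?_)
  unfold expSemigroup yosida
  rw [smul_smul]
  -- The Poisson mean is `t * r.point n` and each power costs `C / r.point n`, so the resolvent
  -- point disappears from the product.
  refine (apply_exp_smul_sub_one_le (r.norm_scaled_le n) hp hadd hsmul (c := C / r.point n)
    (by positivity) (fun h => ?_) (by positivity) f).trans_eq ?_
  · rcases eq_or_ne (p h) ∞ with hh | hh
    · simp [hh]
    obtain ⟨q, hq, hqh, hqp⟩ := hn2 h (lt_top_iff_ne_top.2 hh)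
    have : r.scaled n h = r.point n • q.1 := by
      rw [← r.apply_smul_sub n q hq, hqh]; rfl
    rw [this]
    exact hqp
  · congr 2
    field_simp

end ResolventFamily

/-- Dissipativity of a linear relation. -/
def IsDissipative (A : Submodule ℝ (E × E)) : Prop :=
  ∀ p ∈ A, ∀ s : ℝ, 0 < s → s * ‖p.1‖ ≤ ‖s • p.1 - p.2‖

theorem IsDissipative.topologicalClosure {A : Submodule ℝ (E × E)} (hA : IsDissipative A) :
    IsDissipative A.topologicalClosure := by
  intro p hp s hs
  have : IsClosed {p : E × E | s * ‖p.1‖ ≤ ‖s • p.1 - p.2‖} :=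
    isClosed_le (by fun_prop) (by fun_prop)
  exact closure_minimal (fun q hq => hA q hq s hs) this hp

/-- A dissipative relation whose range condition holds densely has a closure with full range. -/
theorem IsDissipative.exists_mem_topologicalClosure {A : Submodule ℝ (E × E)}
    (hA : IsDissipative A) {s : ℝ} (hs : 0 < s) (hr : Dense {h | ∃ q ∈ A, s • q.1 - q.2 = h})
    (h : E) : ∃ q ∈ A.topologicalClosure, s • q.1 - q.2 = h := by
  obtain ⟨u, hu, hlim⟩ := mem_closure_iff_seq_limit.1 (hr h)
  choose q hq hqu using hu
  -- Dissipativity turns the Cauchy property of the approximate right-hand sides into that of the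
  -- solutions, so the solutions converge and the closed relation contains the limit.
  have hC := hlim.cauchySeq
  have h1 : CauchySeq fun n => (q n).1 := by
    rw [Metric.cauchySeq_iff'] at hC ⊢
    intro ε hε
    obtain ⟨N, hN⟩ := hC (s * ε) (by positivity)
    refine ⟨N, fun n hn => ?_⟩
    have h2 := hA _ (A.sub_mem (hq n) (hq N)) s hs
    have h3 := hN n hn
    rw [dist_eq_norm] at h3 ⊢
    have e : s • (q n - q N).1 - (q n - q N).2 = u n - u N := by
      rw [← hqu, ← hqu]; simp only [Prod.fst_sub, Prod.snd_sub, smul_sub]; abel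
    rw [e] at h2
    exact lt_of_mul_lt_mul_left (h2.trans_lt h3) hs.le
  obtain ⟨f, hf⟩ := cauchySeq_tendsto_of_complete h1
  have h2 : Tendsto (fun n => (q n).2) atTop (𝓝 (s • f - h)) := by
    refine ((hf.const_smul s).sub hlim).congr fun n => ?_
    rw [← hqu]; abel
  refine ⟨(f, s • f - h), mem_closure_of_tendsto (hf.prodMk_nhds h2) (Eventually.of_forall hq), ?_⟩
  simp

/-- The resolvent of a dissipative relation with full range. -/
theorem IsDissipative.exists_resolvent {A : Submodule ℝ (E × E)} (hA : IsDissipative A) {s : ℝ}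
    (hs : 0 < s) (hr : ∀ h, ∃ q ∈ A, s • q.1 - q.2 = h) :
    ∃ R : E →L[ℝ] E, ‖R‖ ≤ s⁻¹ ∧ (∀ h, (R h, s • R h - h) ∈ A) ∧
      ∀ p ∈ A, R (s • p.1 - p.2) = p.1 := by
  choose q hq hqh using hr
  have huniq : ∀ p ∈ A, ∀ p' ∈ A, s • p.1 - p.2 = s • p'.1 - p'.2 → p.1 = p'.1 := by
    intro p hp p' hp' h
    have h2 := hA _ (A.sub_mem hp hp') s hs
    have e : s • (p - p').1 - (p - p').2 = 0 := by
      rw [← sub_eq_zero.2 h]; simp only [Prod.fst_sub, Prod.snd_sub, smul_sub]; abel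
    rw [e, norm_zero] at h2
    have h3 : ‖(p - p').1‖ = 0 := le_antisymm (nonpos_of_mul_nonpos_right h2 hs) (norm_nonneg _)
    exact sub_eq_zero.1 (norm_eq_zero.1 h3)
  let R : E →ₗ[ℝ] E :=
    { toFun := fun h => (q h).1
      map_add' := fun x y => huniq _ (hq _) _ (A.add_mem (hq x) (hq y)) (by
        rw [hqh, Prod.fst_add, Prod.snd_add, smul_add, add_sub_add_comm, hqh, hqh])
      map_smul' := fun c x => huniq _ (hq _) _ (A.smul_mem c (hq x)) (by
        rw [hqh, Prod.smul_fst, Prod.smul_snd, smul_comm, ← smul_sub, hqh]) }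
  refine ⟨R.mkContinuous s⁻¹ fun h => ?_, LinearMap.mkContinuous_norm_le _ (by positivity) _,
    fun h => ?_, fun p hp => huniq _ (hq _) _ hp (hqh _)⟩
  · have := hA _ (hq h) s hs
    rw [hqh] at this
    rwa [← div_eq_inv_mul, le_div_iff₀' hs]
  · have e : s • (q h).1 - h = (q h).2 := sub_eq_iff_eq_add'.2 (sub_eq_iff_eq_add.1 (hqh h))
    show ((q h).1, s • (q h).1 - h) ∈ A
    rw [e]; exact hq h

/-- Generation data for the closure of a densely defined dissipative relation. -/
theorem IsDissipative.nonempty_resolventFamily {A : Submodule ℝ (E × E)} (hA : IsDissipative A)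
    (hd : Dense {f | ∃ g, (f, g) ∈ A})
    (hr : ∀ᶠ s : ℝ in atTop, Dense {h | ∃ q ∈ A, s • q.1 - q.2 = h}) :
    Nonempty (ResolventFamily A.topologicalClosure) := by
  obtain ⟨s₀, hs₀⟩ := (hr.and (eventually_gt_atTop 0)).exists_forall_of_atTop
  have hpos : ∀ n : ℕ, 0 < s₀ + n := fun n => (hs₀ _ (by simp)).2
  choose R h1 h2 h3 using fun n : ℕ => hA.topologicalClosure.exists_resolvent (hpos n)
    (hA.exists_mem_topologicalClosure (hpos n) (hs₀ _ (by simp)).1)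
  exact ⟨⟨fun n => s₀ + n, R, hpos, tendsto_atTop_add_const_left _ _ tendsto_natCast_atTop_atTop,
    h1, h2, h3, hd.mono (by rintro f ⟨g, hg⟩; exact ⟨g, subset_closure hg⟩)⟩⟩

end Exponential

end AbstractSemigroup

end

end GrowthFrag

/-! ### The gain operator and its duality -/

namespace GrowthFrag

noncomputable section

/-- The nonnegative part of a function on the open half-line, extended by zero. -/
def pos (ψ : ℝ → ℝ) : ℝ → ℝ≥0∞ := (Ioi 0).indicator fun x => ENNReal.ofReal (ψ x)

theorem pos_of_pos (ψ : ℝ → ℝ) {x : ℝ} (hx : 0 < x) : pos ψ x = ENNReal.ofReal (ψ x) :=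
  indicator_of_mem (mem_Ioi.2 hx) _

theorem pos_of_nonpos (ψ : ℝ → ℝ) {x : ℝ} (hx : x ≤ 0) : pos ψ x = 0 :=
  indicator_of_notMem (by simpa using hx) _

theorem pos_ne_top (ψ : ℝ → ℝ) (x : ℝ) : pos ψ x ≠ ∞ := by
  rcases le_or_gt x 0 with hx | hx
  · simp [pos_of_nonpos _ hx]
  · simp [pos_of_pos _ hx]

theorem measurable_pos {ψ : ℝ → ℝ} (h : ContinuousOn ψ (Ioi 0)) : Measurable (pos ψ) := by
  have h1 : Measurable ((Ioi (0 : ℝ)).indicator ψ) := by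
    rw [← piecewise_eq_indicator]
    exact h.measurable_piecewise (continuousOn_const (c := (0 : ℝ))) measurableSet_Ioi
  have : pos ψ = fun x => ENNReal.ofReal ((Ioi (0 : ℝ)).indicator ψ x) := by
    ext x
    rcases le_or_gt x 0 with hx | hx
    · simp [pos_of_nonpos _ hx, hx]
    · simp [pos_of_pos _ hx, hx]
  rw [this]
  exact h1.ennreal_ofReal

theorem lintegral_pos_mul (ψ : ℝ → ℝ) (f : ℝ → ℝ≥0∞) :
    ∫⁻ x, pos ψ x * f x = ∫⁻ x in Ioi 0, ENNReal.ofReal (ψ x) * f x := by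
  rw [← lintegral_indicator measurableSet_Ioi]
  congr 1; ext x
  rcases le_or_gt x 0 with hx | hx
  · simp [pos_of_nonpos _ hx, hx]
  · simp [pos_of_pos _ hx, hx]

theorem pos_mono {ψ χ : ℝ → ℝ} (h : ∀ x, 0 < x → ψ x ≤ χ x) (x : ℝ) : pos ψ x ≤ pos χ x := by
  rcases le_or_gt x 0 with hx | hx
  · simp [pos_of_nonpos _ hx]
  · rw [pos_of_pos _ hx, pos_of_pos _ hx]; exact ENNReal.ofReal_le_ofReal (h x hx)

/-- The gain operator on nonnegative extended functions. -/
def gain (B : ℝ → ℝ) (κ : Measure ℝ) (f : ℝ → ℝ≥0∞) (x : ℝ) : ℝ≥0∞ :=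
  ∫⁻ z, pos B (x / z) * f (x / z) * ENNReal.ofReal (1 / z) ∂κ

/-- The dual gain operator on nonnegative extended functions. -/
def gainDual (B : ℝ → ℝ) (κ : Measure ℝ) (θ : ℝ → ℝ≥0∞) (y : ℝ) : ℝ≥0∞ :=
  pos B y * ∫⁻ z, θ (z * y) ∂κ

theorem IsFragKernel.ae_mem {κ : Measure ℝ} (hκ : IsFragKernel κ) : ∀ᵐ z ∂κ, z ∈ Ioo (0 : ℝ) 1 :=
  measure_eq_zero_iff_ae_notMem.1 hκ.concentrated |>.mono fun z hz => by simpa using hz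

theorem lintegral_comp_mul_left_pos (F : ℝ → ℝ≥0∞) {z : ℝ} (hz : 0 < z) :
    ∫⁻ x, F x = ENNReal.ofReal z * ∫⁻ y, F (z * y) := by
  have h := Real.smul_map_volume_mul_left hz.ne'
  have he : MeasurableEmbedding fun y : ℝ => z * y :=
    (Homeomorph.mulLeft₀ z hz.ne').measurableEmbedding
  conv_lhs => rw [← h]
  rw [lintegral_smul_measure, he.lintegral_map, abs_of_pos hz, smul_eq_mul]

section Gain

variable {B : ℝ → ℝ} {κ : Measure ℝ}

theorem measurable_gain (hB : IsFragRate B) (hκ : IsFragKernel κ) {f : ℝ → ℝ≥0∞}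
    (hf : Measurable f) : Measurable (gain B κ f) := by
  have := hκ.finite
  have hb := measurable_pos hB.continuousOn
  unfold gain
  refine Measurable.lintegral_prod_right' (f := fun p : ℝ × ℝ =>
    pos B (p.1 / p.2) * f (p.1 / p.2) * ENNReal.ofReal (1 / p.2)) ?_
  fun_prop

theorem measurable_gainDual (hB : IsFragRate B) (hκ : IsFragKernel κ) {θ : ℝ → ℝ≥0∞}
    (hθ : Measurable θ) : Measurable (gainDual B κ θ) := by
  have := hκ.finite
  have hb := measurable_pos hB.continuousOn
  unfold gainDual
  refine hb.mul (Measurable.lintegral_prod_right' (f := fun p : ℝ × ℝ => θ (p.2 * p.1)) ?_)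
  fun_prop

/-- Tonelli and the substitution `x = z * y`, whose Jacobian cancels the factor `1 / z`. Extended
nonnegative values allow its use before anything is known to be finite. -/
theorem lintegral_mul_gain (hB : IsFragRate B) (hκ : IsFragKernel κ) {θ f : ℝ → ℝ≥0∞}
    (hθ : Measurable θ) (hf : Measurable f) :
    ∫⁻ x, θ x * gain B κ f x = ∫⁻ y, gainDual B κ θ y * f y := by
  have := hκ.finite
  have hb := measurable_pos hB.continuousOn
  have e1 : ∀ x, θ x * gain B κ f x =
      ∫⁻ z, θ x * (pos B (x / z) * f (x / z) * ENNReal.ofReal (1 / z)) ∂κ := fun x => by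
    rw [gain, lintegral_const_mul]; fun_prop
  have e2 : ∀ y, gainDual B κ θ y * f y = ∫⁻ z, θ (z * y) * (pos B y * f y) ∂κ := fun y => by
    rw [gainDual, lintegral_mul_const _ (by fun_prop)]; ring
  simp_rw [e1, e2]
  rw [lintegral_lintegral_swap
    (f := fun x z => θ x * (pos B (x / z) * f (x / z) * ENNReal.ofReal (1 / z))) (by fun_prop),
    lintegral_lintegral_swap (f := fun y z => θ (z * y) * (pos B y * f y)) (by fun_prop)]
  refine lintegral_congr_ae ?_
  filter_upwards [hκ.ae_mem] with z hz
  rw [lintegral_comp_mul_left_pos _ hz.1, ← lintegral_const_mul _ (by fun_prop)]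
  refine lintegral_congr fun y => ?_
  rw [mul_div_cancel_left₀ _ hz.1.ne']
  have : ENNReal.ofReal z * ENNReal.ofReal (1 / z) = 1 := by
    rw [← ENNReal.ofReal_mul hz.1.le, mul_one_div_cancel hz.1.ne', ENNReal.ofReal_one]
  calc _ = (ENNReal.ofReal z * ENNReal.ofReal (1 / z)) * (θ (z * y) * (pos B y * f y)) := by ring
    _ = _ := by rw [this, one_mul]

theorem gain_mono {f g : ℝ → ℝ≥0∞} (h : ∀ x, f x ≤ g x) (x : ℝ) : gain B κ f x ≤ gain B κ g x :=
  lintegral_mono fun z => by gcongr; exact h _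

theorem gain_iSup (hB : IsFragRate B) {f : ℕ → ℝ → ℝ≥0∞} (hf : ∀ n, Measurable (f n))
    (hm : Monotone f) (x : ℝ) :
    gain B κ (fun x => ⨆ n, f n x) x = ⨆ n, gain B κ (f n) x := by
  have hb := measurable_pos hB.continuousOn
  unfold gain
  rw [← lintegral_iSup (fun n => by have := hf n; fun_prop)
    (fun m n h z => by dsimp only; gcongr; exact hm h _)]
  refine lintegral_congr fun z => ?_
  rw [ENNReal.mul_iSup, ENNReal.iSup_mul]

/-- Duality with the constant weight `1` shows that the gain of the indicator of a null set vanishes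
almost everywhere. This makes the gain operators well defined on classes of functions; the
alternative `B (x / z) = 0` is harmless, since the integrand vanishes there. -/
theorem ae_ae_div_of_ae (hB : IsFragRate B) (hκ : IsFragKernel κ) {P : ℝ → Prop}
    (h : ∀ᵐ y ∂halfLine, P y) :
    ∀ᵐ x ∂halfLine, ∀ᵐ z ∂κ, B (x / z) = 0 ∨ P (x / z) := by
  have := hκ.finite
  have hb := measurable_pos hB.continuousOn
  obtain ⟨N, hN, hNm, hN0⟩ := exists_measurable_superset_of_null (show halfLine {y | ¬ P y} = 0 from h)
  have hNm' : Measurable ((N ∩ Ioi 0).indicator (1 : ℝ → ℝ≥0∞)) :=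
    measurable_one.indicator (hNm.inter measurableSet_Ioi)
  have h1 : ∀ᵐ x, gain B κ ((N ∩ Ioi 0).indicator 1) x = 0 := by
    have := lintegral_mul_gain hB hκ (θ := fun _ => 1) measurable_const hNm'
    have h2 : ∫⁻ y, gainDual B κ (fun _ => 1) y * (N ∩ Ioi 0).indicator 1 y = 0 := by
      refine (lintegral_congr_ae ?_).trans lintegral_zero
      have h3 : volume (N ∩ Ioi 0) = 0 := by rwa [halfLine, Measure.restrict_apply hNm] at hN0
      filter_upwards [measure_eq_zero_iff_ae_notMem.1 h3] with y hy
      rw [indicator_of_notMem hy, mul_zero]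
    rw [h2] at this
    simp only [one_mul] at this
    exact (lintegral_eq_zero_iff (measurable_gain hB hκ hNm')).1 this
  filter_upwards [ae_restrict_of_ae h1, ae_restrict_mem measurableSet_Ioi] with x hx hx0
  have hx' := (lintegral_eq_zero_iff (by fun_prop)).1 hx
  filter_upwards [hx', hκ.ae_mem] with z hz hz1
  have hxz : 0 < x / z := div_pos hx0 hz1.1
  by_cases hm : x / z ∈ N
  · simp only [Pi.zero_apply, mul_eq_zero, ENNReal.ofReal_eq_zero] at hz
    rcases hz with (hz | hz) | hz
    · rw [pos_of_pos _ hxz, ENNReal.ofReal_eq_zero] at hz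
      exact Or.inl (le_antisymm hz (hB.nonneg _ hxz))
    · rw [indicator_of_mem (show x / z ∈ N ∩ Ioi 0 from ⟨hm, hxz⟩)] at hz; simp at hz
    · exact absurd hz (not_le.2 (one_div_pos.2 hz1.1))
  · right
    by_contra hne; exact hm (hN hne)

theorem gain_congr_ae (hB : IsFragRate B) (hκ : IsFragKernel κ) {f g : ℝ → ℝ≥0∞}
    (h : f =ᵐ[halfLine] g) : gain B κ f =ᵐ[halfLine] gain B κ g := by
  filter_upwards [ae_ae_div_of_ae hB hκ h, ae_restrict_mem measurableSet_Ioi] with x hx hx0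
  refine lintegral_congr_ae ?_
  filter_upwards [hx, hκ.ae_mem] with z hz hz1
  rcases hz with hz | hz
  · simp [pos_of_pos B (div_pos hx0 hz1.1), hz]
  · rw [hz]

theorem fragPlus_congr_ae (hB : IsFragRate B) (hκ : IsFragKernel κ) {f g : ℝ → ℝ}
    (h : f =ᵐ[halfLine] g) : fragPlus B κ f =ᵐ[halfLine] fragPlus B κ g := by
  filter_upwards [ae_ae_div_of_ae hB hκ h] with x hx
  refine integral_congr_ae ?_
  filter_upwards [hx] with z hz
  rcases hz with hz | hz
  · simp [hz]
  · rw [hz]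

theorem enorm_fragPlus_integrand (hB : IsFragRate B) {f : ℝ → ℝ} {x z : ℝ} (hx : 0 < x)
    (hz : z ∈ Ioo (0 : ℝ) 1) : ‖B (x / z) * f (x / z) / z‖ₑ =
      pos B (x / z) * ‖f (x / z)‖ₑ * ENNReal.ofReal (1 / z) := by
  have hxz : 0 < x / z := div_pos hx hz.1
  rw [div_eq_mul_one_div, enorm_mul, enorm_mul, Real.enorm_of_nonneg (hB.nonneg _ hxz),
    Real.enorm_of_nonneg (one_div_pos.2 hz.1).le, pos_of_pos _ hxz]

theorem lintegral_enorm_fragPlus_integrand (hB : IsFragRate B) (hκ : IsFragKernel κ) (f : ℝ → ℝ)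
    {x : ℝ} (hx : 0 < x) :
    ∫⁻ z, ‖B (x / z) * f (x / z) / z‖ₑ ∂κ = gain B κ (fun y => ‖f y‖ₑ) x :=
  lintegral_congr_ae (hκ.ae_mem.mono fun _ hz => enorm_fragPlus_integrand hB hx hz)

theorem enorm_fragPlus_le (hB : IsFragRate B) (hκ : IsFragKernel κ) (f : ℝ → ℝ) {x : ℝ}
    (hx : 0 < x) : ‖fragPlus B κ f x‖ₑ ≤ gain B κ (fun y => ‖f y‖ₑ) x := by
  rw [← lintegral_enorm_fragPlus_integrand hB hκ f hx]
  exact enorm_integral_le_lintegral_enorm _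

theorem aestronglyMeasurable_fragPlus_integrand (hB : IsFragRate B) (hκ : IsFragKernel κ)
    {f : ℝ → ℝ} (hf : Measurable f) {x : ℝ} (hx : 0 < x) :
    AEStronglyMeasurable (fun z => B (x / z) * f (x / z) / z) κ := by
  have hb := measurable_pos hB.continuousOn
  have : Measurable fun z => (pos B (x / z)).toReal * f (x / z) / z := by fun_prop
  refine this.aestronglyMeasurable.congr (hκ.ae_mem.mono fun z hz => ?_)
  have hxz : 0 < x / z := div_pos hx hz.1
  simp [pos_of_pos _ hxz, ENNReal.toReal_ofReal (hB.nonneg _ hxz)]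

theorem integrable_fragPlus_integrand (hB : IsFragRate B) (hκ : IsFragKernel κ) {f : ℝ → ℝ}
    (hf : Measurable f) {x : ℝ} (hx : 0 < x) (h : gain B κ (fun y => ‖f y‖ₑ) x < ∞) :
    Integrable (fun z => B (x / z) * f (x / z) / z) κ := by
  refine ⟨aestronglyMeasurable_fragPlus_integrand hB hκ hf hx, ?_⟩
  rwa [HasFiniteIntegral, lintegral_enorm_fragPlus_integrand hB hκ f hx]

theorem fragPlus_eq_toReal (hB : IsFragRate B) (hκ : IsFragKernel κ) {f : ℝ → ℝ}
    (hf : Measurable f) (h0 : ∀ y, 0 ≤ f y) {x : ℝ} (hx : 0 < x) :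
    fragPlus B κ f x = (gain B κ (fun y => ‖f y‖ₑ) x).toReal := by
  rw [← lintegral_enorm_fragPlus_integrand hB hκ f hx, fragPlus, integral_eq_lintegral_of_nonneg_ae]
  · congr 1
    refine lintegral_congr_ae (hκ.ae_mem.mono fun z hz => ?_)
    have hxz : 0 < x / z := div_pos hx hz.1
    exact (Real.enorm_of_nonneg (div_nonneg (mul_nonneg (hB.nonneg _ hxz) (h0 _)) hz.1.le)).symm
  · refine hκ.ae_mem.mono fun z hz => ?_
    have hxz : 0 < x / z := div_pos hx hz.1
    exact div_nonneg (mul_nonneg (hB.nonneg _ hxz) (h0 _)) hz.1.le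
  · exact aestronglyMeasurable_fragPlus_integrand hB hκ hf hx

/-- The total gain is finite almost everywhere when its integral against a positive weight is. -/
theorem gain_lt_top_ae (hB : IsFragRate B) (hκ : IsFragKernel κ) {θ f : ℝ → ℝ≥0∞}
    (hθ : Measurable θ) (hθ0 : ∀ x, 0 < x → θ x ≠ 0) (hf : Measurable f)
    (h : ∫⁻ y, gainDual B κ θ y * f y ≠ ∞) : ∀ᵐ x ∂halfLine, gain B κ f x < ∞ := by
  rw [← lintegral_mul_gain hB hκ hθ hf] at h
  have h1 := ae_lt_top (hθ.mul (measurable_gain hB hκ hf)) h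
  filter_upwards [ae_restrict_of_ae h1, ae_restrict_mem measurableSet_Ioi] with x hx hx0
  by_contra hcon
  rw [not_lt, top_le_iff] at hcon
  simp [hcon, ENNReal.mul_top (hθ0 x hx0)] at hx

end Gain

end

end GrowthFrag

/-! ### Integrating factors and Duhamel's formula -/

namespace GrowthFrag

noncomputable section

/-- Integration by parts for two primitives. -/
theorem integral_mul_primitive {u w U W : ℝ → ℝ} {a b : ℝ}
    (hu : IntervalIntegrable u volume a b) (hw : IntervalIntegrable w volume a b)
    (hU : ∀ x ∈ uIcc a b, U x = U a + ∫ t in a..x, u t)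
    (hW : ∀ x ∈ uIcc a b, W x = W a + ∫ t in a..x, w t) :
    ∫ x in a..b, (u x * W x + U x * w x) = U b * W b - U a * W a := by
  have acU := (hu.absolutelyContinuousOnInterval_intervalIntegral (c := a) (by simp))
  have acW := (hw.absolutelyContinuousOnInterval_intervalIntegral (c := a) (by simp))
  have cc : ∀ k : ℝ, AbsolutelyContinuousOnInterval (fun _ : ℝ => k) a b := fun k =>
    (contDiff_const.contDiffOn (s := uIcc a b) (n := 1)).absolutelyContinuousOnInterval
  have h := ((cc (U a)).fun_add acU).integral_deriv_mul_eq_sub ((cc (W a)).fun_add acW)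
  rw [← hU b right_mem_uIcc, ← hW b right_mem_uIcc, ← hU a left_mem_uIcc,
    ← hW a left_mem_uIcc] at h
  rw [← h]
  refine intervalIntegral.integral_congr_ae ?_
  filter_upwards [hu.ae_hasDerivAt_integral, hw.ae_hasDerivAt_integral] with x hx1 hx2 hx
  have hx' := uIoc_subset_uIcc hx
  rw [((hx1 hx' a (by simp)).const_add (U a)).deriv, ((hx2 hx' a (by simp)).const_add (W a)).deriv,
    ← hU x hx', ← hW x hx']

/-- A continuous function that is differentiable on the open interval with integrable derivative is
a primitive. -/
theorem eq_add_integral_of_hasDerivAt {F F' : ℝ → ℝ} {a b : ℝ} (hab : a ≤ b)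
    (hc : ContinuousOn F (Icc a b)) (hd : ∀ x ∈ Ioo a b, HasDerivAt F (F' x) x)
    (hi : IntervalIntegrable F' volume a b) :
    ∀ x ∈ uIcc a b, F x = F a + ∫ t in a..x, F' t := by
  intro x hx
  rw [uIcc_of_le hab] at hx
  rw [intervalIntegral.integral_eq_sub_of_hasDerivAt_of_le hx.1
    (hc.mono (Icc_subset_Icc_right hx.2)) (fun y hy => hd y ⟨hy.1, hy.2.trans_le hx.2⟩)
    (hi.mono_set (by rw [uIcc_of_le hab, uIcc_of_le hx.1]; exact Icc_subset_Icc_right hx.2))]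
  ring

theorem IsGrowthRate.continuousOn {τ : ℝ → ℝ} (hτ : IsGrowthRate τ) : ContinuousOn τ (Ioi 0) :=
  hτ.contDiffOn.continuousOn

theorem IsFragRate.exists_le {B : ℝ → ℝ} (hB : IsFragRate B) (X : ℝ) :
    ∃ b, 0 ≤ b ∧ ∀ x, 0 < x → x ≤ X → B x ≤ b := by
  obtain ⟨γ₀, γ₁, B₀, B₁, x₀, h0, h01, hB0, hB01, hx0, hlo, hhi⟩ := hB.bounds
  have hB1 : 0 < B₁ := hB0.trans_le hB01
  refine ⟨B₁ * max 1 (X ^ γ₁), by positivity, fun x hx hxX => (hhi x hx).trans ?_⟩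
  have : 0 < γ₁ := h0.trans_le h01
  gcongr

/-- The logarithmic growth factor `∫₀ˣ (c + B) / τ`. -/
def logGrowth (τ B : ℝ → ℝ) (c : ℝ) (x : ℝ) : ℝ := ∫ y in (0 : ℝ)..x, (c + B y) / τ y

section Growth

variable {τ B : ℝ → ℝ} (c : ℝ)

theorem IsGrowthRate.integrableOn_inv (hτ : IsGrowthRate τ) (X : ℝ) :
    IntegrableOn (fun x => 1 / τ x) (Ioc 0 X) := by
  have h1 : IntegrableOn (fun x => 1 / τ x) (Icc 1 X) := by
    refine ContinuousOn.integrableOn_Icc ?_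
    refine continuousOn_const.div (hτ.continuousOn.mono fun x hx => ?_) fun x hx => ?_
    · exact zero_lt_one.trans_le hx.1
    · exact (hτ.pos x (zero_lt_one.trans_le hx.1)).ne'
  refine (hτ.inv_integrable.union h1).mono_set fun x hx => ?_
  rcases lt_or_ge x 1 with h | h
  · exact Or.inl ⟨hx.1, h⟩
  · exact Or.inr ⟨h, hx.2⟩

theorem integrableOn_growth (hτ : IsGrowthRate τ) (hB : IsFragRate B) (X : ℝ) :
    IntegrableOn (fun x => (c + B x) / τ x) (Ioc 0 X) := by
  obtain ⟨b, hb0, hb⟩ := hB.exists_le X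
  have hc : ContinuousOn (fun x => c + B x) (Ioi 0) := continuousOn_const.add hB.continuousOn
  have h2 : AEStronglyMeasurable (fun x => c + B x) (volume.restrict (Ioc 0 X)) :=
    (hc.mono fun x hx => hx.1).aestronglyMeasurable measurableSet_Ioc
  have h3 := (hτ.integrableOn_inv X).bdd_mul (c := |c| + b) h2 (by
    refine (ae_restrict_mem measurableSet_Ioc).mono fun x hx => ?_
    refine (norm_add_le _ _).trans ?_
    rw [Real.norm_eq_abs, Real.norm_eq_abs, abs_of_nonneg (hB.nonneg x hx.1)]
    gcongr; exact hb x hx.1 hx.2)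
  refine h3.congr (ae_of_all _ fun x => ?_)
  simp [div_eq_mul_inv]

theorem intervalIntegrable_growth (hτ : IsGrowthRate τ) (hB : IsFragRate B) {X : ℝ} (hX : 0 ≤ X) :
    IntervalIntegrable (fun x => (c + B x) / τ x) volume 0 X :=
  (intervalIntegrable_iff_integrableOn_Ioc_of_le hX).2 (integrableOn_growth c hτ hB X)

theorem logGrowth_zero : logGrowth τ B c 0 = 0 := by simp [logGrowth]

theorem continuousOn_logGrowth_Icc (hτ : IsGrowthRate τ) (hB : IsFragRate B) {X : ℝ} (hX : 0 ≤ X) :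
    ContinuousOn (logGrowth τ B c) (Icc 0 X) := by
  have := intervalIntegral.continuousOn_primitive_interval (μ := volume) (a := 0) (b := X)
    (f := fun x => (c + B x) / τ x)
    (by rw [uIcc_of_le hX, integrableOn_Icc_iff_integrableOn_Ioc]; exact integrableOn_growth c hτ hB X)
  rwa [uIcc_of_le hX] at this

theorem hasDerivAt_logGrowth (hτ : IsGrowthRate τ) (hB : IsFragRate B) {x : ℝ} (hx : 0 < x) :
    HasDerivAt (logGrowth τ B c) ((c + B x) / τ x) x := by
  have hc : ContinuousOn (fun x => (c + B x) / τ x) (Ioi 0) :=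
    (continuousOn_const.add hB.continuousOn).div hτ.continuousOn fun y hy => (hτ.pos y hy).ne'
  refine intervalIntegral.integral_hasDerivAt_right (intervalIntegrable_growth c hτ hB hx.le)
    (hc.stronglyMeasurableAtFilter isOpen_Ioi x hx) (hc.continuousAt (Ioi_mem_nhds hx))

theorem continuousOn_logGrowth (hτ : IsGrowthRate τ) (hB : IsFragRate B) :
    ContinuousOn (logGrowth τ B c) (Ioi 0) := fun _ hx =>
  (hasDerivAt_logGrowth c hτ hB hx).continuousAt.continuousWithinAt

theorem hasDerivAt_exp_logGrowth (hτ : IsGrowthRate τ) (hB : IsFragRate B) {x : ℝ} (hx : 0 < x) :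
    HasDerivAt (fun y => Real.exp (logGrowth τ B c y))
      (Real.exp (logGrowth τ B c x) * ((c + B x) / τ x)) x :=
  (hasDerivAt_logGrowth c hτ hB hx).exp

theorem hasDerivAt_exp_neg_logGrowth (hτ : IsGrowthRate τ) (hB : IsFragRate B) {x : ℝ}
    (hx : 0 < x) : HasDerivAt (fun y => Real.exp (-logGrowth τ B c y))
      (Real.exp (-logGrowth τ B c x) * (-((c + B x) / τ x))) x :=
  (hasDerivAt_logGrowth c hτ hB hx).neg.exp

theorem exp_logGrowth_eq (hτ : IsGrowthRate τ) (hB : IsFragRate B) {X : ℝ} (hX : 0 ≤ X) :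
    IntervalIntegrable (fun x => Real.exp (logGrowth τ B c x) * ((c + B x) / τ x)) volume 0 X ∧
    ∀ x ∈ uIcc 0 X, Real.exp (logGrowth τ B c x) = Real.exp (logGrowth τ B c 0) +
      ∫ t in (0 : ℝ)..x, Real.exp (logGrowth τ B c t) * ((c + B t) / τ t) := by
  have hc := (continuousOn_logGrowth_Icc c hτ hB hX).rexp
  have hi := (intervalIntegrable_growth c hτ hB hX).continuousOn_mul (by rwa [uIcc_of_le hX])
  exact ⟨hi, eq_add_integral_of_hasDerivAt hX hc
    (fun x hx => hasDerivAt_exp_logGrowth c hτ hB hx.1) hi⟩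

theorem exp_neg_logGrowth_eq (hτ : IsGrowthRate τ) (hB : IsFragRate B) {X : ℝ} (hX : 0 ≤ X) :
    IntervalIntegrable (fun x => Real.exp (-logGrowth τ B c x) * (-((c + B x) / τ x))) volume 0 X ∧
    ∀ x ∈ uIcc 0 X, Real.exp (-logGrowth τ B c x) = Real.exp (-logGrowth τ B c 0) +
      ∫ t in (0 : ℝ)..x, Real.exp (-logGrowth τ B c t) * (-((c + B t) / τ t)) := by
  have hc := (continuousOn_logGrowth_Icc c hτ hB hX).neg.rexp
  have hi := (intervalIntegrable_growth c hτ hB hX).neg.continuousOn_mul (by rwa [uIcc_of_le hX])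
  exact ⟨hi, eq_add_integral_of_hasDerivAt hX hc
    (fun x hx => hasDerivAt_exp_neg_logGrowth c hτ hB hx.1) hi⟩

/-- The solution of `(τ f)' + (c + B) f = g` with zero flux at the origin. -/
theorem HasFluxDeriv.of_duhamel (hτ : IsGrowthRate τ) (hB : IsFragRate B) {f g : ℝ → ℝ}
    (hg : ∀ x, 0 < x → IntegrableOn g (Ioc 0 x))
    (hf : ∀ᵐ x ∂halfLine, f x = Real.exp (-logGrowth τ B c x) / τ x *
      ∫ y in Ioc 0 x, Real.exp (logGrowth τ B c y) * g y) :
    HasFluxDeriv τ f (fun x => g x - (c + B x) * f x) := by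
  set P : ℝ → ℝ := fun x => ∫ y in (0 : ℝ)..x, Real.exp (logGrowth τ B c y) * g y with hP
  have hgi : ∀ X, 0 < X → IntervalIntegrable
      (fun y => Real.exp (logGrowth τ B c y) * g y) volume 0 X := fun X hX =>
    ((intervalIntegrable_iff_integrableOn_Ioc_of_le hX.le).2 (hg X hX)).continuousOn_mul
      (by rw [uIcc_of_le hX.le]; exact (continuousOn_logGrowth_Icc c hτ hB hX.le).rexp)
  have hfP : ∀ᵐ x ∂halfLine, (c + B x) * f x =
      (c + B x) / τ x * (Real.exp (-logGrowth τ B c x) * P x) := by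
    filter_upwards [hf, ae_restrict_mem measurableSet_Ioi] with x hx hx0
    rw [hx, hP]; simp only; rw [intervalIntegral.integral_of_le (le_of_lt hx0)]; ring
  have hPc : ∀ X, 0 < X → ContinuousOn P (Icc 0 X) := fun X hX => by
    have h := (intervalIntegrable_iff_integrableOn_Ioc_of_le hX.le).1 (hgi X hX)
    rw [← integrableOn_Icc_iff_integrableOn_Ioc, ← uIcc_of_le hX.le] at h
    have := intervalIntegral.continuousOn_primitive_interval h
    rwa [uIcc_of_le hX.le] at this
  have hint : ∀ X, 0 < X → IntervalIntegrable
      (fun x => (c + B x) / τ x * (Real.exp (-logGrowth τ B c x) * P x)) volume 0 X := fun X hX =>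
    (intervalIntegrable_growth c hτ hB hX.le).mul_continuousOn (by
      rw [uIcc_of_le hX.le]; exact (continuousOn_logGrowth_Icc c hτ hB hX.le).neg.rexp.mul (hPc X hX))
  have hres : ∀ X, Ioc 0 X ⊆ Ioi (0 : ℝ) := fun X x hx => hx.1
  have hint' : ∀ X, 0 < X → IntegrableOn (fun x => (c + B x) * f x) (Ioc 0 X) := fun X hX =>
    ((intervalIntegrable_iff_integrableOn_Ioc_of_le hX.le).1 (hint X hX)).congr
      ((ae_restrict_of_ae_restrict_of_subset (hres X) hfP).mono fun x hx => hx.symm)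
  refine ⟨fun X hX => (hg X hX).sub (hint' X hX), ?_⟩
  filter_upwards [hf, ae_restrict_mem measurableSet_Ioi] with X hX hX0
  have hX0' : 0 < X := hX0
  obtain ⟨hi, he⟩ := exp_neg_logGrowth_eq c hτ hB hX0'.le
  -- The flux is the primitive `P` times the decaying exponential; integrating the product rule
  -- recovers it as the primitive of `g - (c + B) f`.
  have hparts := integral_mul_primitive (U := P) (hgi X hX0') hi (fun x _ => by simp [hP]) he
  have hlhs : τ X * f X = P X * Real.exp (-logGrowth τ B c X) := by
    rw [hX, hP]; simp only
    rw [intervalIntegral.integral_of_le hX0'.le]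
    have := (hτ.pos X hX0').ne'
    field_simp
  have hP0 : P 0 = 0 := by simp [hP]
  rw [hP0, zero_mul, sub_zero] at hparts
  rw [hlhs, ← hparts, intervalIntegral.integral_of_le hX0'.le]
  refine integral_congr_ae ((ae_restrict_of_ae_restrict_of_subset (hres X) hfP).mono fun x hx => ?_)
  simp only
  rw [hx]
  have : Real.exp (logGrowth τ B c x) * Real.exp (-logGrowth τ B c x) = 1 := by
    rw [← Real.exp_add]; simp
  linear_combination g x * this

/-- Duhamel's formula. -/
theorem HasFluxDeriv.duhamel (hτ : IsGrowthRate τ) (hB : IsFragRate B) {f d : ℝ → ℝ}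
    (h : HasFluxDeriv τ f d) :
    (∀ x, 0 < x → IntegrableOn (fun y => d y + (c + B y) * f y) (Ioc 0 x)) ∧
    ∀ᵐ x ∂halfLine, f x = Real.exp (-logGrowth τ B c x) / τ x *
      ∫ y in Ioc 0 x, Real.exp (logGrowth τ B c y) * (d y + (c + B y) * f y) := by
  set V : ℝ → ℝ := fun x => ∫ y in (0 : ℝ)..x, d y with hV
  have hdi : ∀ X, 0 < X → IntervalIntegrable d volume 0 X := fun X hX =>
    (intervalIntegrable_iff_integrableOn_Ioc_of_le hX.le).2 (h.1 X hX)
  have hVc : ∀ X, 0 < X → ContinuousOn V (Icc 0 X) := fun X hX => by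
    have h := h.1 X hX
    rw [← integrableOn_Icc_iff_integrableOn_Ioc, ← uIcc_of_le hX.le] at h
    have := intervalIntegral.continuousOn_primitive_interval h
    rwa [uIcc_of_le hX.le] at this
  have hfV : ∀ᵐ x ∂halfLine, (c + B x) * f x = (c + B x) / τ x * V x := by
    filter_upwards [h.2, ae_restrict_mem measurableSet_Ioi] with x hx hx0
    have hx0' : 0 < x := hx0
    rw [hV]; simp only
    rw [intervalIntegral.integral_of_le hx0'.le, ← hx]
    have := (hτ.pos x hx0').ne'
    field_simp
  have hint : ∀ X, 0 < X → IntervalIntegrable (fun x => (c + B x) / τ x * V x) volume 0 X :=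
    fun X hX => (intervalIntegrable_growth c hτ hB hX.le).mul_continuousOn (by
      rw [uIcc_of_le hX.le]; exact hVc X hX)
  have hres : ∀ X, Ioc 0 X ⊆ Ioi (0 : ℝ) := fun X x hx => hx.1
  have hint' : ∀ X, 0 < X → IntegrableOn (fun x => (c + B x) * f x) (Ioc 0 X) := fun X hX =>
    ((intervalIntegrable_iff_integrableOn_Ioc_of_le hX.le).1 (hint X hX)).congr
      ((ae_restrict_of_ae_restrict_of_subset (hres X) hfV).mono fun x hx => hx.symm)
  refine ⟨fun X hX => (h.1 X hX).add (hint' X hX), ?_⟩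
  filter_upwards [h.2, ae_restrict_mem measurableSet_Ioi] with X hX hX0
  have hX0' : 0 < X := hX0
  obtain ⟨hi, he⟩ := exp_logGrowth_eq c hτ hB hX0'.le
  have hparts := integral_mul_primitive (U := V) (hdi X hX0') hi (fun x _ => by simp [hV]) he
  have hV0 : V 0 = 0 := by simp [hV]
  rw [hV0, zero_mul, sub_zero, intervalIntegral.integral_of_le hX0'.le] at hparts
  have e2 : ∫ y in Ioc 0 X, Real.exp (logGrowth τ B c y) * (d y + (c + B y) * f y) =
      V X * Real.exp (logGrowth τ B c X) := by
    rw [← hparts]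
    refine integral_congr_ae ((ae_restrict_of_ae_restrict_of_subset (hres X) hfV).mono fun x hx => ?_)
    simp only
    rw [hx]; ring
  have e3 : τ X * f X = V X := by rw [hX, hV]; simp only; rw [intervalIntegral.integral_of_le hX0'.le]
  have : Real.exp (logGrowth τ B c X) * Real.exp (-logGrowth τ B c X) = 1 := by
    rw [← Real.exp_add]; simp
  rw [e2, ← e3]
  have hne := (hτ.pos X hX0').ne'
  field_simp
  linear_combination (-(f X)) * this

end Growth

end

end GrowthFrag

/-! ### The solution operator on nonnegative functions -/

namespace GrowthFrag

noncomputable section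

/-- The solution operator of `(τ f)' + (c + B) f = g` on nonnegative extended functions. -/
def solve (τ B : ℝ → ℝ) (c : ℝ) (g : ℝ → ℝ≥0∞) (x : ℝ) : ℝ≥0∞ :=
  pos (fun x => Real.exp (-logGrowth τ B c x) / τ x) x *
    ∫⁻ y in Iic x, pos (fun y => Real.exp (logGrowth τ B c y)) y * g y

section Solve

variable {τ B : ℝ → ℝ} {c : ℝ}

theorem measurable_pos_exp (hτ : IsGrowthRate τ) (hB : IsFragRate B) :
    Measurable (pos fun y => Real.exp (logGrowth τ B c y)) :=
  measurable_pos (continuousOn_logGrowth c hτ hB).rexp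

theorem measurable_pos_exp_neg_div (hτ : IsGrowthRate τ) (hB : IsFragRate B) :
    Measurable (pos fun x => Real.exp (-logGrowth τ B c x) / τ x) :=
  measurable_pos ((continuousOn_logGrowth c hτ hB).neg.rexp.div hτ.continuousOn
    fun y hy => (hτ.pos y hy).ne')

theorem solve_eq_lintegral (g : ℝ → ℝ≥0∞) (x : ℝ) : solve τ B c g x =
    pos (fun x => Real.exp (-logGrowth τ B c x) / τ x) x *
    ∫⁻ y, (Ici y).indicator 1 x * (pos (fun y => Real.exp (logGrowth τ B c y)) y * g y) := by
  rw [solve, ← lintegral_indicator measurableSet_Iic]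
  congr 1
  refine lintegral_congr fun y => ?_
  by_cases h : y ≤ x <;> simp [indicator, h]

theorem measurable_indicator_Ici : Measurable fun p : ℝ × ℝ => (Ici p.2).indicator (1 : ℝ → ℝ≥0∞) p.1 := by
  have : (fun p : ℝ × ℝ => (Ici p.2).indicator (1 : ℝ → ℝ≥0∞) p.1) =
      {p : ℝ × ℝ | p.2 ≤ p.1}.indicator 1 := by
    ext p; simp [indicator]
  rw [this]
  exact measurable_one.indicator (measurableSet_le measurable_snd measurable_fst)

theorem measurable_solve (hτ : IsGrowthRate τ) (hB : IsFragRate B) {g : ℝ → ℝ≥0∞}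
    (hg : Measurable g) : Measurable (solve τ B c g) := by
  have h1 := measurable_pos_exp (c := c) hτ hB
  have h2 := measurable_pos_exp_neg_div (c := c) hτ hB
  have h3 := measurable_indicator_Ici
  have : solve τ B c g = fun x => _ := funext fun x => solve_eq_lintegral g x
  rw [this]
  refine h2.mul (Measurable.lintegral_prod_right' (f := fun p : ℝ × ℝ =>
    (Ici p.2).indicator 1 p.1 * (pos (fun y => Real.exp (logGrowth τ B c y)) p.2 * g p.2)) ?_)
  fun_prop

theorem solve_mono {f g : ℝ → ℝ≥0∞} (h : ∀ x, f x ≤ g x) (x : ℝ) :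
    solve τ B c f x ≤ solve τ B c g x := by
  unfold solve
  gcongr
  exact h _

theorem solve_iSup (hτ : IsGrowthRate τ) (hB : IsFragRate B) {g : ℕ → ℝ → ℝ≥0∞}
    (hg : ∀ n, Measurable (g n)) (hm : Monotone g) (x : ℝ) :
    solve τ B c (fun x => ⨆ n, g n x) x = ⨆ n, solve τ B c (g n) x := by
  have h1 := measurable_pos_exp (c := c) hτ hB
  unfold solve
  rw [← ENNReal.mul_iSup, ← lintegral_iSup (fun n => by have := hg n; fun_prop)
    (fun m n h z => by dsimp only; gcongr; exact hm h _)]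
  simp_rw [ENNReal.mul_iSup]

theorem solve_congr_ae {f g : ℝ → ℝ≥0∞} (h : f =ᵐ[halfLine] g) (x : ℝ) :
    solve τ B c f x = solve τ B c g x := by
  unfold solve
  congr 1
  refine lintegral_congr_ae (ae_restrict_of_ae ?_)
  have := (ae_restrict_iff' measurableSet_Ioi).1
    (show ∀ᵐ y ∂(volume : Measure ℝ).restrict (Ioi 0), f y = g y from h)
  filter_upwards [this] with y hy
  rcases le_or_gt y 0 with hy0 | hy0
  · simp [pos_of_nonpos _ hy0]
  · rw [hy hy0]

/-- `F` is nondecreasing and bounded above by `0`, so it has a limit `l ≤ 0` and the integral equals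
`l - F y`. No decay at infinity is required. -/
theorem setLIntegral_Ici_le_of_hasDerivAt {F F' : ℝ → ℝ} {y : ℝ}
    (hF : ∀ x ∈ Ici y, HasDerivAt F (F' x) x) (hF' : ∀ x ∈ Ioi y, 0 ≤ F' x)
    (hF0 : ∀ x ∈ Ici y, F x ≤ 0) :
    ∫⁻ x in Ici y, ENNReal.ofReal (F' x) ≤ ENNReal.ofReal (-F y) := by
  have hmono : MonotoneOn F (Ici y) := by
    refine monotoneOn_of_deriv_nonneg (convex_Ici y)
      (fun x hx => (hF x hx).continuousAt.continuousWithinAt)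
      (fun x hx => ?_) fun x hx => ?_
    · rw [interior_Ici] at hx
      exact (hF x (mem_Ici.2 (mem_Ioi.1 hx).le)).differentiableAt.differentiableWithinAt
    · rw [interior_Ici] at hx
      rw [(hF x (mem_Ici.2 (mem_Ioi.1 hx).le)).deriv]; exact hF' x hx
  have hm2 : Monotone fun x => F (max x y) := fun a b hab =>
    hmono (mem_Ici.2 (le_max_right _ _)) (mem_Ici.2 (le_max_right _ _)) (max_le_max_right y hab)
  have hlim := tendsto_atTop_ciSup hm2 ⟨0, by rintro _ ⟨x, rfl⟩; exact hF0 _ (mem_Ici.2 (le_max_right _ _))⟩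
  set l := ⨆ x, F (max x y)
  have hlim' : Tendsto F atTop (𝓝 l) := hlim.congr' (by
    filter_upwards [eventually_ge_atTop y] with x hx
    rw [max_eq_left hx])
  have hl : l ≤ 0 := ciSup_le fun x => hF0 _ (mem_Ici.2 (le_max_right _ _))
  have hint := integrableOn_Ioi_deriv_of_nonneg' hF hF' hlim'
  have heq := integral_Ioi_of_hasDerivAt_of_nonneg' hF hF' hlim'
  rw [setLIntegral_congr Ioi_ae_eq_Ici.symm, ← ofReal_integral_eq_lintegral_ofReal hint
    ((ae_restrict_mem measurableSet_Ioi).mono hF'), heq]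
  exact ENNReal.ofReal_le_ofReal (by linarith)

/-- Adjoint estimate for the solution operator. -/
theorem lintegral_pos_mul_solve_le (hτ : IsGrowthRate τ) (hB : IsFragRate B) {θ θ' : ℝ → ℝ}
    (hθ : ∀ x, 0 < x → HasDerivAt θ (θ' x) x) (hθ0 : ∀ x, 0 < x → 0 ≤ θ x)
    (hψm : Measurable (pos fun x => (c + B x) * θ x - τ x * θ' x))
    (hψ : ∀ x, 0 < x → 0 ≤ (c + B x) * θ x - τ x * θ' x) {g : ℝ → ℝ≥0∞} (hg : Measurable g) :
    ∫⁻ x, pos (fun x => (c + B x) * θ x - τ x * θ' x) x * solve τ B c g x ≤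
      ∫⁻ x, pos θ x * g x := by
  have h1 := measurable_pos_exp (c := c) hτ hB
  have h2 := measurable_pos_exp_neg_div (c := c) hτ hB
  have h3 := measurable_indicator_Ici
  set ψ : ℝ → ℝ := fun x => (c + B x) * θ x - τ x * θ' x with hψdef
  have e1 : ∀ x, pos ψ x * solve τ B c g x = ∫⁻ y, pos ψ x *
      pos (fun x => Real.exp (-logGrowth τ B c x) / τ x) x *
      ((Ici y).indicator 1 x * (pos (fun y => Real.exp (logGrowth τ B c y)) y * g y)) := fun x => by
    have h4 : Measurable fun y => (Ici y).indicator (1 : ℝ → ℝ≥0∞) x :=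
      h3.comp measurable_prodMk_left
    rw [solve_eq_lintegral, ← mul_assoc, lintegral_const_mul _ (by fun_prop)]
  simp_rw [e1]
  rw [lintegral_lintegral_swap (by fun_prop)]
  refine lintegral_mono fun y => ?_
  rcases le_or_gt y 0 with hy | hy
  · simp [pos_of_nonpos _ hy]
  have e2 : ∀ x, pos ψ x * pos (fun x => Real.exp (-logGrowth τ B c x) / τ x) x *
      ((Ici y).indicator 1 x * (pos (fun y => Real.exp (logGrowth τ B c y)) y * g y)) =
      (Ici y).indicator (fun x => ENNReal.ofReal (ψ x * (Real.exp (-logGrowth τ B c x) / τ x))) x *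
      (pos (fun y => Real.exp (logGrowth τ B c y)) y * g y) := fun x => by
    by_cases hx : y ≤ x
    · have hx0 : 0 < x := hy.trans_le hx
      simp only [indicator_of_mem (mem_Ici.2 hx), Pi.one_apply, one_mul, pos_of_pos _ hx0]
      rw [ENNReal.ofReal_mul (hψ x hx0)]
    · simp [hx]
  rw [lintegral_congr e2]
  have hmeas : Measurable ((Ici y).indicator
      (fun x => ENNReal.ofReal (ψ x * (Real.exp (-logGrowth τ B c x) / τ x)))) := by
    have : (Ici y).indicator (fun x => ENNReal.ofReal (ψ x * (Real.exp (-logGrowth τ B c x) / τ x)))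
        = (Ici y).indicator (fun x => pos ψ x * pos (fun x => Real.exp (-logGrowth τ B c x) / τ x) x) := by
      ext x
      by_cases hx : y ≤ x
      · have hx0 : 0 < x := hy.trans_le hx
        simp only [indicator_of_mem (mem_Ici.2 hx), pos_of_pos _ hx0]
        rw [ENNReal.ofReal_mul (hψ x hx0)]
      · simp [hx]
    rw [this]
    exact (hψm.mul h2).indicator measurableSet_Ici
  rw [lintegral_mul_const _ hmeas, lintegral_indicator measurableSet_Ici]
  -- After exchanging the integrals, the inner integrand is exactly the derivative of `-θ` times the
  -- decaying exponential; the boundary term at infinity has a favourable sign and is dropped.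
  have key := setLIntegral_Ici_le_of_hasDerivAt (F := fun x => -(θ x * Real.exp (-logGrowth τ B c x)))
    (F' := fun x => ψ x * (Real.exp (-logGrowth τ B c x) / τ x)) (y := y)
    (fun x hx => by
      have hx0 : 0 < x := hy.trans_le hx
      refine ((hθ x hx0).fun_mul (hasDerivAt_exp_neg_logGrowth c hτ hB hx0)).fun_neg.congr_deriv ?_
      have := (hτ.pos x hx0).ne'
      simp only [hψdef]
      field_simp
      ring)
    (fun x hx => by
      have hx0 : 0 < x := hy.trans hx
      exact mul_nonneg (hψ x hx0) (div_nonneg (Real.exp_pos _).le (hτ.pos x hx0).le))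
    (fun x hx => by
      have hx0 : 0 < x := hy.trans_le hx
      exact neg_nonpos.2 (mul_nonneg (hθ0 x hx0) (Real.exp_pos _).le))
  rw [neg_neg] at key
  calc _ ≤ ENNReal.ofReal (θ y * Real.exp (-logGrowth τ B c y)) *
        (pos (fun y => Real.exp (logGrowth τ B c y)) y * g y) := by gcongr
    _ = _ := by
      rw [pos_of_pos _ hy, pos_of_pos _ hy, ← mul_assoc,
        ← ENNReal.ofReal_mul (mul_nonneg (hθ0 y hy) (Real.exp_pos _).le), mul_assoc (θ y),
        ← Real.exp_add]
      simp

/-- Pointwise Duhamel bound. -/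
theorem HasFluxDeriv.enorm_le_solve (hτ : IsGrowthRate τ) (hB : IsFragRate B) {f d : ℝ → ℝ}
    (h : HasFluxDeriv τ f d) : ∀ᵐ x ∂halfLine,
      ‖f x‖ₑ ≤ solve τ B c (fun y => ‖d y + (c + B y) * f y‖ₑ) x := by
  filter_upwards [(h.duhamel c hτ hB).2, ae_restrict_mem measurableSet_Ioi] with x hx hx0
  have hx0' : 0 < x := hx0
  rw [hx, enorm_mul, solve, pos_of_pos _ hx0', Real.enorm_of_nonneg
    (div_nonneg (Real.exp_pos _).le (hτ.pos x hx0').le)]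
  gcongr
  refine (enorm_integral_le_lintegral_enorm _).trans ?_
  refine (lintegral_mono_ae ?_).trans (lintegral_mono_set Ioc_subset_Iic_self)
  refine (ae_restrict_mem measurableSet_Ioc).mono fun y hy => ?_
  rw [enorm_mul, Real.enorm_of_nonneg (Real.exp_pos _).le, pos_of_pos _ hy.1]

/-- A finite value of the solution operator on a nonnegative function solves the flux equation. -/
theorem hasFluxDeriv_toReal_solve (hτ : IsGrowthRate τ) (hB : IsFragRate B) {g : ℝ → ℝ}
    (hg : ∀ x, 0 < x → IntegrableOn g (Ioc 0 x)) (hg0 : ∀ x, 0 < x → 0 ≤ g x) {f : ℝ → ℝ}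
    (hf : ∀ᵐ x ∂halfLine, f x = (solve τ B c (pos g) x).toReal) :
    HasFluxDeriv τ f (fun x => g x - (c + B x) * f x) := by
  refine HasFluxDeriv.of_duhamel c hτ hB hg ?_
  filter_upwards [hf, ae_restrict_mem measurableSet_Ioi] with x hx hx0
  have hx0' : 0 < x := hx0
  rw [hx, solve, ENNReal.toReal_mul, pos_of_pos _ hx0', ENNReal.toReal_ofReal
    (div_nonneg (Real.exp_pos _).le (hτ.pos x hx0').le)]
  congr 1
  rw [integral_eq_lintegral_of_nonneg_ae]
  · congr 1
    rw [← lintegral_indicator measurableSet_Iic, ← lintegral_indicator measurableSet_Ioc]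
    refine lintegral_congr fun y => ?_
    by_cases hy : y ≤ x
    · rcases le_or_gt y 0 with hy0 | hy0
      · simp [pos_of_nonpos _ hy0, hy0]
      · have h1 : y ∈ Ioc 0 x := ⟨hy0, hy⟩
        rw [indicator_of_mem (mem_Iic.2 hy), indicator_of_mem h1, pos_of_pos _ hy0,
          pos_of_pos _ hy0, ENNReal.ofReal_mul (Real.exp_pos _).le]
    · have h1 : y ∉ Ioc 0 x := fun h => hy h.2
      rw [indicator_of_notMem (by simpa using hy), indicator_of_notMem h1]
  · exact (ae_restrict_mem measurableSet_Ioc).mono fun y hy =>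
      mul_nonneg (Real.exp_pos _).le (hg0 y hy.1)
  · exact (((continuousOn_logGrowth c hτ hB).rexp.mono fun y hy => hy.1).aestronglyMeasurable
      measurableSet_Ioc).mul (hg x hx0').aestronglyMeasurable

end Solve

end

end GrowthFrag

/-! ### Moments of the kernel and positivity of the dual eigenvector -/

namespace GrowthFrag

noncomputable section

theorem IsGrowthRate.exists_le {τ : ℝ → ℝ} (hτ : IsGrowthRate τ) :
    ∃ τ₁, 0 < τ₁ ∧ ∀ x, 0 < x → τ x ≤ τ₁ * max 1 x := by
  obtain ⟨ν₀, τ₀, τ₁, -, h0, h01, -, h⟩ := hτ.bounds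
  exact ⟨τ₁, h0.trans_le h01, h⟩

theorem IsFragRate.exists_ge {B : ℝ → ℝ} (hB : IsFragRate B) :
    ∃ γ₀ B₀ : ℝ, 0 < γ₀ ∧ 0 < B₀ ∧ ∀ᶠ x in atTop, B₀ * x ^ γ₀ ≤ B x := by
  obtain ⟨γ₀, γ₁, B₀, B₁, x₀, h0, h01, hB0, hB01, hx0, hlo, hhi⟩ := hB.bounds
  exact ⟨γ₀, B₀, h0, hB0, (eventually_ge_atTop x₀).mono fun x hx => hlo x (hx0.trans_le hx) hx⟩

theorem IsFragRate.tendsto_atTop {B : ℝ → ℝ} (hB : IsFragRate B) : Tendsto B atTop atTop := by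
  obtain ⟨γ₀, B₀, h0, hB0, h⟩ := hB.exists_ge
  exact tendsto_atTop_mono' _ h ((tendsto_rpow_atTop h0).const_mul_atTop hB0)

/-- A fragmentation rate that vanishes on an interval vanishes to the left of it. -/
theorem IsFragRate.eq_zero_of_eq_zero_on {B : ℝ → ℝ} (hB : IsFragRate B) {p q : ℝ} (hp : 0 < p)
    (hpq : p < q) (h : ∀ x ∈ Ioo p q, B x = 0) {x : ℝ} (hx : 0 < x) (hxq : x < q) : B x = 0 := by
  by_contra hne
  have hxp : x ≤ p := by
    by_contra hlt
    exact hne (h x ⟨not_le.1 hlt, hxq⟩)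
  obtain ⟨y, hy1, hy2⟩ := ((hB.tendsto_atTop.eventually_gt_atTop 0).and
    (eventually_ge_atTop q)).exists
  have hy0 : 0 < y := (hp.trans hpq).trans_le hy2
  have hc := hB.support_connected.isPreconnected.ordConnected
  have hm := hc.out (⟨subset_closure ⟨hx, hne⟩, hx⟩) (⟨subset_closure ⟨hy0, hy1.ne'⟩, hy0⟩)
    (show (p + q) / 2 ∈ Icc x y from ⟨by linarith, by linarith⟩)
  obtain ⟨w, hw1, hw2⟩ := mem_closure_iff.1 hm.1 (Ioo p q) isOpen_Ioo ⟨by linarith, by linarith⟩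
  exact hw2.2 (h w hw1)

section Kernel

variable {κ : Measure ℝ}

theorem IsFragKernel.integrable_comp (hκ : IsFragKernel κ) {h : ℝ → ℝ}
    (hh : ContinuousOn h (Ici 0)) {x : ℝ} (hx : 0 < x) : Integrable (fun z => h (z * x)) κ := by
  have := hκ.finite
  obtain ⟨C, hC⟩ := isCompact_Icc.exists_bound_of_continuousOn (hh.mono (Icc_subset_Ici_self : Icc 0 x ⊆ _))
  have hr : κ.restrict (Ioo 0 1) = κ := Measure.restrict_eq_self_of_ae_mem hκ.ae_mem
  have hm : AEStronglyMeasurable (fun z => h (z * x)) κ := by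
    rw [← hr]
    refine ContinuousOn.aestronglyMeasurable ?_ measurableSet_Ioo
    exact hh.comp (by fun_prop) fun z hz => mul_nonneg hz.1.le hx.le
  refine Integrable.of_bound hm C (hκ.ae_mem.mono fun z hz => hC _ ⟨mul_nonneg hz.1.le hx.le, ?_⟩)
  exact mul_le_of_le_one_left hx.le hz.2.le

theorem IsFragKernel.integrable_of_continuousOn (hκ : IsFragKernel κ) {h : ℝ → ℝ}
    (hh : ContinuousOn h (Ici 0)) : Integrable h κ := by
  simpa using hκ.integrable_comp hh one_pos

theorem IsFragKernel.integrable_id (hκ : IsFragKernel κ) : Integrable (fun z : ℝ => z) κ :=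
  hκ.integrable_of_continuousOn continuousOn_id

theorem IsFragKernel.integrable_rpow (hκ : IsFragKernel κ) {β : ℝ} (hβ : 0 < β) :
    Integrable (fun z : ℝ => z ^ β) κ :=
  hκ.integrable_of_continuousOn (continuousOn_id.rpow_const fun _ _ => Or.inr hβ.le)

theorem IsFragKernel.ne_zero (hκ : IsFragKernel κ) : κ ≠ 0 := by
  rintro rfl
  simpa using hκ.mass

theorem IsFragKernel.integral_lt (hκ : IsFragKernel κ) {f g : ℝ → ℝ} (hf : Integrable f κ)
    (hg : Integrable g κ) (h : ∀ z ∈ Ioo (0 : ℝ) 1, f z < g z) : ∫ z, f z ∂κ < ∫ z, g z ∂κ := by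
  rw [← sub_pos, ← integral_sub hg hf, integral_pos_iff_support_of_nonneg_ae
    (hκ.ae_mem.mono fun z hz => sub_nonneg.2 (h z hz).le) (hg.sub hf)]
  have := hκ.finite
  by_contra hcon
  have h0 : κ (Function.support fun z => g z - f z) = 0 := by simpa using hcon
  refine hκ.ne_zero (Measure.measure_univ_eq_zero.1 (le_antisymm ?_ zero_le))
  calc κ univ ≤ κ (Function.support (fun z => g z - f z) ∪ (Ioo 0 1)ᶜ) := measure_mono fun z _ => by
        by_cases hz : z ∈ Ioo (0 : ℝ) 1
        · exact Or.inl (sub_ne_zero.2 (h z hz).ne')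
        · exact Or.inr hz
    _ ≤ _ := measure_union_le _ _
    _ = 0 := by rw [h0, hκ.concentrated, add_zero]

/-- The exponent `1` is critical because mass is conserved. The strict inequalities on its two
sides, here and in `integral_rpow_lt_one`, make powers of `x` strict sub- or supersolutions at
infinity. -/
theorem IsFragKernel.one_lt_integral_rpow (hκ : IsFragKernel κ) {β : ℝ} (h0 : 0 < β) (h1 : β < 1) :
    1 < ∫ z, z ^ β ∂κ := by
  rw [← hκ.mass]
  refine hκ.integral_lt hκ.integrable_id (hκ.integrable_rpow h0) fun z hz => ?_
  simpa using Real.rpow_lt_rpow_of_exponent_gt hz.1 hz.2 h1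

theorem IsFragKernel.integral_rpow_lt_one (hκ : IsFragKernel κ) {α : ℝ} (h1 : 1 < α) :
    ∫ z, z ^ α ∂κ < 1 := by
  rw [← hκ.mass]
  refine hκ.integral_lt (hκ.integrable_rpow (by linarith)) hκ.integrable_id fun z hz => ?_
  simpa using Real.rpow_lt_rpow_of_exponent_gt hz.1 hz.2 h1

/-- The intervals `(0, 1 - 1 / (n + 2))` exhaust `(0, 1)`. The lemma guarantees fragments smaller
than their parent by a fixed factor, which is how information is carried across the boundary of a
support. -/
theorem IsFragKernel.exists_measure_pos (hκ : IsFragKernel κ) :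
    ∃ z₁ ∈ Ioo (0 : ℝ) 1, κ (Ioo 0 z₁) ≠ 0 := by
  by_contra! hcon
  have h1 : Ioo (0 : ℝ) 1 ⊆ ⋃ n : ℕ, Ioo (0 : ℝ) (1 - 1 / (n + 2)) := fun z hz => by
    obtain ⟨n, hn⟩ := exists_nat_one_div_lt (sub_pos.2 hz.2)
    refine mem_iUnion.2 ⟨n, hz.1, ?_⟩
    have : 1 / ((n : ℝ) + 2) ≤ 1 / (n + 1) := by gcongr; norm_num
    linarith
  have h2 : κ (Ioo 0 1) = 0 := measure_mono_null h1 (measure_iUnion_null fun n => by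
    refine hcon _ ⟨?_, ?_⟩
    · have : 1 / ((n : ℝ) + 2) ≤ 1 / 2 := by gcongr; linarith [n.cast_nonneg (α := ℝ)]
      linarith
    · have : 0 < 1 / ((n : ℝ) + 2) := by positivity
      linarith)
  refine hκ.ne_zero (Measure.measure_univ_eq_zero.1 (le_antisymm ?_ zero_le))
  rw [← union_compl_self (Ioo (0 : ℝ) 1)]
  exact (measure_union_le _ _).trans (by rw [h2, hκ.concentrated, add_zero])

theorem IsFragKernel.integral_pos_of_pos_left (hκ : IsFragKernel κ) {φ : ℝ → ℝ} {x b z₁ : ℝ}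
    (hx : 0 < x) (hz : κ (Ioo 0 z₁) ≠ 0) (hxb : z₁ * x < b) (h0 : ∀ y, 0 < y → 0 ≤ φ y)
    (hpos : ∀ y, 0 < y → y < b → 0 < φ y) (hi : Integrable (fun z => φ (z * x)) κ) :
    0 < ∫ z, φ (z * x) ∂κ := by
  rw [integral_pos_iff_support_of_nonneg_ae
    (hκ.ae_mem.mono fun z hz => h0 _ (mul_pos hz.1 hx)) hi]
  refine lt_of_lt_of_le (pos_iff_ne_zero.2 hz) (measure_mono fun z hz => ?_)
  refine (hpos _ (mul_pos hz.1 hx) (lt_trans ?_ hxb)).ne'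
  exact mul_lt_mul_of_pos_right hz.2 hx

end Kernel

section Dual

variable {τ B : ℝ → ℝ} {κ : Measure ℝ} {lam : ℝ} {G φ : ℝ → ℝ}

theorem IsDualPerron.hasDerivAt (hφ : IsDualPerron τ B κ lam G φ) {x : ℝ} (hx : 0 < x) :
    HasDerivAt φ (deriv φ x) x :=
  ((hφ.contDiffOn.differentiableOn one_ne_zero).differentiableAt (Ioi_mem_nhds hx)).hasDerivAt

theorem IsDualPerron.continuousOn (hφ : IsDualPerron τ B κ lam G φ) : ContinuousOn φ (Ioi 0) :=
  hφ.contDiffOn.continuousOn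

theorem IsDualPerron.continuousOn_deriv (hφ : IsDualPerron τ B κ lam G φ) :
    ContinuousOn (deriv φ) (Ioi 0) :=
  hφ.contDiffOn.continuousOn_deriv_of_isOpen isOpen_Ioi le_rfl

theorem IsDualPerron.gain_nonneg (hκ : IsFragKernel κ) (hB : IsFragRate B)
    (hφ : IsDualPerron τ B κ lam G φ) {x : ℝ} (hx : 0 < x) :
    0 ≤ B x * ∫ z, φ (z * x) ∂κ :=
  mul_nonneg (hB.nonneg x hx) (integral_nonneg_of_ae
    (hκ.ae_mem.mono fun _ hz => hφ.nonneg _ (mul_pos hz.1 hx)))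

/-- The integrating factor absorbs `lam + B` and leaves only the gain, which has a sign. -/
theorem IsDualPerron.hasDerivAt_mul_exp (hτ : IsGrowthRate τ) (hB : IsFragRate B)
    (hφ : IsDualPerron τ B κ lam G φ) {x : ℝ} (hx : 0 < x) :
    HasDerivAt (fun y => φ y * Real.exp (-logGrowth τ B lam y))
      (-(B x * ∫ z, φ (z * x) ∂κ) / τ x * Real.exp (-logGrowth τ B lam x)) x := by
  refine ((hφ.hasDerivAt hx).fun_mul (hasDerivAt_exp_neg_logGrowth lam hτ hB hx)).congr_deriv ?_
  have := hφ.equation x hx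
  have hne := (hτ.pos x hx).ne'
  rw [← this]
  field_simp
  ring

theorem IsDualPerron.antitoneOn (hτ : IsGrowthRate τ) (hB : IsFragRate B) (hκ : IsFragKernel κ)
    (hφ : IsDualPerron τ B κ lam G φ) :
    AntitoneOn (fun y => φ y * Real.exp (-logGrowth τ B lam y)) (Ioi 0) := by
  refine antitoneOn_of_deriv_nonpos (convex_Ioi 0)
    (fun x hx => (hφ.hasDerivAt_mul_exp hτ hB hx).continuousAt.continuousWithinAt)
    (fun x hx => ?_) fun x hx => ?_ <;> rw [interior_Ioi] at hx
  · exact (hφ.hasDerivAt_mul_exp hτ hB hx).differentiableAt.differentiableWithinAt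
  · rw [(hφ.hasDerivAt_mul_exp hτ hB hx).deriv]
    refine mul_nonpos_of_nonpos_of_nonneg (div_nonpos_of_nonpos_of_nonneg ?_ (hτ.pos x hx).le)
      (Real.exp_pos _).le
    exact neg_nonpos.2 (hφ.gain_nonneg hκ hB hx)

/-- Where there is no fragmentation the dual eigenvector is an exponential. -/
theorem IsDualPerron.mul_exp_eq (hτ : IsGrowthRate τ) (hB : IsFragRate B)
    (hφ : IsDualPerron τ B κ lam G φ) {q : ℝ} (h : ∀ x, 0 < x → x < q → B x = 0) {x y : ℝ}
    (hx : 0 < x) (hxy : x < y) (hy : y < q) :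
    φ x * Real.exp (-logGrowth τ B lam x) = φ y * Real.exp (-logGrowth τ B lam y) := by
  obtain ⟨c, hc, hc'⟩ := exists_hasDerivAt_eq_slope
    (fun y => φ y * Real.exp (-logGrowth τ B lam y)) _ hxy
    (fun w hw => (hφ.hasDerivAt_mul_exp hτ hB (hx.trans_le hw.1)).continuousAt.continuousWithinAt)
    (fun w hw => hφ.hasDerivAt_mul_exp hτ hB (hx.trans hw.1))
  rw [h c (hx.trans hc.1) (hc.2.trans hy)] at hc'
  simp only [zero_mul, neg_zero, zero_div] at hc'
  have := (div_eq_zero_iff.1 hc'.symm).resolve_right (sub_pos.2 hxy).ne'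
  linarith

/-- The dual eigenvector is positive. -/
theorem IsDualPerron.pos (hτ : IsGrowthRate τ) (hB : IsFragRate B) (hκ : IsFragKernel κ)
    (hφ : IsDualPerron τ B κ lam G φ) {x : ℝ} (hx : 0 < x) : 0 < φ x := by
  have hanti := hφ.antitoneOn hτ hB hκ
  -- By monotonicity zeros of `φ` propagate to the right. Hence `φ` is positive on some `(0, b)` and
  -- zero from `b` on, and the rest of the argument excludes this.
  have hup : ∀ a b, 0 < a → a ≤ b → φ a = 0 → φ b = 0 := by
    intro a b ha hab h
    have := hanti (mem_Ioi.2 ha) (mem_Ioi.2 (ha.trans_le hab)) hab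
    simp only [h, zero_mul] at this
    exact le_antisymm (nonpos_of_mul_nonpos_left this (Real.exp_pos _)) (hφ.nonneg b (ha.trans_le hab))
  by_contra hcon
  have hx0 : φ x = 0 := le_antisymm (not_lt.1 hcon) (hφ.nonneg x hx)
  obtain ⟨y, hy, hy0⟩ : ∃ y, 0 < y ∧ φ y ≠ 0 := by
    by_contra! h
    have h1 : ∫ x, G x * φ x ∂halfLine = 0 := by
      refine (integral_congr_ae (g := fun _ => 0) ?_).trans (by simp)
      exact (ae_restrict_mem measurableSet_Ioi).mono fun x hx => by simp [h x hx]
    exact one_ne_zero (hφ.normalized.symm.trans h1)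
  set Z := {a | 0 < a ∧ φ a = 0} with hZ
  have hyZ : ∀ a ∈ Z, y ≤ a := fun a ha => by
    by_contra hlt
    exact hy0 (hup a y ha.1 (not_le.1 hlt).le ha.2)
  have hZb : BddBelow Z := ⟨y, hyZ⟩
  have hZne : Z.Nonempty := ⟨x, hx, hx0⟩
  set b := sInf Z with hb
  have hb0 : 0 < b := hy.trans_le (le_csInf hZne hyZ)
  have hgt : ∀ a, b < a → φ a = 0 := fun a ha => by
    obtain ⟨a', ha', hlt⟩ := exists_lt_of_csInf_lt hZne ha
    exact hup a' a ha'.1 hlt.le ha'.2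
  have hlt : ∀ a, 0 < a → a < b → 0 < φ a := fun a ha hab =>
    lt_of_le_of_ne (hφ.nonneg a ha) fun h => absurd (csInf_le hZb ⟨ha, h.symm⟩) (not_le.2 hab)
  have hbz : φ b = 0 := by
    have h1 := (hφ.hasDerivAt hb0).continuousAt.tendsto.mono_left
      (nhdsWithin_le_nhds (s := Ioi b))
    refine tendsto_nhds_unique h1 (tendsto_const_nhds.congr' ?_)
    filter_upwards [self_mem_nhdsWithin] with a ha
    exact (hgt a ha).symm
  obtain ⟨z₁, hz₁, hκz⟩ := hκ.exists_measure_pos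
  have hbz1 : b < b / z₁ := by
    rw [lt_div_iff₀ hz₁.1]; exact mul_lt_of_lt_one_right hb0 hz₁.2
  -- Beyond `b` the equation reduces to the vanishing of the gain. A parent slightly larger than `b`
  -- has fragments in the region where `φ` is positive, so its fragmentation rate must be zero.
  have hB0 : ∀ a ∈ Ioo b (b / z₁), B a = 0 := fun a ha => by
    have ha0 := hb0.trans ha.1
    have hd : deriv φ a = 0 := by
      have : φ =ᶠ[𝓝 a] fun _ => 0 := by
        filter_upwards [Ioi_mem_nhds ha.1] with w hw using hgt w hw
      rw [this.deriv_eq]; simp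
    have h1 := hφ.equation a ha0
    rw [hd, hgt a ha.1] at h1
    have h2 := hκ.integral_pos_of_pos_left ha0 hκz
      (by rw [mul_comm]; exact (lt_div_iff₀ hz₁.1).1 ha.2) hφ.nonneg hlt (hφ.integrable a ha0)
    simp only [mul_zero, neg_zero, add_zero] at h1
    exact (mul_eq_zero.1 h1.symm).resolve_right h2.ne'
  -- By connectedness of its support, `B` vanishes on all of `(0, b / z₁)`. There `φ` is a constant
  -- multiple of an exponential, so it cannot be positive at `b / 2` and zero at `b`.
  have h3 := hφ.mul_exp_eq hτ hB (fun a ha haq => hB.eq_zero_of_eq_zero_on hb0 hbz1 hB0 ha haq)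
    (half_pos hb0) (half_lt_self hb0) hbz1
  rw [hbz, zero_mul] at h3
  exact (mul_pos (hlt _ (half_pos hb0) (half_lt_self hb0)) (Real.exp_pos _)).ne' h3

/-- The dual eigenvector is bounded below near the origin. -/
theorem IsDualPerron.exists_le_of_le (hτ : IsGrowthRate τ) (hB : IsFragRate B)
    (hκ : IsFragKernel κ) (hφ : IsDualPerron τ B κ lam G φ) {X : ℝ} (hX : 0 < X) :
    ∃ c, 0 < c ∧ ∀ x, 0 < x → x ≤ X → c ≤ φ x := by
  obtain ⟨C, hC⟩ := isCompact_Icc.exists_bound_of_continuousOn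
    (continuousOn_logGrowth_Icc lam hτ hB hX.le)
  refine ⟨φ X * Real.exp (-C - C), mul_pos (hφ.pos hτ hB hκ hX) (Real.exp_pos _), fun x hx hxX => ?_⟩
  have h1 := hφ.antitoneOn hτ hB hκ (mem_Ioi.2 hx) (mem_Ioi.2 hX) hxX
  simp only at h1
  have h2 := abs_le.1 (hC x ⟨hx.le, hxX⟩)
  have h3 := abs_le.1 (hC X ⟨hX.le, le_rfl⟩)
  have h4 : φ X * Real.exp (-C) ≤ φ x * Real.exp C := calc
    _ ≤ φ X * Real.exp (-logGrowth τ B lam X) := by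
      gcongr
      · exact hφ.nonneg X hX
      · linarith
    _ ≤ φ x * Real.exp (-logGrowth τ B lam x) := h1
    _ ≤ φ x * Real.exp C := by
      gcongr
      · exact hφ.nonneg x hx
      · linarith
  calc φ X * Real.exp (-C - C) = φ X * Real.exp (-C) * Real.exp (-C) := by
        rw [mul_assoc, ← Real.exp_add]; ring_nf
    _ ≤ φ x * Real.exp C * Real.exp (-C) := by gcongr
    _ = φ x := by rw [mul_assoc, ← Real.exp_add]; simp

end Dual

end

end GrowthFrag

/-! ### Sub- and supersolutions at infinity; the lower bound on `φ` -/

namespace GrowthFrag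

noncomputable section

/-- The dual operator `τ θ' - (λ + B) θ + 𝓕₊* θ`, with the derivative passed separately. -/
def adj (τ B : ℝ → ℝ) (κ : Measure ℝ) (lam : ℝ) (θ θ' : ℝ → ℝ) (x : ℝ) : ℝ :=
  τ x * θ' x - (lam + B x) * θ x + B x * ∫ z, θ (z * x) ∂κ

section Weights

variable {τ B : ℝ → ℝ} {κ : Measure ℝ} {lam : ℝ} {G φ : ℝ → ℝ}

theorem IsDualPerron.adj_eq_zero (hφ : IsDualPerron τ B κ lam G φ) {x : ℝ} (hx : 0 < x) :
    adj τ B κ lam φ (deriv φ) x = 0 := by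
  have := hφ.equation x hx
  unfold adj
  rw [← this]; ring

theorem hasDerivAt_one_add_rpow (α : ℝ) {x : ℝ} (hx : 0 < x) :
    HasDerivAt (fun x : ℝ => 1 + x ^ α) (α * x ^ (α - 1)) x :=
  (Real.hasDerivAt_rpow_const (Or.inl hx.ne')).const_add 1

theorem IsGrowthRate.mul_deriv_rpow_le {τ₁ α x : ℝ} (hτ₁ : 0 < τ₁)
    (h : ∀ x, 0 < x → τ x ≤ τ₁ * max 1 x) (hα : 1 < α) (hx : 0 < x) :
    τ x * (α * x ^ (α - 1)) ≤ α * τ₁ * (1 + x ^ α) := by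
  have h1 : max 1 x * x ^ (α - 1) ≤ 1 + x ^ α := by
    rcases le_total x 1 with h1 | h1
    · rw [max_eq_left h1, one_mul]
      have := Real.rpow_le_one hx.le h1 (by linarith : (0 : ℝ) ≤ α - 1)
      have := Real.rpow_nonneg hx.le α
      linarith
    · rw [max_eq_right h1, ← Real.rpow_one_add' hx.le (by linarith)]
      simp
  have h2 := Real.rpow_nonneg hx.le (α - 1)
  calc τ x * (α * x ^ (α - 1)) ≤ τ₁ * max 1 x * (α * x ^ (α - 1)) := by
        gcongr
        exact h x hx
    _ = α * τ₁ * (max 1 x * x ^ (α - 1)) := by ring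
    _ ≤ _ := by gcongr

theorem IsFragKernel.integral_one_add_rpow (hκ : IsFragKernel κ) {α x : ℝ} (hα : 0 < α)
    (hx : 0 < x) :
    ∫ z, (1 + (z * x) ^ α) ∂κ = κ.real univ + (∫ z, z ^ α ∂κ) * x ^ α := by
  have := hκ.finite
  have h1 : ∀ᵐ z ∂κ, 1 + (z * x) ^ α = 1 + z ^ α * x ^ α := hκ.ae_mem.mono fun z hz => by
    rw [Real.mul_rpow hz.1.le hx.le]
  rw [integral_congr_ae h1, integral_add (integrable_const _) ((hκ.integrable_rpow hα).mul_const _),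
    integral_mul_const]
  simp

/-- The gain of the weight `1 + x ^ α` is a strict fraction of the loss, up to a constant. -/
theorem exists_gain_one_add_rpow_le (hB : IsFragRate B) (hκ : IsFragKernel κ) {α : ℝ}
    (hα : 1 < α) : ∃ ρ b : ℝ, 0 < ρ ∧ ρ < 1 ∧ 0 ≤ b ∧ ∀ x, 0 < x →
      B x * ∫ z, (1 + (z * x) ^ α) ∂κ ≤ ρ * (B x * (1 + x ^ α)) + b := by
  have := hκ.finite
  set k := ∫ z, z ^ α ∂κ with hk
  set m := κ.real univ with hm
  have hm0 : 0 ≤ m := measureReal_nonneg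
  have hk1 : k < 1 := hκ.integral_rpow_lt_one hα
  have hk0 : 0 ≤ k := integral_nonneg_of_ae (hκ.ae_mem.mono fun z hz => Real.rpow_nonneg hz.1.le _)
  -- Beyond `X` the constant `m`, the gain of the weight `1`, is absorbed by half of the gap `1 -
  -- k`; this leaves the fraction `(1 + k) / 2`. Below `X` it is bounded by `m * b`.
  obtain ⟨X, hX⟩ := ((tendsto_rpow_atTop (by linarith : 0 < α)).eventually_ge_atTop
    (m / ((1 - k) / 2))).exists_forall_of_atTop
  obtain ⟨b, hb0, hb⟩ := hB.exists_le X
  refine ⟨(1 + k) / 2, m * b, by linarith, by linarith, by positivity, fun x hx => ?_⟩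
  rw [hκ.integral_one_add_rpow (by linarith) hx]
  have hBx := hB.nonneg x hx
  have hxa := Real.rpow_nonneg hx.le α
  rcases le_total x X with h | h
  · have h1 : B x * m ≤ m * b := by rw [mul_comm]; gcongr; exact hb x hx h
    have h2 : 0 ≤ B x * (1 - k) * x ^ α := by
      have : 0 ≤ 1 - k := by linarith
      positivity
    have h3 : 0 ≤ (1 + k) * B x := by positivity
    nlinarith
  · have h1 := hX x h
    rw [div_le_iff₀ (by linarith)] at h1
    have h2 : B x * m ≤ B x * (x ^ α * ((1 - k) / 2)) := by gcongr
    have h3 : 0 ≤ (1 + k) * B x := by positivity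
    have h4 : 0 ≤ m * b := by positivity
    nlinarith

theorem continuousOn_one_add_rpow {α : ℝ} (hα : 0 < α) :
    ContinuousOn (fun x : ℝ => 1 + x ^ α) (Ici 0) :=
  continuousOn_const.add (continuousOn_id.rpow_const fun _ _ => Or.inr hα.le)

/-- The weight `1 + x ^ α` is a strict supersolution of the dual problem at infinity. -/
theorem eventually_adj_one_add_rpow_le (hτ : IsGrowthRate τ) (hB : IsFragRate B)
    (hκ : IsFragKernel κ) {α : ℝ} (hα : 1 < α) :
    ∀ᶠ x in atTop, adj τ B κ lam (fun x => 1 + x ^ α) (fun x => α * x ^ (α - 1)) x ≤ -1 := by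
  obtain ⟨τ₁, hτ₁, hτ1⟩ := hτ.exists_le
  obtain ⟨ρ, b, hρ0, hρ1, hb0, hb⟩ := exists_gain_one_add_rpow_le hB hκ hα
  filter_upwards [eventually_gt_atTop 0,
    hB.tendsto_atTop.eventually_ge_atTop ((α * τ₁ + |lam| + b + 1) / (1 - ρ))] with x hx hBx
  rw [div_le_iff₀ (by linarith)] at hBx
  have h1 := IsGrowthRate.mul_deriv_rpow_le hτ₁ hτ1 hα hx
  have h2 := hb x hx
  unfold adj
  set w := 1 + x ^ α with hw
  have hw1 : 1 ≤ w := by rw [hw]; linarith [Real.rpow_nonneg hx.le α]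
  have h3 : -lam * w ≤ |lam| * w := by gcongr; exact neg_le_abs _
  have h4 : (α * τ₁ + |lam| + b + 1) * w ≤ B x * (1 - ρ) * w := by gcongr
  have h5 : (b + 1) * 1 ≤ (b + 1) * w := by gcongr
  nlinarith

/-- Uses `z * x ≤ 1 + z * x` on the left and subadditivity of `x ^ β` on the right; the shift by
`1`, which keeps the weight smooth at the origin, costs only a constant. -/
theorem IsFragKernel.integral_one_add_rpow_sub_ge (hκ : IsFragKernel κ) {β x : ℝ} (h0 : 0 < β)
    (h1 : β < 1) (hx : 0 < x) :
    ((∫ z, z ^ β ∂κ) - 1) * x ^ β - 1 ≤ ∫ z, (1 + z * x) ^ β ∂κ - (1 + x) ^ β := by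
  have e1 : (∫ z, z ^ β ∂κ) * x ^ β ≤ ∫ z, (1 + z * x) ^ β ∂κ := by
    rw [← integral_mul_const]
    refine integral_mono_ae ((hκ.integrable_rpow h0).mul_const _)
      (hκ.integrable_comp (h := fun y => (1 + y) ^ β) ?_ hx) ?_
    · exact (continuousOn_const.add continuousOn_id).rpow_const fun y _ => Or.inr h0.le
    · refine hκ.ae_mem.mono fun z hz => ?_
      simp only
      rw [← Real.mul_rpow hz.1.le hx.le]
      have := mul_nonneg hz.1.le hx.le
      exact Real.rpow_le_rpow this (by linarith) h0.le
  have e2 : (1 + x) ^ β ≤ 1 + x ^ β := by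
    simpa using Real.rpow_add_le_add_rpow zero_le_one hx.le h0.le h1.le
  linarith

/-- An exponent for sublinear corrections of the weight `x`. -/
theorem IsFragRate.exists_exponent (hB : IsFragRate B) {k : ℝ} : ∃ β : ℝ, 0 < β ∧ β < 1 ∧
    ∀ c C : ℝ, 0 < c → ∀ᶠ x in atTop, C * x + 1 ≤ B x * (c * x ^ β - k) := by
  obtain ⟨γ₀, B₀, hγ, hB₀, hlo⟩ := hB.exists_ge
  -- The choice `β > 1 - γ₀` makes `x ^ γ₀ * x ^ β` superlinear, so that it dominates the growth and
  -- eigenvalue terms.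
  obtain ⟨β, hβ1, hβ2⟩ := exists_between (max_lt zero_lt_one (sub_lt_self 1 hγ))
  have hβ0 : 0 < β := (le_max_left _ _).trans_lt hβ1
  have hβγ : 0 < β + γ₀ - 1 := by linarith [(le_max_right 0 (1 - γ₀)).trans_lt hβ1]
  refine ⟨β, hβ0, hβ2, fun c C hc => ?_⟩
  filter_upwards [hlo, eventually_ge_atTop 1,
    (tendsto_rpow_atTop hβ0).eventually_ge_atTop (|k| / (c / 2)),
    (tendsto_rpow_atTop hβγ).eventually_ge_atTop ((|C| + 1) / (B₀ * (c / 2)))] with x h1 h2 h3 h4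
  have hx : 0 < x := by linarith
  rw [div_le_iff₀ (by positivity)] at h3 h4
  have h5 : c / 2 * x ^ β ≤ c * x ^ β - k := by linarith [le_abs_self k]
  have h6 : B₀ * x ^ γ₀ * (c / 2 * x ^ β) ≤ B x * (c * x ^ β - k) := by
    gcongr
    exact hB.nonneg x hx
  have h7 : x ^ (β + γ₀ - 1) * x = x ^ γ₀ * x ^ β := by
    rw [← Real.rpow_add hx, ← Real.rpow_add_one hx.ne']; congr 1; ring
  have h8 : (|C| + 1) * x ≤ x ^ (β + γ₀ - 1) * (B₀ * (c / 2)) * x := by gcongr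
  have h9 : C * x ≤ |C| * x := by gcongr; exact le_abs_self C
  have h10 : x ^ (β + γ₀ - 1) * (B₀ * (c / 2)) * x = B₀ * x ^ γ₀ * (c / 2 * x ^ β) := by
    linear_combination (B₀ * (c / 2)) * h7
  linarith

theorem hasDerivAt_one_add_rpow_shift (β : ℝ) {x : ℝ} (hx : 0 < x) :
    HasDerivAt (fun x : ℝ => (1 + x) ^ β) (β * (1 + x) ^ (β - 1)) x := by
  have h := ((hasDerivAt_id' x).const_add 1).rpow_const (p := β) (Or.inl (by positivity : 1 + x ≠ 0))
  exact h.congr_deriv (by ring)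

theorem continuousOn_shift_rpow {β : ℝ} (h0 : 0 < β) :
    ContinuousOn (fun x : ℝ => (1 + x) ^ β) (Ici 0) :=
  (continuousOn_const.add continuousOn_id).rpow_const fun _ _ => Or.inr h0.le

theorem shift_rpow_le {β x : ℝ} (h1 : β < 1) (hx : 0 ≤ x) : (1 + x) ^ β ≤ 1 + x := by
  simpa using Real.rpow_le_rpow_of_exponent_le (by linarith : 1 ≤ 1 + x) h1.le

/-- The weight `x + (1 + x) ^ β` is a strict subsolution of the dual problem at infinity. -/
theorem eventually_adj_add_rpow_pos (hτ : IsGrowthRate τ) (hB : IsFragRate B)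
    (hκ : IsFragKernel κ) : ∃ β : ℝ, 0 < β ∧ β < 1 ∧ ∀ᶠ x in atTop,
      0 < adj τ B κ lam (fun x => x + (1 + x) ^ β) (fun x => 1 + β * (1 + x) ^ (β - 1)) x := by
  obtain ⟨β, h0, h1, h⟩ := hB.exists_exponent (k := 1)
  refine ⟨β, h0, h1, ?_⟩
  have hk := hκ.one_lt_integral_rpow h0 h1
  filter_upwards [h ((∫ z, z ^ β ∂κ) - 1) (3 * |lam|) (by linarith), eventually_ge_atTop 1] with x hx hx1
  have hx0 : 0 < x := by linarith
  have e1 := hκ.integral_one_add_rpow_sub_ge h0 h1 hx0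
  -- Mass conservation makes gain and loss of the linear part cancel; only the sublinear correction
  -- is amplified by `B`.
  have e2 : ∫ z, (z * x + (1 + z * x) ^ β) ∂κ = x + ∫ z, (1 + z * x) ^ β ∂κ := by
    rw [integral_add (hκ.integrable_id.mul_const x)
      (hκ.integrable_comp (continuousOn_shift_rpow h0) hx0), integral_mul_const, hκ.mass, one_mul]
  unfold adj
  rw [e2]
  have e3 : 0 ≤ τ x * (1 + β * (1 + x) ^ (β - 1)) := by
    have := hτ.pos x hx0
    have := Real.rpow_nonneg (by linarith : 0 ≤ 1 + x) (β - 1)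
    positivity
  have e4 : lam * (x + (1 + x) ^ β) ≤ |lam| * (3 * x) := by
    have e5 := shift_rpow_le h1 hx0.le
    have e6 : 0 ≤ (1 + x) ^ β := Real.rpow_nonneg (by linarith) _
    calc _ ≤ |lam| * (x + (1 + x) ^ β) := by gcongr; exact le_abs_self _
      _ ≤ _ := by gcongr; linarith
  have e7 := mul_le_mul_of_nonneg_left e1 (hB.nonneg x hx0)
  nlinarith

theorem adj_linear_combination {f g h f' g' h' : ℝ → ℝ} {x : ℝ}
    (hf : Integrable (fun z => f (z * x)) κ) (hg : Integrable (fun z => g (z * x)) κ)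
    (hh : Integrable (fun z => h (z * x)) κ) (a b : ℝ) :
    adj τ B κ lam (fun y => f y + a * g y - b * h y) (fun y => f' y + a * g' y - b * h' y) x =
      adj τ B κ lam f f' x + a * adj τ B κ lam g g' x - b * adj τ B κ lam h h' x := by
  have e : ∫ z, (f (z * x) + a * g (z * x) - b * h (z * x)) ∂κ =
      ∫ z, f (z * x) ∂κ + a * ∫ z, g (z * x) ∂κ - b * ∫ z, h (z * x) ∂κ := by
    have h1 : Integrable (fun z => f (z * x) + a * g (z * x)) κ := hf.add (hg.const_mul a)
    rw [integral_sub h1 (hh.const_mul b), integral_add hf (hg.const_mul a),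
      integral_const_mul, integral_const_mul]
  unfold adj
  rw [e]
  ring

/-- The dual eigenvector grows at least linearly. -/
theorem IsDualPerron.exists_mul_one_add_le (hτ : IsGrowthRate τ) (hB : IsFragRate B)
    (hκ : IsFragKernel κ) (hφ : IsDualPerron τ B κ lam G φ) :
    ∃ c, 0 < c ∧ ∀ x, 0 < x → c * (1 + x) ≤ φ x := by
  obtain ⟨β, hβ0, hβ1, hq⟩ := eventually_adj_add_rpow_pos (lam := lam) hτ hB hκ
  obtain ⟨X, hX⟩ := ((hq.and (eventually_adj_one_add_rpow_le (lam := lam) hτ hB hκ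
    one_lt_two)).and (eventually_gt_atTop 0)).exists_forall_of_atTop
  have hX0 : 0 < X := (hX X le_rfl).2
  set q : ℝ → ℝ := fun x => x + (1 + x) ^ β with hqdef
  set W : ℝ → ℝ := fun x => 1 + x ^ (2 : ℝ) with hW
  have hqpos : ∀ x, 0 < x → 0 < q x := fun x hx => by
    have := Real.rpow_nonneg (by linarith : 0 ≤ 1 + x) β
    simp only [hqdef]; linarith
  have hqge : ∀ x, 0 < x → 1 + x ≤ 2 * q x := fun x hx => by
    have := Real.one_le_rpow (by linarith : 1 ≤ 1 + x) hβ0.le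
    simp only [hqdef]; linarith
  have hqle : ∀ x, 0 < x → q x ≤ 2 * (1 + x) := fun x hx => by
    have := shift_rpow_le hβ1 hx.le
    simp only [hqdef]; linarith
  have hWpos : ∀ x, 0 < x → 0 < W x := fun x hx => by
    have := Real.rpow_nonneg hx.le 2
    simp only [hW]; linarith
  obtain ⟨m, hm0, hm⟩ := hφ.exists_le_of_le hτ hB hκ hX0
  -- Chosen so that `c * q ≤ φ` already holds on `(0, X]`.
  set c := m / (2 * (1 + X)) with hc
  have hc0 : 0 < c := by positivity
  have hcX : ∀ x, 0 < x → x ≤ X → c * q x ≤ φ x := fun x hx hxX => by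
    refine le_trans ?_ (hm x hx hxX)
    calc c * q x ≤ c * (2 * (1 + X)) := by
          have := hqle x hx
          gcongr
          linarith
      _ = m := by rw [hc]; field_simp
  -- The penalisation `ε * W` grows faster than `q`, so the quotient `F` exceeds `c` near infinity
  -- and a value below `c` would force a minimum to be attained.
  have key : ∀ ε, 0 < ε → ∀ x, X ≤ x → c * q x ≤ φ x + ε * W x := by
    intro ε hε x₁ hx₁
    by_contra! hcon
    set F : ℝ → ℝ := fun x => (φ x + ε * W x) / q x with hF
    have hx₁0 : 0 < x₁ := hX0.trans_le hx₁
    have hF1 : F x₁ < c := by rw [hF]; simp only; rwa [div_lt_iff₀ (hqpos _ hx₁0)]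
    have hbig : ∀ᶠ x in atTop, c ≤ F x := by
      filter_upwards [eventually_ge_atTop 1, eventually_ge_atTop (4 * c / ε)] with x h1 h2
      have hx : 0 < x := by linarith
      rw [div_le_iff₀ hε] at h2
      rw [hF]; simp only; rw [le_div_iff₀ (hqpos x hx)]
      have h3 := hφ.nonneg x hx
      have h4 : W x = 1 + x ^ 2 := by simp [hW]
      rw [h4]
      have h5 := mul_le_mul_of_nonneg_left (hqle x hx) hc0.le
      nlinarith
    obtain ⟨Y, hY⟩ := (hbig.and (eventually_gt_atTop x₁)).exists_forall_of_atTop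
    have hYx := (hY Y le_rfl).2
    have hFc : ContinuousOn F (Icc X Y) := by
      refine ContinuousOn.mono ?_ (fun x hx => hX0.trans_le hx.1 : Icc X Y ⊆ Ioi 0)
      refine ((hφ.continuousOn.add (continuousOn_const.mul
        ((continuousOn_one_add_rpow two_pos).mono Ioi_subset_Ici_self))).div
        (continuousOn_id.add ((continuousOn_shift_rpow hβ0).mono Ioi_subset_Ici_self)) ?_)
      exact fun x hx => (hqpos x hx).ne'
    obtain ⟨xm, hxm, hmin⟩ := isCompact_Icc.exists_isMinOn ⟨x₁, hx₁, hYx.le⟩ hFc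
    have hμc : F xm < c := (hmin ⟨hx₁, hYx.le⟩).trans_lt hF1
    have hxm0 : 0 < xm := hX0.trans_le hxm.1
    set μ := F xm with hμ
    have hμ0 : 0 < μ := div_pos (add_pos_of_nonneg_of_pos (hφ.nonneg _ hxm0)
      (mul_pos hε (hWpos _ hxm0))) (hqpos _ hxm0)
    -- The inequality is needed on the whole half-line, since the gain is nonlocal and sees all
    -- smaller sizes. It also makes `xm` a local minimum of `f` when it is the endpoint `X`.
    have hall : ∀ x, 0 < x → μ * q x ≤ φ x + ε * W x := by
      intro x hx
      have hqx := hqpos x hx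
      rcases le_total x X with h | h
      · have h1 := hcX x hx h
        have h2 := mul_le_mul_of_nonneg_right hμc.le hqx.le
        have := mul_pos hε (hWpos x hx)
        linarith
      · rw [← le_div_iff₀ hqx]
        rcases le_total x Y with h' | h'
        · exact hmin ⟨h, h'⟩
        · exact hμc.le.trans (hY x h').1
    have heq : φ xm + ε * W xm - μ * q xm = 0 := by
      rw [hμ, hF]; simp only
      rw [div_mul_cancel₀ _ (hqpos _ hxm0).ne', sub_self]
    set f : ℝ → ℝ := fun y => φ y + ε * W y - μ * q y with hf
    have hlocmin : IsLocalMin f xm := by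
      filter_upwards [Ioi_mem_nhds hxm0] with y hy
      simp only [hf]
      rw [heq]
      linarith [hall y hy]
    have hd : HasDerivAt f (deriv φ xm + ε * ((2 : ℝ) * xm ^ ((2 : ℝ) - 1)) -
        μ * (1 + β * (1 + xm) ^ (β - 1))) xm :=
      ((hφ.hasDerivAt hxm0).add ((hasDerivAt_one_add_rpow 2 hxm0).const_mul ε)).sub
        (((hasDerivAt_id xm).add (hasDerivAt_one_add_rpow_shift β hxm0)).const_mul μ)
    have hd0 := hlocmin.hasDerivAt_eq_zero hd
    -- At the contact point `f` and its derivative vanish, so the dual operator on `f` reduces to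
    -- the gain of a nonnegative function. The strict inequalities for `W` and `q` make it negative,
    -- a contradiction.
    have hadj := adj_linear_combination (τ := τ) (B := B) (lam := lam) (f := φ) (g := W) (h := q)
      (f' := deriv φ) (g' := fun x => (2 : ℝ) * x ^ ((2 : ℝ) - 1)) (h' := fun x => 1 + β * (1 + x) ^ (β - 1))
      (hφ.integrable xm hxm0) (hκ.integrable_comp (continuousOn_one_add_rpow two_pos) hxm0)
      (hκ.integrable_comp (h := q) (continuousOn_id.add (continuousOn_shift_rpow hβ0)) hxm0) ε μ
    have hXm := (hX xm hxm.1).1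
    rw [hφ.adj_eq_zero hxm0] at hadj
    have hneg : 0 + ε * adj τ B κ lam (fun x => 1 + x ^ (2 : ℝ)) (fun x => (2 : ℝ) * x ^ ((2 : ℝ) - 1)) xm
      - μ * adj τ B κ lam q (fun x => 1 + β * (1 + x) ^ (β - 1)) xm < 0 := by
      have h1 := mul_pos hμ0 hXm.1
      have h2 := mul_le_mul_of_nonneg_left hXm.2 hε.le
      linarith
    rw [← hadj] at hneg
    unfold adj at hneg
    beta_reduce at hneg
    rw [hd0, heq] at hneg
    have hpos : 0 ≤ ∫ z, (φ (z * xm) + ε * W (z * xm) - μ * q (z * xm)) ∂κ := by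
      refine integral_nonneg_of_ae (hκ.ae_mem.mono fun z hz => ?_)
      have := hall (z * xm) (mul_pos hz.1 hxm0)
      simp only [Pi.zero_apply]
      linarith
    have := mul_nonneg (hB.nonneg xm hxm0) hpos
    linarith
  refine ⟨c / 2, by positivity, fun x hx => ?_⟩
  have h1 : c * q x ≤ φ x := by
    rcases le_total x X with h | h
    · exact hcX x hx h
    · refine le_of_forall_pos_le_add fun δ hδ => ?_
      have := key (δ / W x) (div_pos hδ (hWpos x hx)) x h
      rwa [div_mul_cancel₀ _ (hWpos x hx).ne'] at this
  have h2 := mul_le_mul_of_nonneg_left (hqge x hx) hc0.le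
  linarith

end Weights

end

end GrowthFrag

/-! ### The direct eigenvector: testing with supersolutions, and its support -/

namespace GrowthFrag

noncomputable section

section Direct

variable {τ B : ℝ → ℝ} {κ : Measure ℝ} {lam : ℝ} {G φ : ℝ → ℝ}

theorem ae_halfLine_pos : ∀ᵐ x ∂halfLine, 0 < x := ae_restrict_mem measurableSet_Ioi

theorem IsDirectPerron.exists_density (hG : IsDirectPerron τ B κ lam G) :
    ∃ g : ℝ → ℝ, Measurable g ∧ (∀ x, 0 ≤ g x) ∧ g =ᵐ[halfLine] G := by
  have h1 : AEStronglyMeasurable G halfLine := by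
    have h2 : AEStronglyMeasurable (fun x : ℝ => (1 + x)⁻¹) halfLine := by
      apply Measurable.aestronglyMeasurable; fun_prop
    refine (h2.mul hG.integrable.aestronglyMeasurable).congr ?_
    filter_upwards [ae_halfLine_pos] with x hx
    simp only [Pi.mul_apply]
    field_simp
  refine ⟨fun x => |h1.mk G x|, (h1.stronglyMeasurable_mk.measurable).abs,
    fun x => abs_nonneg _, ?_⟩
  filter_upwards [h1.ae_eq_mk, hG.nonneg] with x hx h0
  rw [← hx, abs_of_nonneg h0]

/-- Passes from the extended-valued dual gain to a Bochner integral. A majorant `F` is allowed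
because the truncated weight below is controlled only through its tangent lines. -/
theorem gainDual_pos_le (hB : IsFragRate B) (hκ : IsFragKernel κ) {θ F : ℝ → ℝ} {y : ℝ}
    (hy : 0 < y) (hF : Integrable F κ) (hF0 : ∀ z ∈ Ioo (0 : ℝ) 1, 0 ≤ F z)
    (h : ∀ z ∈ Ioo (0 : ℝ) 1, θ (z * y) ≤ F z) :
    gainDual B κ (pos θ) y ≤ ENNReal.ofReal (B y * ∫ z, F z ∂κ) := by
  unfold gainDual
  rw [pos_of_pos B hy, ENNReal.ofReal_mul (hB.nonneg y hy),
    ofReal_integral_eq_lintegral_ofReal hF (hκ.ae_mem.mono hF0)]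
  gcongr 1
  refine lintegral_mono_ae (hκ.ae_mem.mono fun z hz => ?_)
  rw [pos_of_pos θ (mul_pos hz.1 hy)]
  exact ENNReal.ofReal_le_ofReal (h z hz)

theorem gainDual_of_nonpos (θ : ℝ → ℝ≥0∞) {y : ℝ} (hy : y ≤ 0) : gainDual B κ θ y = 0 := by
  simp [gainDual, pos_of_nonpos B hy]

theorem gainDual_one_add_le (hB : IsFragRate B) (hκ : IsFragKernel κ) (y : ℝ) :
    gainDual B κ (pos fun x => 1 + x) y ≤
      ENNReal.ofReal (κ.real univ + 1) * pos (fun y => (1 + y) * B y) y := by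
  have := hκ.finite
  rcases le_or_gt y 0 with hy | hy
  · simp [gainDual_of_nonpos _ hy]
  · have h1 : Integrable (fun z => 1 + z * y) κ :=
      hκ.integrable_comp (h := fun x => 1 + x) (by fun_prop) hy
    refine (gainDual_pos_le hB hκ hy h1 (fun z hz => ?_) fun z _ => le_rfl).trans ?_
    · have := mul_pos hz.1 hy
      linarith
    · rw [pos_of_pos _ hy, ← ENNReal.ofReal_mul (by positivity)]
      apply ENNReal.ofReal_le_ofReal
      have h2 : ∫ z, (1 + z * y) ∂κ = κ.real univ + y := by
        rw [integral_add (integrable_const _) (hκ.integrable_id.mul_const y), integral_mul_const,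
          hκ.mass]
        simp
      have h3 := hB.nonneg y hy
      have h4 : 0 ≤ κ.real univ := measureReal_nonneg
      rw [h2]
      have h5 : 0 ≤ κ.real univ * B y * y + B y := by positivity
      nlinarith

theorem IsDirectPerron.lintegral_gain_ne_top (hG : IsDirectPerron τ B κ lam G) {g : ℝ → ℝ}
    (hgG : g =ᵐ[halfLine] G) (hB : IsFragRate B) (hκ : IsFragKernel κ) :
    ∫⁻ y, gainDual B κ (pos fun x => 1 + x) y * ‖g y‖ₑ ≠ ∞ := by
  have h1 : ∫⁻ y, pos (fun y => (1 + y) * B y) y * ‖g y‖ₑ < ∞ := by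
    rw [lintegral_pos_mul]
    refine lt_of_eq_of_lt ?_ hG.integrable_rate.hasFiniteIntegral
    refine lintegral_congr_ae ?_
    filter_upwards [hgG, ae_halfLine_pos] with y hy hy0
    have := hB.nonneg y hy0
    rw [hy, ← mul_assoc, enorm_mul, Real.enorm_of_nonneg (by positivity : 0 ≤ (1 + y) * B y)]
  refine ne_top_of_le_ne_top
    (ENNReal.mul_ne_top (ENNReal.ofReal_ne_top (r := κ.real univ + 1)) h1.ne) ?_
  rw [← lintegral_const_mul' _ _ ENNReal.ofReal_ne_top]
  refine lintegral_mono fun y => ?_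
  rw [← mul_assoc]
  gcongr
  exact gainDual_one_add_le hB hκ y

theorem IsDirectPerron.fragPlus_eq (hG : IsDirectPerron τ B κ lam G) {g : ℝ → ℝ}
    (hgG : g =ᵐ[halfLine] G) (hgm : Measurable g) (hg0 : ∀ x, 0 ≤ g x) (hB : IsFragRate B)
    (hκ : IsFragKernel κ) :
    ∀ᵐ x ∂halfLine, gain B κ (‖g ·‖ₑ) x < ∞ ∧
      fragPlus B κ G x = (gain B κ (‖g ·‖ₑ) x).toReal := by
  have h1 := gain_lt_top_ae hB hκ (θ := pos fun x => 1 + x) (f := (‖g ·‖ₑ))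
    (measurable_pos (by fun_prop)) (fun x hx => by
      rw [pos_of_pos _ hx]
      simp only [ne_eq, ENNReal.ofReal_eq_zero, not_le]; linarith) hgm.enorm
    (hG.lintegral_gain_ne_top hgG hB hκ)
  filter_upwards [h1, fragPlus_congr_ae hB hκ hgG, ae_halfLine_pos] with x hx h2 h3
  exact ⟨hx, by rw [← h2, fragPlus_eq_toReal hB hκ hgm hg0 h3]⟩

theorem IsDirectPerron.enorm_le_solve (hG : IsDirectPerron τ B κ lam G) {g : ℝ → ℝ}
    (hgG : g =ᵐ[halfLine] G) (hgm : Measurable g) (hg0 : ∀ x, 0 ≤ g x) (hτ : IsGrowthRate τ)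
    (hB : IsFragRate B) (hκ : IsFragKernel κ) :
    ∀ᵐ x ∂halfLine, ‖g x‖ₑ ≤ solve τ B lam (gain B κ (‖g ·‖ₑ)) x := by
  filter_upwards [hG.equation.enorm_le_solve (c := lam) hτ hB, hgG] with x h1 h2
  rw [h2]
  refine h1.trans (solve_congr_ae ?_ x).le
  filter_upwards [hG.fragPlus_eq hgG hgm hg0 hB hκ] with y hy
  rw [show fragPlus B κ G y - lam * G y - B y * G y + (lam + B y) * G y = fragPlus B κ G y by ring,
    hy.2, Real.enorm_of_nonneg ENNReal.toReal_nonneg, ENNReal.ofReal_toReal hy.1.ne]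

/-- The direct eigenvector vanishes where a dominated positive weight is a strict supersolution of
the dual problem. -/
theorem IsDirectPerron.eq_zero_of_supersolution (hG : IsDirectPerron τ B κ lam G) {g : ℝ → ℝ}
    (hgG : g =ᵐ[halfLine] G) (hgm : Measurable g) (hg0 : ∀ x, 0 ≤ g x) (hτ : IsGrowthRate τ)
    (hB : IsFragRate B) (hκ : IsFragKernel κ) {θ θ' L : ℝ → ℝ} {C : ℝ}
    (hθ : ∀ x, 0 < x → HasDerivAt θ (θ' x) x) (hθ' : ContinuousOn θ' (Ioi 0))
    (hθ0 : ∀ x, 0 < x → 0 ≤ θ x) (hθC : ∀ x, 0 < x → θ x ≤ C * (1 + x))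
    (hL0 : ∀ x, 0 < x → 0 ≤ L x)
    (hL : ∀ x, 0 < x → gainDual B κ (pos θ) x ≤ ENNReal.ofReal (L x))
    (hLψ : ∀ x, 0 < x → L x ≤ (lam + B x) * θ x - τ x * θ' x) :
    ∀ᵐ x ∂halfLine, L x < (lam + B x) * θ x - τ x * θ' x → g x = 0 := by
  set ψ : ℝ → ℝ := fun x => (lam + B x) * θ x - τ x * θ' x with hψ
  have hθc : ContinuousOn θ (Ioi 0) := fun x hx => (hθ x hx).continuousAt.continuousWithinAt
  have hψm : Measurable (pos ψ) := measurable_pos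
    (((continuousOn_const.add hB.continuousOn).mul hθc).sub (hτ.continuousOn.mul hθ'))
  have hθm : Measurable (pos θ) := measurable_pos hθc
  have hC : ∀ x, pos θ x ≤ ENNReal.ofReal |C| * pos (fun x => 1 + x) x := fun x => by
    rcases le_or_gt x 0 with hx | hx
    · rw [pos_of_nonpos _ hx]; exact zero_le
    · rw [pos_of_pos _ hx, pos_of_pos _ hx, ← ENNReal.ofReal_mul (abs_nonneg _)]
      refine ENNReal.ofReal_le_ofReal ((hθC x hx).trans ?_)
      gcongr
      exact le_abs_self C
  have hfin : ∫⁻ y, gainDual B κ (pos θ) y * ‖g y‖ₑ ≠ ∞ := by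
    rw [← lintegral_mul_gain hB hκ hθm hgm.enorm]
    have h := hG.lintegral_gain_ne_top hgG hB hκ
    rw [← lintegral_mul_gain hB hκ (measurable_pos (by fun_prop)) hgm.enorm] at h
    refine ne_top_of_le_ne_top (ENNReal.mul_ne_top (ENNReal.ofReal_ne_top (r := |C|)) h) ?_
    rw [← lintegral_const_mul' _ _ ENNReal.ofReal_ne_top]
    refine lintegral_mono fun y => ?_
    rw [← mul_assoc]
    gcongr
    exact hC y
  have hle : ∀ y, gainDual B κ (pos θ) y ≤ pos ψ y := fun y => by
    rcases le_or_gt y 0 with hy | hy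
    · simp [gainDual_of_nonpos _ hy]
    · rw [pos_of_pos _ hy]
      exact (hL y hy).trans (ENNReal.ofReal_le_ofReal (hLψ y hy))
  -- Testing the equation of `G` with `θ` reverses, after integration, the pointwise inequality
  -- `hle`. As the integrals are finite, equality holds almost everywhere, which rules out
  -- strictness where `g` is nonzero.
  have hint : ∫⁻ y, pos ψ y * ‖g y‖ₑ ≤ ∫⁻ y, gainDual B κ (pos θ) y * ‖g y‖ₑ := by
    calc ∫⁻ y, pos ψ y * ‖g y‖ₑ ≤ ∫⁻ y, pos ψ y * solve τ B lam (gain B κ (‖g ·‖ₑ)) y := by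
          rw [lintegral_pos_mul, lintegral_pos_mul]
          refine lintegral_mono_ae ?_
          filter_upwards [hG.enorm_le_solve hgG hgm hg0 hτ hB hκ] with x hx
          gcongr
      _ ≤ ∫⁻ y, pos θ y * gain B κ (‖g ·‖ₑ) y :=
          lintegral_pos_mul_solve_le hτ hB hθ hθ0 hψm
            (fun x hx => (hL0 x hx).trans (hLψ x hx)) (measurable_gain hB hκ hgm.enorm)
      _ = _ := lintegral_mul_gain hB hκ hθm hgm.enorm
  have hae := ae_eq_of_ae_le_of_lintegral_le
    (ae_of_all _ fun y => mul_le_mul_left (hle y) ‖g y‖ₑ) hfin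
    (hψm.mul hgm.enorm).aemeasurable hint
  filter_upwards [ae_restrict_of_ae hae, ae_halfLine_pos] with x h1 hx hlt
  by_contra hne
  rw [(ENNReal.mul_left_inj (enorm_ne_zero.2 hne) enorm_ne_top), pos_of_pos _ hx] at h1
  have h2 := hL x hx
  rw [h1] at h2
  exact absurd ((ENNReal.ofReal_le_ofReal_iff (hL0 x hx)).1 h2) (not_le.2 hlt)

/-- The direct eigenvector is positive beyond some point `a`, below which the fragmentation rate
vanishes. -/
theorem IsDirectPerron.exists_support (hG : IsDirectPerron τ B κ lam G) (hτ : IsGrowthRate τ)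
    (hB : IsFragRate B) (hκ : IsFragKernel κ) :
    ∃ a, 0 ≤ a ∧ (∀ᵐ x ∂halfLine, a < x → G x ≠ 0) ∧
      (0 < a → ∃ q, a < q ∧ ∀ x, 0 < x → x < q → B x = 0) := by
  obtain ⟨g, hgm, hg0, hgG⟩ := hG.exists_density
  obtain ⟨hi, hrep⟩ := hG.equation.duhamel (c := lam) hτ hB
  have hF : ∀ y, fragPlus B κ G y - lam * G y - B y * G y + (lam + B y) * G y =
    fragPlus B κ G y := fun y => by ring
  simp only [hF] at hi hrep
  have hFeq := hG.fragPlus_eq hgG hgm hg0 hB hκ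
  set u : ℝ → ℝ := fun y => Real.exp (logGrowth τ B lam y) * fragPlus B κ G y with hu
  -- Up to a positive factor `G` equals `Q`, which is nonnegative and nondecreasing; hence `G` is
  -- zero up to a threshold, the supremum of `S`, and positive beyond it.
  set Q : ℝ → ℝ := fun x => ∫ y in Ioc 0 x, u y with hQ
  have hui : ∀ x, 0 < x → IntegrableOn u (Ioc 0 x) := fun x hx => by
    have h1 : ContinuousOn (fun y => Real.exp (logGrowth τ B lam y)) (Icc 0 x) :=
      (continuousOn_logGrowth_Icc lam hτ hB hx.le).rexp
    rw [← integrableOn_Icc_iff_integrableOn_Ioc]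
    exact ((integrableOn_Icc_iff_integrableOn_Ioc).2 (hi x hx)).continuousOn_mul h1 isCompact_Icc
  have hu0 : ∀ x, 0 ≤ᵐ[volume.restrict (Ioc 0 x)] u := fun x => by
    filter_upwards [ae_restrict_of_ae_restrict_of_subset Ioc_subset_Ioi_self hFeq] with y hy
    simp only [hu, Pi.zero_apply, hy.2]
    positivity
  have hQ0 : ∀ x, 0 ≤ Q x := fun x => integral_nonneg_of_ae (hu0 x)
  have hQm : ∀ x y, 0 < y → x ≤ y → Q x ≤ Q y := fun x y hy hxy =>
    setIntegral_mono_set (hui y hy) (hu0 y) (Ioc_subset_Ioc_right hxy).eventuallyLE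
  set S : Set ℝ := {x | 0 ≤ x ∧ Q x = 0} with hS
  have h0S : (0 : ℝ) ∈ S := ⟨le_rfl, by simp [hQ]⟩
  have hbdd : BddAbove S := by
    by_contra hcon
    have hQz : ∀ x, 0 < x → Q x = 0 := fun x hx => by
      rw [not_bddAbove_iff] at hcon
      obtain ⟨y, hy, hxy⟩ := hcon x
      exact le_antisymm (hy.2 ▸ hQm x y (hx.trans hxy) hxy.le) (hQ0 x)
    have : ∫ x, G x ∂halfLine = 0 := by
      refine integral_eq_zero_of_ae ?_
      filter_upwards [hrep, ae_halfLine_pos] with x h1 h2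
      have := hQz x h2
      simp only [hQ, hu] at this
      rw [h1, this]; simp
    rw [hG.mass] at this
    exact one_ne_zero this
  have hzero : ∀ x, 0 < x → x < sSup S → Q x = 0 := fun x hx hxS => by
    obtain ⟨y, hy, hxy⟩ := exists_lt_of_lt_csSup ⟨0, h0S⟩ hxS
    exact le_antisymm (hy.2 ▸ hQm x y (hx.trans hxy) hxy.le) (hQ0 x)
  have hGne : ∀ᵐ x ∂halfLine, sSup S < x → G x ≠ 0 := by
    filter_upwards [hrep, ae_halfLine_pos] with x h1 h2 h3 h4
    have h5 := hτ.pos x h2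
    rw [h1, mul_eq_zero] at h4
    rcases h4 with h4 | h4
    · have : 0 < Real.exp (-logGrowth τ B lam x) / τ x := by positivity
      exact this.ne' h4
    · exact absurd (le_csSup hbdd (⟨h2.le, h4⟩ : x ∈ S)) (not_le.2 h3)
  refine ⟨sSup S, le_csSup hbdd h0S, hGne, fun ha => ?_⟩
  set a := sSup S with ha_def
  obtain ⟨z₁, hz₁, hκz⟩ := hκ.exists_measure_pos
  -- With `a * z₁ < p < a`, parents of size in `(a, p / z₁)` carry mass of `G` and produce fragments
  -- in `(0, p]`. The gain vanishes there, so such parents cannot split.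
  obtain ⟨p, hp1, hp2⟩ := exists_between (max_lt ha (mul_lt_of_lt_one_right ha hz₁.2))
  have hp0 : 0 < p := (le_max_left _ _).trans_lt hp1
  have hpz : a < p / z₁ := by
    rw [lt_div_iff₀ hz₁.1]; exact (le_max_right _ _).trans_lt hp1
  refine ⟨p / z₁, hpz, fun x hx hxq => ?_⟩
  have hgain : ∫⁻ x, (Ioc 0 p).indicator 1 x * gain B κ (‖g ·‖ₑ) x = 0 := by
    have h1 : u =ᵐ[volume.restrict (Ioc 0 p)] 0 :=
      (setIntegral_eq_zero_iff_of_nonneg_ae (hu0 p) (hui p hp0)).1 (hzero p hp0 hp2)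
    have h2 : ∫⁻ x in Ioc 0 p, gain B κ (‖g ·‖ₑ) x = 0 := by
      rw [lintegral_eq_zero_iff (measurable_gain hB hκ hgm.enorm)]
      filter_upwards [h1, ae_restrict_of_ae_restrict_of_subset Ioc_subset_Ioi_self hFeq]
        with y hy1 hy2
      simp only [hu, Pi.zero_apply, mul_eq_zero, Real.exp_ne_zero, false_or] at hy1
      rw [hy2.2, ENNReal.toReal_eq_zero_iff] at hy1
      exact hy1.resolve_right hy2.1.ne
    rw [← lintegral_indicator measurableSet_Ioc] at h2
    rw [← h2]
    refine lintegral_congr fun y => ?_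
    by_cases hy : y ∈ Ioc 0 p <;> simp [hy]
  have hindm : Measurable ((Ioc 0 p).indicator (1 : ℝ → ℝ≥0∞)) :=
    measurable_one.indicator measurableSet_Ioc
  have hdualm : Measurable fun y => gainDual B κ ((Ioc 0 p).indicator 1) y * ‖g y‖ₑ :=
    (measurable_gainDual hB hκ hindm).mul hgm.enorm
  rw [lintegral_mul_gain hB hκ hindm hgm.enorm, lintegral_eq_zero_iff hdualm] at hgain
  have hBae : B =ᵐ[volume.restrict (Ioo a (p / z₁))] 0 := by
    have hsub : Ioo a (p / z₁) ⊆ Ioi 0 := fun y hy => ha.trans hy.1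
    filter_upwards [ae_restrict_of_ae hgain, ae_restrict_of_ae_restrict_of_subset hsub hGne,
      ae_restrict_of_ae_restrict_of_subset hsub hgG, ae_restrict_mem measurableSet_Ioo]
      with y h1 h2 h3 h4
    have hy0 : 0 < y := ha.trans h4.1
    have hgy : g y ≠ 0 := h3 ▸ h2 h4.1
    simp only [Pi.zero_apply, mul_eq_zero, enorm_eq_zero, hgy, or_false, gainDual] at h1
    rcases h1 with h1 | h1
    · rw [pos_of_pos _ hy0, ENNReal.ofReal_eq_zero] at h1
      exact le_antisymm h1 (hB.nonneg y hy0)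
    · exfalso
      apply hκz
      rw [← nonpos_iff_eq_zero, ← h1, ← setLIntegral_one, ← lintegral_indicator measurableSet_Ioo]
      refine lintegral_mono fun z => ?_
      by_cases hz : z ∈ Ioo 0 z₁
      · have : z * y ∈ Ioc 0 p := by
          refine ⟨mul_pos hz.1 hy0, ?_⟩
          have := h4.2
          rw [lt_div_iff₀ hz₁.1] at this
          have := mul_lt_mul_of_pos_right hz.2 hy0
          linarith
        simp [hz, this]
      · simp [hz]
  have hBz := Measure.eqOn_open_of_ae_eq hBae isOpen_Ioo
    (hB.continuousOn.mono fun y hy => ha.trans hy.1) continuousOn_const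
  exact hB.eq_zero_of_eq_zero_on ha hpz hBz hx hxq

end Direct

end

end GrowthFrag

/-! ### Concave truncation and the upper bound on `φ` -/

namespace GrowthFrag

noncomputable section

section Truncation

/-- The tangent inequalities at `r` and at `s` squeeze `χ s - χ r` between `k s * (s - r)` and `k r
* (s - r)`; continuity of the slope then gives the derivative. This avoids a case split at the
junction point of `trunc`. -/
theorem hasDerivAt_of_tangent_le {χ k : ℝ → ℝ}
    (h : ∀ r s, 0 < r → 0 < s → χ s ≤ χ r + k r * (s - r)) {r : ℝ} (hr : 0 < r)
    (hk : ContinuousAt k r) : HasDerivAt χ (k r) r := by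
  rw [hasDerivAt_iff_isLittleO]
  refine Asymptotics.isLittleO_of_tendsto' ?_ ?_
  · filter_upwards with s hs
    rw [sub_eq_zero.1 hs]; simp
  · refine squeeze_zero_norm' (a := fun s => |k s - k r|) ?_ ?_
    · filter_upwards [Ioi_mem_nhds hr] with s hs
      rcases eq_or_ne s r with rfl | hne
      · simp
      · rw [Real.norm_eq_abs, abs_div, div_le_iff₀ (abs_pos.2 (sub_ne_zero.2 hne)), ← abs_mul]
        have h1 := h r s hr hs
        have h2 := h s r hs hr
        simp only [smul_eq_mul]
        rw [abs_of_nonpos (by nlinarith), ← abs_neg]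
        refine le_trans ?_ (le_abs_self _)
        linarith
    · have : Tendsto (fun s => |k s - k r|) (𝓝 r) (𝓝 |k r - k r|) :=
        ((hk.tendsto.sub tendsto_const_nhds)).abs
      simpa using this

/-- The slope parameter of the concave truncation. -/
def truncSlope (r : ℝ) : ℝ := min 1 r⁻¹

/-- A bounded concave `C¹` truncation of the identity of `(0,∞)`, equal to `r` on `(0,1]` and to
`2 - 1 / r` on `[1,∞)`. -/
def trunc (r : ℝ) : ℝ := 2 - 2 * truncSlope r + r * truncSlope r ^ 2

theorem truncSlope_pos {r : ℝ} (hr : 0 < r) : 0 < truncSlope r := lt_min one_pos (inv_pos.2 hr)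

theorem truncSlope_le_one (r : ℝ) : truncSlope r ≤ 1 := min_le_left _ _

theorem truncSlope_lt_one {r : ℝ} (hr : 1 < r) : truncSlope r < 1 :=
  (min_le_right _ _).trans_lt (inv_lt_one_of_one_lt₀ hr)

theorem truncSlope_eq_one {r : ℝ} (h0 : 0 < r) (hr : r ≤ 1) : truncSlope r = 1 :=
  min_eq_left ((one_le_inv₀ h0).2 hr)

theorem continuousAt_truncSlope {r : ℝ} (hr : 0 < r) : ContinuousAt truncSlope r :=
  continuousAt_const.min (continuousAt_inv₀ hr.ne')

/-- For fixed `s` the slope parameter minimises `2 - 2 m + s m ^ 2` over `m ∈ [0, 1]`. Thus `trunc`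
is an infimum of affine functions, and the right-hand side is its tangent line at `r`. -/
theorem trunc_le {r s : ℝ} (hr : 0 < r) (hs : 0 < s) :
    trunc s ≤ 2 - 2 * truncSlope r + s * truncSlope r ^ 2 := by
  unfold trunc
  have h0 := truncSlope_pos hr
  have h1 := truncSlope_le_one r
  generalize truncSlope r = m at *
  rcases le_or_gt s 1 with h | h
  · rw [truncSlope_eq_one hs h]
    have : 0 ≤ (1 - m) * (2 - s * (1 + m)) := by
      apply mul_nonneg (by linarith)
      nlinarith
    nlinarith
  · have e : truncSlope s = s⁻¹ := min_eq_right (inv_le_one_of_one_le₀ h.le)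
    rw [e]
    have h2 : s * s⁻¹ = 1 := mul_inv_cancel₀ hs.ne'
    have h3 : 0 ≤ s * (m - s⁻¹) ^ 2 := by positivity
    nlinarith

theorem trunc_le_two {r : ℝ} (hr : 0 < r) : trunc r ≤ 2 := by
  unfold trunc truncSlope
  rcases le_or_gt r 1 with h | h
  · rw [min_eq_left ((one_le_inv₀ hr).2 h)]; linarith
  · rw [min_eq_right (inv_le_one_of_one_le₀ h.le)]
    field_simp
    nlinarith

theorem trunc_nonneg {r : ℝ} (hr : 0 < r) : 0 ≤ trunc r := by
  unfold trunc
  have := truncSlope_le_one r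
  have : 0 ≤ r * truncSlope r ^ 2 := by positivity
  linarith

theorem hasDerivAt_trunc {r : ℝ} (hr : 0 < r) : HasDerivAt trunc (truncSlope r ^ 2) r :=
  hasDerivAt_of_tangent_le (k := fun r => truncSlope r ^ 2) (fun r s hr hs => by
    have := trunc_le hr hs
    conv_rhs => rw [trunc]
    linarith) hr ((continuousAt_truncSlope hr).pow 2)

end Truncation

section UpperBound

variable {τ B : ℝ → ℝ} {κ : Measure ℝ} {lam : ℝ} {G φ : ℝ → ℝ}

/-- If a weight of at most linear growth is a strict supersolution of the dual problem wherever it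
is smaller than the dual eigenvector, then the direct eigenvector vanishes there. -/
theorem IsDirectPerron.eq_zero_of_lt (hG : IsDirectPerron τ B κ lam G) (hτ : IsGrowthRate τ)
    (hB : IsFragRate B) (hκ : IsFragKernel κ) (hφ : IsDualPerron τ B κ lam G φ) {b b' : ℝ → ℝ}
    {C : ℝ} (hb : ∀ x, 0 < x → HasDerivAt b (b' x) x) (hb' : ContinuousOn b' (Ioi 0))
    (hb0 : ∀ x, 0 < x → 0 < b x) (hbC : ∀ x, 0 < x → b x ≤ C * (1 + x))
    (hbi : ∀ x, 0 < x → Integrable (fun z => b (z * x)) κ)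
    (hadj : ∀ x, 0 < x → b x < φ x → adj τ B κ lam b b' x < 0) :
    ∀ᵐ x ∂halfLine, b x < φ x → G x = 0 := by
  obtain ⟨g, hgm, hg0, hgG⟩ := hG.exists_density
  have hφ0 : ∀ x, 0 < x → 0 < φ x := fun x hx => hφ.pos hτ hB hκ hx
  have hr : ∀ x, 0 < x → 0 < φ x / b x := fun x hx => div_pos (hφ0 x hx) (hb0 x hx)
  set m : ℝ → ℝ := fun x => truncSlope (φ x / b x) with hm
  have hbc : ContinuousOn b (Ioi 0) := fun x hx => (hb x hx).continuousAt.continuousWithinAt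
  have hmc : ContinuousOn m (Ioi 0) := fun x hx =>
    (continuousAt_truncSlope (hr x hx)).comp_continuousWithinAt (f := fun x => φ x / b x)
      ((hφ.continuousOn.div hbc fun y hy => (hb0 y hy).ne') x hx)
  have hm1 : ∀ x, m x ≤ 1 := fun x => truncSlope_le_one _
  -- The tangent at `x` replaces the truncated weight by the combination `(2 - 2 m) b + m ^ 2 φ`
  -- with frozen coefficients. The part in `φ` is annihilated by the dual operator, so only the
  -- strict supersolution `b` contributes.
  have hsub : ∀ x, 0 < x → (lam + B x) * (b x * trunc (φ x / b x)) -
      τ x * (b' x * (2 - 2 * m x) + m x ^ 2 * deriv φ x) -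
      B x * ∫ z, ((2 - 2 * m x) * b (z * x) + m x ^ 2 * φ (z * x)) ∂κ =
      -((2 - 2 * m x) * adj τ B κ lam b b' x) := fun x hx => by
    have h1 := hφ.adj_eq_zero hx
    have h4 : b x * (φ x / b x) = φ x := mul_div_cancel₀ _ (hb0 x hx).ne'
    rw [integral_add ((hbi x hx).const_mul _) ((hφ.integrable x hx).const_mul _),
      integral_const_mul, integral_const_mul]
    unfold adj at h1 ⊢
    simp only [trunc]
    linear_combination (lam + B x) * m x ^ 2 * h4 - m x ^ 2 * h1
  have key := hG.eq_zero_of_supersolution hgG hgm hg0 hτ hB hκ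
    -- A smooth substitute for `min b φ`: it equals `φ` where `φ ≤ b` and never exceeds `2 * b`,
    -- hence grows at most linearly whatever `φ` does.
    (θ := fun x => b x * trunc (φ x / b x))
    (θ' := fun x => b' x * (2 - 2 * m x) + m x ^ 2 * deriv φ x)
    (L := fun x => B x * ∫ z, ((2 - 2 * m x) * b (z * x) + m x ^ 2 * φ (z * x)) ∂κ) (C := 2 * C)
    (fun x hx => by
      have h1 := ((hφ.hasDerivAt hx).fun_div (hb x hx) (hb0 x hx).ne')
      refine ((hb x hx).fun_mul ((hasDerivAt_trunc (hr x hx)).comp x h1)).congr_deriv ?_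
      have := (hb0 x hx).ne'
      simp only [Function.comp_apply, trunc, hm]
      field_simp
      ring)
    ((hb'.mul (continuousOn_const.sub (continuousOn_const.mul hmc))).add
      ((hmc.pow 2).mul hφ.continuousOn_deriv))
    (fun x hx => mul_nonneg (hb0 x hx).le (trunc_nonneg (hr x hx)))
    (fun x hx => by
      have h1 := trunc_le_two (hr x hx)
      have h2 := mul_le_mul_of_nonneg_left h1 (hb0 x hx).le
      have := hbC x hx
      linarith)
    (fun x hx => mul_nonneg (hB.nonneg x hx) (integral_nonneg_of_ae
      (hκ.ae_mem.mono fun z hz => by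
        have h1 := hb0 _ (mul_pos hz.1 hx)
        have h2 := hφ0 _ (mul_pos hz.1 hx)
        have h3 : 0 ≤ 2 - 2 * m x := by linarith [hm1 x]
        simp only [Pi.zero_apply]
        positivity)))
    (fun x hx => gainDual_pos_le hB hκ hx
      (((hbi x hx).const_mul _).add ((hφ.integrable x hx).const_mul _))
      (fun z hz => by
        have h1 := hb0 _ (mul_pos hz.1 hx)
        have h2 := hφ0 _ (mul_pos hz.1 hx)
        have h3 : 0 ≤ 2 - 2 * m x := by linarith [hm1 x]
        positivity)
      (fun z hz => by
        have h1 := hb0 _ (mul_pos hz.1 hx)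
        have h2 := trunc_le (hr x hx) (hr _ (mul_pos hz.1 hx))
        have h3 := mul_le_mul_of_nonneg_left h2 h1.le
        have h4 : b (z * x) * (φ (z * x) / b (z * x)) = φ (z * x) := mul_div_cancel₀ _ h1.ne'
        simp only [hm]
        linear_combination h3 + (truncSlope (φ x / b x)) ^ 2 * h4))
    (fun x hx => by
      have h1 := hsub x hx
      have h2 : 0 ≤ -((2 - 2 * m x) * adj τ B κ lam b b' x) := by
        rcases le_or_gt (φ x) (b x) with h | h
        · have : m x = 1 :=
            truncSlope_eq_one (hr x hx) ((div_le_one₀ (hb0 x hx)).2 h)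
          simp [this]
        · have h3 : 0 ≤ 2 - 2 * m x := by linarith [hm1 x]
          nlinarith [hadj x hx h]
      linarith)
  filter_upwards [key, hgG, ae_halfLine_pos] with x h1 h2 hx h3
  rw [← h2]
  apply h1
  have h4 := hsub x hx
  have h5 : m x < 1 := truncSlope_lt_one ((one_lt_div₀ (hb0 x hx)).2 h3)
  have h6 : 0 < -((2 - 2 * m x) * adj τ B κ lam b b' x) := by
    have h7 : 0 < 2 - 2 * m x := by linarith
    nlinarith [hadj x hx h3]
  linarith

/-- A weight of linear growth which is a strict supersolution of the dual problem near `0` and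
near infinity. -/
theorem exists_weight (hτ : IsGrowthRate τ) (hB : IsFragRate B) (hκ : IsFragKernel κ) :
    ∃ w w' : ℝ → ℝ, ∃ δ X : ℝ, 0 < δ ∧ δ ≤ X ∧ (∀ x, 0 < x → HasDerivAt w (w' x) x) ∧
      ContinuousOn w' (Ioi 0) ∧ (∀ x, 0 < x → 1 ≤ w x ∧ w x ≤ 3 * (1 + x)) ∧
      (∀ x, 0 < x → Integrable (fun z => w (z * x)) κ) ∧
      ∀ x, 0 < x → x < δ ∨ X < x → adj τ B κ lam w w' x < 0 := by
  have := hκ.finite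
  obtain ⟨τ₁, hτ₁, hτ1⟩ := hτ.exists_le
  obtain ⟨b, hb0, hb⟩ := hB.exists_le 1
  set M := κ.real univ with hM
  have hM0 : 0 ≤ M := measureReal_nonneg
  -- Near the origin `E > 1 / 2`, so the term `-c * E` produced by transport outweighs the growth,
  -- eigenvalue and gain terms, bounded by `τ₁ + 3 * |lam| + 3 * b * M`.
  set c := 2 * (τ₁ + 3 * |lam| + 3 * b * M + 1) with hc
  have hc0 : 0 < c := by positivity
  obtain ⟨β, hβ0, hβ1, hβ⟩ := hB.exists_exponent (k := 3 * M)
  have hk := hκ.one_lt_integral_rpow hβ0 hβ1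
  set E : ℝ → ℝ := fun x => Real.exp (-logGrowth τ B c x) with hE
  have hEcont : ContinuousOn E (Ici 0) := fun x hx => by
    have h1 := (continuousOn_logGrowth_Icc c hτ hB
      (by linarith [mem_Ici.1 hx] : 0 ≤ x + 1)).neg.rexp x ⟨hx, by linarith⟩
    refine h1.mono_of_mem_nhdsWithin ?_
    rw [← Ici_inter_Iic]
    exact inter_mem self_mem_nhdsWithin
      (mem_nhdsWithin_of_mem_nhds (Iic_mem_nhds (by linarith)))
  have hE0 : ∀ x, 0 < E x := fun x => Real.exp_pos _
  have hE1 : ∀ x, 0 < x → E x ≤ 1 := fun x hx => by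
    simp only [hE, Real.exp_le_one_iff, neg_nonpos, logGrowth]
    rw [intervalIntegral.integral_of_le hx.le]
    refine setIntegral_nonneg measurableSet_Ioc fun y hy => ?_
    have := hB.nonneg y hy.1
    have := hτ.pos y hy.1
    positivity
  -- The steep decreasing `E` gives strictness near `0`, even if `B` vanishes there. At infinity
  -- strictness comes from subtracting a sublinear power, whose gain exceeds its loss.
  set w : ℝ → ℝ := fun x => 1 + E x + ((1 + x) - (1 + x) ^ β) with hw
  set w' : ℝ → ℝ := fun x => E x * (-((c + B x) / τ x)) + (1 - β * (1 + x) ^ (β - 1)) with hw'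
  have hEint : ∀ x, 0 < x → Integrable (fun z => E (z * x)) κ := fun x hx =>
    hκ.integrable_comp hEcont hx
  have hpint : ∀ x, 0 < x → Integrable (fun z => (1 + z * x) ^ β) κ := fun x hx =>
    hκ.integrable_comp (continuousOn_shift_rpow hβ0) hx
  have hlint : ∀ x, 0 < x → Integrable (fun z => 1 + z * x) κ := fun x hx =>
    hκ.integrable_comp (h := fun x => 1 + x) (by fun_prop) hx
  have hwint : ∀ x, 0 < x → Integrable (fun z => w (z * x)) κ := fun x hx =>
    ((integrable_const 1).add (hEint x hx)).add ((hlint x hx).sub (hpint x hx))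
  have hwle : ∀ x, 0 < x → 1 ≤ w x ∧ w x ≤ 2 + x := fun x hx => by
    have h1 := hE1 x hx
    have h2 := hE0 x
    have h3 := shift_rpow_le hβ1 hx.le
    have h4 := Real.one_le_rpow (by linarith : 1 ≤ 1 + x) hβ0.le
    simp only [hw]
    constructor <;> linarith
  have hlamw : ∀ x, 0 < x → -lam * w x ≤ |lam| * (2 + x) := fun x hx => by
    have h1 := hwle x hx
    calc -lam * w x ≤ |lam| * w x := by
          gcongr
          · linarith
          · exact neg_le_abs _
      _ ≤ _ := by gcongr; exact h1.2
  have hτw : ∀ x, 0 < x → τ x * w' x ≤ τ₁ * max 1 x - c * E x := fun x hx => by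
    have h1 := hτ.pos x hx
    have h2 : τ x * (E x * (-((c + B x) / τ x))) = -(E x * (c + B x)) := by field_simp
    have h3 := hτ1 x hx
    have h4 : 0 ≤ β * (1 + x) ^ (β - 1) := by
      have := Real.rpow_nonneg (by linarith : 0 ≤ 1 + x) (β - 1)
      positivity
    have h5 := mul_nonneg (hE0 x).le (hB.nonneg x hx)
    have h6 := mul_nonneg h1.le h4
    simp only [hw', mul_add, h2]
    nlinarith
  have hEnear : ∀ᶠ x in 𝓝[Ici 0] 0, 1 / 2 < E x := by
    refine (hEcont 0 self_mem_Ici).eventually_const_lt ?_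
    simp only [hE, logGrowth_zero, neg_zero, Real.exp_zero]
    norm_num
  obtain ⟨δ, hδ0, hδ⟩ : ∃ δ > 0, ∀ x, 0 < x → x < δ → x ≤ 1 ∧ 1 / 2 < E x := by
    obtain ⟨δ, hδ, h⟩ := mem_nhdsGE_iff_exists_Ico_subset.1 hEnear
    refine ⟨min δ 1, lt_min hδ one_pos, fun x hx hxδ => ⟨(hxδ.trans_le (min_le_right _ _)).le,
      h ⟨hx.le, hxδ.trans_le (min_le_left _ _)⟩⟩⟩
  obtain ⟨X, hX⟩ := ((hβ ((∫ z, z ^ β ∂κ) - 1) (τ₁ + 3 * |lam|) (by linarith)).and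
    (eventually_ge_atTop (max δ 1))).exists_forall_of_atTop
  refine ⟨w, w', δ, X, hδ0, (le_max_left _ _).trans (hX X le_rfl).2, fun x hx => ?_, ?_,
    fun x hx => ⟨(hwle x hx).1, by linarith [(hwle x hx).2]⟩, hwint, ?_⟩
  · exact ((hasDerivAt_exp_neg_logGrowth c hτ hB hx).const_add 1).add
      (((hasDerivAt_id x).const_add 1).sub (hasDerivAt_one_add_rpow_shift β hx))
  · have h1 := hτ.continuousOn
    have h2 := hB.continuousOn
    refine ((hEcont.mono Ioi_subset_Ici_self).mul ((continuousOn_const.add h2).div h1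
      fun x hx => (hτ.pos x hx).ne').neg).add (continuousOn_const.sub (continuousOn_const.mul ?_))
    exact (continuousOn_const.add continuousOn_id).rpow_const fun x hx =>
      Or.inl (by have : (0 : ℝ) < x := hx; exact (by positivity : 1 + x ≠ 0))
  · intro x hx hor
    have hBx := hB.nonneg x hx
    have h1 := hlamw x hx
    have h2 := hτw x hx
    have h3 := hwle x hx
    unfold adj
    rcases hor with h | h
    · obtain ⟨hx1, hEx⟩ := hδ x hx h
      rw [max_eq_left hx1] at h2
      have h4 : ∫ z, w (z * x) ∂κ ≤ 3 * M := by
        have : ∫ z, w (z * x) ∂κ ≤ ∫ z, (3 : ℝ) ∂κ := by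
          refine integral_mono_ae (hwint x hx) (integrable_const _) ?_
          filter_upwards [hκ.ae_mem] with z hz
          have h5 := (hwle _ (mul_pos hz.1 hx)).2
          have h6 : z * x ≤ 1 := mul_le_one₀ hz.2.le hx.le hx1
          linarith
        simpa [hM, mul_comm] using this
      have h5 : B x * ∫ z, w (z * x) ∂κ ≤ b * (3 * M) := by
        exact mul_le_mul (hb x hx hx1) h4 (integral_nonneg_of_ae
          (hκ.ae_mem.mono fun z hz => by
            have := (hwle _ (mul_pos hz.1 hx)).1
            simp only [Pi.zero_apply]; linarith)) hb0
      have h6 : 0 ≤ B x * w x := mul_nonneg hBx (by linarith)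
      have h7 : |lam| * (2 + x) ≤ |lam| * 3 := by gcongr; linarith
      have h8 : c * (1 / 2) < c * E x := by gcongr
      linarith
    · obtain ⟨h4, h5⟩ := hX x h.le
      have hx1 : 1 ≤ x := (le_max_right _ _).trans h5
      rw [max_eq_right hx1] at h2
      have h6 := hκ.integral_one_add_rpow_sub_ge hβ0 hβ1 hx
      have h7 : ∫ z, w (z * x) ∂κ ≤ 3 * M + x - ∫ z, (1 + z * x) ^ β ∂κ := by
        have e1 : ∫ z, w (z * x) ∂κ ≤ ∫ z, (3 + z * x - (1 + z * x) ^ β) ∂κ := by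
          refine integral_mono_ae (hwint x hx) (((integrable_const 3).add
            (hκ.integrable_id.mul_const x)).sub (hpint x hx)) ?_
          filter_upwards [hκ.ae_mem] with z hz
          have := hE1 _ (mul_pos hz.1 hx)
          simp only [hw]
          linarith
        have e2 : Integrable (fun z => 3 + z * x) κ :=
          (integrable_const 3).add (hκ.integrable_id.mul_const x)
        rw [integral_sub e2 (hpint x hx), integral_add (integrable_const 3)
          (hκ.integrable_id.mul_const x), integral_mul_const, hκ.mass, integral_const] at e1
        simp only [smul_eq_mul, one_mul] at e1
        linarith
      have h8 : ∫ z, w (z * x) ∂κ - w x ≤ -(((∫ z, z ^ β ∂κ) - 1) * x ^ β - 3 * M) := by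
        have := hE0 x
        simp only [hw] at h7 ⊢
        linarith
      have h9 := mul_le_mul_of_nonneg_left h8 hBx
      have h10 : |lam| * (2 + x) ≤ |lam| * (3 * x) := by gcongr; linarith
      have h11 := mul_pos hc0 (hE0 x)
      linarith

/-- The dual eigenvector grows at most linearly. -/
theorem IsDualPerron.exists_le_mul_one_add (hτ : IsGrowthRate τ) (hB : IsFragRate B)
    (hκ : IsFragKernel κ) (hG : IsDirectPerron τ B κ lam G) (hφ : IsDualPerron τ B κ lam G φ) :
    ∃ C, 0 < C ∧ ∀ x, 0 < x → φ x ≤ C * (1 + x) := by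
  obtain ⟨w, w', δ, X, hδ, hδX, hw, hwc, hw1, hwi, hadj⟩ := exists_weight (lam := lam) hτ hB hκ
  obtain ⟨C₀, hC₀⟩ := (isCompact_Icc.bddAbove_image (hφ.continuousOn.mono
    (fun x hx => hδ.trans_le hx.1 : Icc δ X ⊆ Ioi 0)))
  set C := max C₀ 1 with hC
  have hC1 : 1 ≤ C := le_max_right _ _
  -- `C` dominates `φ` on the compact interval where `w` need not be a supersolution.
  have hmid : ∀ x, 0 < x → C * w x < φ x → x < δ ∨ X < x := fun x hx hlt => by
    by_contra! hcon
    have h1 : φ x ≤ C₀ := hC₀ ⟨x, ⟨hcon.1, hcon.2⟩, rfl⟩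
    have h2 : C * 1 ≤ C * w x := by gcongr; exact (hw1 x hx).1
    linarith [le_max_left C₀ 1]
  have hzero := hG.eq_zero_of_lt hτ hB hκ hφ (b := fun x => C * w x) (b' := fun x => C * w' x)
    (C := C * 3) (fun x hx => (hw x hx).const_mul C) (continuousOn_const.mul hwc)
    (fun x hx => by have := (hw1 x hx).1; positivity)
    (fun x hx => by rw [mul_assoc]; gcongr; exact (hw1 x hx).2)
    (fun x hx => (hwi x hx).const_mul C)
    (fun x hx hlt => by
      have h1 := hadj x hx (hmid x hx hlt)
      have h2 : adj τ B κ lam (fun x => C * w x) (fun x => C * w' x) x =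
          C * adj τ B κ lam w w' x := by
        unfold adj; rw [integral_const_mul]; ring
      rw [h2]
      nlinarith)
  obtain ⟨a, ha0, hne, hBa⟩ := hG.exists_support hτ hB hκ
  -- By continuity a violation would hold on an open set, of positive measure, where `G` would be
  -- both zero and nonzero almost everywhere.
  have hlarge : ∀ x, a < x → φ x ≤ C * w x := fun x hx => by
    by_contra! hlt
    have hx0 : 0 < x := ha0.trans_lt hx
    have hopen : ∀ᶠ y in 𝓝 x, 0 < y ∧ a < y ∧ C * w y < φ y := by
      refine (eventually_gt_nhds hx0).and ((eventually_gt_nhds hx).and ?_)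
      exact (((hw x hx0).continuousAt.const_mul C).tendsto).eventually_lt
        (hφ.hasDerivAt hx0).continuousAt.tendsto hlt
    have hμ := (Measure.measure_pos_of_mem_nhds volume hopen).ne'
    apply hμ
    have hnull : ∀ᵐ y, 0 < y → ¬ (a < y ∧ C * w y < φ y) := by
      have := (hne.and hzero)
      rw [halfLine, ae_restrict_iff' measurableSet_Ioi] at this
      filter_upwards [this] with y hy hy0 hcon
      exact (hy hy0).1 hcon.1 ((hy hy0).2 hcon.2)
    refine measure_mono_null (fun y hy => ?_) (ae_iff.1 hnull)
    exact fun hcon => hcon hy.1 hy.2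
  -- When `a > 0` there is no fragmentation up to a point beyond `a`, so `φ` is a multiple of an
  -- exponential that stays bounded at the origin.
  have hsmall : ∃ D, 0 ≤ D ∧ ∀ x, 0 < x → x ≤ a → φ x ≤ D := by
    rcases ha0.eq_or_lt with h0 | h0
    · exact ⟨0, le_rfl, fun x hx hxa => by linarith⟩
    · obtain ⟨q, haq, hq⟩ := hBa h0
      obtain ⟨y, hay, hyq⟩ := exists_between haq
      have h1 : ContinuousOn (fun x => Real.exp (logGrowth τ B lam x)) (Icc 0 a) :=
        (continuousOn_logGrowth_Icc lam hτ hB h0.le).rexp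
      obtain ⟨K, hK⟩ := isCompact_Icc.bddAbove_image h1
      have hk : 0 < φ y * Real.exp (-logGrowth τ B lam y) :=
        mul_pos (hφ.pos hτ hB hκ (h0.trans hay)) (Real.exp_pos _)
      refine ⟨φ y * Real.exp (-logGrowth τ B lam y) * max K 0, by positivity, fun x hx hxa => ?_⟩
      rw [← hφ.mul_exp_eq hτ hB hq hx (hxa.trans_lt hay) hyq] at hk ⊢
      have h2 : Real.exp (logGrowth τ B lam x) ≤ max K 0 :=
        (hK ⟨x, ⟨hx.le, hxa⟩, rfl⟩).trans (le_max_left _ _)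
      calc φ x = φ x * Real.exp (-logGrowth τ B lam x) * Real.exp (logGrowth τ B lam x) := by
            rw [mul_assoc, ← Real.exp_add, neg_add_cancel, Real.exp_zero, mul_one]
        _ ≤ _ := by gcongr
  obtain ⟨D, hD0, hD⟩ := hsmall
  refine ⟨3 * C + D, by positivity, fun x hx => ?_⟩
  rcases le_or_gt x a with h | h
  · have h1 := hD x hx h
    have : 0 ≤ 3 * C + 3 * C * x + D * x := by positivity
    linarith
  · have h1 := hlarge x h
    have h2 : C * w x ≤ C * (3 * (1 + x)) := by gcongr; exact (hw1 x hx).2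
    have : 0 ≤ D * (1 + x) := by positivity
    linarith


end UpperBound

end

end GrowthFrag

/-! ### Weighted spaces, the operator as a linear relation, dissipativity -/

namespace GrowthFrag

noncomputable section

section Weighted

/-- A positive continuous weight on `(0,∞)`. -/
structure IsWeight (ψ : ℝ → ℝ) : Prop where
  continuousOn : ContinuousOn ψ (Ioi 0)
  pos : ∀ x, 0 < x → 0 < ψ x

variable {ψ : ℝ → ℝ}

theorem IsWeight.pos_ne_zero (hψ : IsWeight ψ) {x : ℝ} (hx : 0 < x) : GrowthFrag.pos ψ x ≠ 0 := by
  rw [pos_of_pos _ hx]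
  simpa using hψ.pos x hx

theorem weightMeasure_eq (ψ : ℝ → ℝ) : weightMeasure ψ = volume.withDensity (pos ψ) :=
  (withDensity_indicator measurableSet_Ioi _).symm

theorem IsWeight.ae_iff (hψ : IsWeight ψ) {P : ℝ → Prop} :
    (∀ᵐ x ∂weightMeasure ψ, P x) ↔ ∀ᵐ x ∂halfLine, P x := by
  rw [weightMeasure_eq, ae_withDensity_iff (measurable_pos hψ.continuousOn), halfLine,
    ae_restrict_iff' measurableSet_Ioi]
  refine eventually_congr (Eventually.of_forall fun x => ?_)
  rcases le_or_gt x 0 with hx | hx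
  · simp [pos_of_nonpos _ hx, hx]
  · simp [hψ.pos_ne_zero hx, hx]

theorem IsWeight.aestronglyMeasurable_iff (hψ : IsWeight ψ) {f : ℝ → ℝ} :
    AEStronglyMeasurable f (weightMeasure ψ) ↔ AEStronglyMeasurable f halfLine := by
  constructor <;> rintro ⟨g, hg, h⟩
  · exact ⟨g, hg, hψ.ae_iff.1 h⟩
  · exact ⟨g, hg, hψ.ae_iff.2 h⟩

theorem IsWeight.lintegral_eq (hψ : IsWeight ψ) (f : ℝ → ℝ≥0∞) :
    ∫⁻ x, f x ∂weightMeasure ψ = ∫⁻ x, GrowthFrag.pos ψ x * f x := by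
  rw [weightMeasure_eq, lintegral_withDensity_eq_lintegral_mul_non_measurable _
    (measurable_pos hψ.continuousOn) (ae_of_all _ fun x => (pos_ne_top ψ x).lt_top)]
  rfl

theorem IsWeight.integrable_iff (hψ : IsWeight ψ) {f : ℝ → ℝ} :
    Integrable f (weightMeasure ψ) ↔
      AEStronglyMeasurable f halfLine ∧ ∫⁻ x, GrowthFrag.pos ψ x * ‖f x‖ₑ ≠ ∞ := by
  rw [Integrable, hψ.aestronglyMeasurable_iff, HasFiniteIntegral, hψ.lintegral_eq, lt_top_iff_ne_top]

theorem IsWeight.enorm_eq (hψ : IsWeight ψ) (f : WL1 ψ) :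
    ‖f‖ₑ = ∫⁻ x, GrowthFrag.pos ψ x * ‖f x‖ₑ := by
  rw [Lp.enorm_def, eLpNorm_one_eq_lintegral_enorm, hψ.lintegral_eq]

theorem IsWeight.lintegral_ne_top (hψ : IsWeight ψ) (f : WL1 ψ) :
    ∫⁻ x, GrowthFrag.pos ψ x * ‖f x‖ₑ ≠ ∞ := by
  rw [← hψ.enorm_eq]; exact enorm_ne_top

theorem WL1.measurable (f : WL1 ψ) : Measurable f := (Lp.stronglyMeasurable f).measurable

theorem lintegral_pos_mul_mono {f g : ℝ → ℝ≥0∞} (h : ∀ᵐ x ∂halfLine, f x ≤ g x) :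
    ∫⁻ x, pos ψ x * f x ≤ ∫⁻ x, pos ψ x * g x := by
  rw [lintegral_pos_mul, lintegral_pos_mul]
  refine lintegral_mono_ae ?_
  filter_upwards [h] with x hx
  gcongr

theorem lintegral_pos_mul_congr {f g : ℝ → ℝ≥0∞} (h : f =ᵐ[halfLine] g) :
    ∫⁻ x, pos ψ x * f x = ∫⁻ x, pos ψ x * g x :=
  le_antisymm (lintegral_pos_mul_mono (h.mono fun _ hx => hx.le))
    (lintegral_pos_mul_mono (h.mono fun _ hx => hx.ge))

theorem pos_mul_of_nonneg {f g : ℝ → ℝ} (hf : ∀ x, 0 < x → 0 ≤ f x) (x : ℝ) :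
    pos (fun y => f y * g y) x = pos f x * pos g x := by
  rcases le_or_gt x 0 with hx | hx
  · simp [pos_of_nonpos _ hx]
  · rw [pos_of_pos _ hx, pos_of_pos _ hx, pos_of_pos _ hx, ENNReal.ofReal_mul (hf x hx)]

theorem pos_const_mul {c : ℝ} (hc : 0 ≤ c) (g : ℝ → ℝ) (x : ℝ) :
    pos (fun y => c * g y) x = ENNReal.ofReal c * pos g x := by
  rcases le_or_gt x 0 with hx | hx
  · simp [pos_of_nonpos _ hx]
  · rw [pos_of_pos _ hx, pos_of_pos _ hx, ENNReal.ofReal_mul hc]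

end Weighted

section Flux

variable {τ f g d e : ℝ → ℝ}

theorem HasFluxDeriv.congr (h : HasFluxDeriv τ f d) (hf : f =ᵐ[halfLine] g)
    (hd : d =ᵐ[halfLine] e) : HasFluxDeriv τ g e := by
  have hd' : ∀ x, d =ᵐ[volume.restrict (Ioc 0 x)] e := fun x =>
    ae_restrict_of_ae_restrict_of_subset Ioc_subset_Ioi_self hd
  refine ⟨fun x hx => (h.1 x hx).congr (hd' x), ?_⟩
  filter_upwards [h.2, hf] with x h1 h2
  rw [← h2, h1, integral_congr_ae (hd' x)]

theorem HasFluxDeriv.add (h : HasFluxDeriv τ f d) (h' : HasFluxDeriv τ g e) :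
    HasFluxDeriv τ (fun x => f x + g x) (fun x => d x + e x) := by
  refine ⟨fun x hx => (h.1 x hx).add (h'.1 x hx), ?_⟩
  filter_upwards [h.2, h'.2, ae_halfLine_pos] with x h1 h2 hx
  rw [mul_add, h1, h2, integral_add (h.1 x hx) (h'.1 x hx)]

theorem HasFluxDeriv.const_mul (h : HasFluxDeriv τ f d) (c : ℝ) :
    HasFluxDeriv τ (fun x => c * f x) (fun x => c * d x) := by
  refine ⟨fun x hx => (h.1 x hx).const_mul c, ?_⟩
  filter_upwards [h.2] with x h1
  rw [integral_const_mul, ← h1]; ring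

end Flux

section Gain

variable {B : ℝ → ℝ} {κ : Measure ℝ} {f g : ℝ → ℝ}

theorem fragPlus_const_mul (c : ℝ) (f : ℝ → ℝ) (x : ℝ) :
    fragPlus B κ (fun y => c * f y) x = c * fragPlus B κ f x := by
  unfold fragPlus
  rw [← integral_const_mul]
  congr 1; ext z; ring

theorem fragPlus_add (hB : IsFragRate B) (hκ : IsFragKernel κ) (hf : Measurable f)
    (hg : Measurable g) {x : ℝ} (hx : 0 < x) (hfx : gain B κ (‖f ·‖ₑ) x < ∞)
    (hgx : gain B κ (‖g ·‖ₑ) x < ∞) :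
    fragPlus B κ (fun y => f y + g y) x = fragPlus B κ f x + fragPlus B κ g x := by
  unfold fragPlus
  rw [← integral_add (integrable_fragPlus_integrand hB hκ hf hx hfx)
    (integrable_fragPlus_integrand hB hκ hg hx hgx)]
  congr 1; ext z; ring

theorem aestronglyMeasurable_fragPlus (hB : IsFragRate B) (hκ : IsFragKernel κ)
    (hf : Measurable f) : AEStronglyMeasurable (fragPlus B κ f) halfLine := by
  have := hκ.finite
  have h1 : Measurable fun p : ℝ × ℝ => (pos B (p.1 / p.2)).toReal * f (p.1 / p.2) / p.2 := by
    have := measurable_pos hB.continuousOn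
    fun_prop
  refine (h1.stronglyMeasurable.integral_prod_right' (ν := κ)).aestronglyMeasurable.congr ?_
  filter_upwards [ae_halfLine_pos] with x hx
  refine integral_congr_ae ?_
  filter_upwards [hκ.ae_mem] with z hz
  have := div_pos hx hz.1
  rw [pos_of_pos _ this, ENNReal.toReal_ofReal (hB.nonneg _ this)]

end Gain

section Operator

variable {τ B : ℝ → ℝ} {κ : Measure ℝ} {lam : ℝ} {G φ : ℝ → ℝ}

/-- Two-sided linear growth of a function on `(0,∞)`. -/
def HasLinearGrowth (φ : ℝ → ℝ) : Prop :=
  ∃ c C : ℝ, 0 < c ∧ 0 < C ∧ ∀ x, 0 < x → c * (1 + x) ≤ φ x ∧ φ x ≤ C * (1 + x)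

theorem IsDualPerron.hasLinearGrowth (hτ : IsGrowthRate τ) (hB : IsFragRate B)
    (hκ : IsFragKernel κ) (hG : IsDirectPerron τ B κ lam G) (hφ : IsDualPerron τ B κ lam G φ) :
    HasLinearGrowth φ := by
  obtain ⟨c, hc, h1⟩ := hφ.exists_mul_one_add_le hτ hB hκ
  obtain ⟨C, hC, h2⟩ := hφ.exists_le_mul_one_add hτ hB hκ hG
  exact ⟨c, C, hc, hC, fun x hx => ⟨h1 x hx, h2 x hx⟩⟩

theorem IsDualPerron.isWeight (hφ : IsDualPerron τ B κ lam G φ) (hl : HasLinearGrowth φ) :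
    IsWeight φ := by
  obtain ⟨c, C, hc, hC, h⟩ := hl
  exact ⟨hφ.continuousOn, fun x hx => lt_of_lt_of_le (by positivity) (h x hx).1⟩

/-- Two-sided linear growth makes the gain bounded relative to multiplication by `B`; hence
`fragPlus` maps the domain into `L¹(φ)`. -/
theorem HasLinearGrowth.exists_gainDual_le (hl : HasLinearGrowth φ) (hB : IsFragRate B)
    (hκ : IsFragKernel κ) :
    ∃ K : ℝ, ∀ y, gainDual B κ (pos φ) y ≤ ENNReal.ofReal K * (pos φ y * pos B y) := by
  have := hκ.finite
  obtain ⟨c, C, hc, hC, h⟩ := hl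
  set M := κ.real univ with hM
  have hM0 : 0 ≤ M := measureReal_nonneg
  refine ⟨C * (M + 1) / c, fun y => ?_⟩
  rcases le_or_gt y 0 with hy | hy
  · simp [gainDual_of_nonpos _ hy]
  · have hi : Integrable (fun z => C * (1 + z * y)) κ :=
      hκ.integrable_comp (h := fun x => C * (1 + x)) (by fun_prop) hy
    refine (gainDual_pos_le hB hκ hy hi (fun z hz => ?_) fun z hz => (h _ (mul_pos hz.1 hy)).2).trans ?_
    · have := mul_pos hz.1 hy
      positivity
    · have h0 := hB.nonneg y hy
      have hφ0 : 0 ≤ φ y := le_trans (by positivity) (h y hy).1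
      rw [pos_of_pos _ hy, pos_of_pos _ hy, ← ENNReal.ofReal_mul hφ0,
        ← ENNReal.ofReal_mul (by positivity)]
      apply ENNReal.ofReal_le_ofReal
      have h2 : ∫ z, C * (1 + z * y) ∂κ = C * (M + y) := by
        rw [integral_const_mul, integral_add (integrable_const _) (hκ.integrable_id.mul_const y),
          integral_mul_const, hκ.mass]
        simp [hM]
      have h3 : C * (M + y) ≤ C * (M + 1) * (1 + y) := by
        have : 0 ≤ C * M * y := by positivity
        nlinarith
      have h4 : C * (M + 1) * (1 + y) ≤ C * (M + 1) / c * φ y := by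
        rw [div_mul_eq_mul_div, le_div_iff₀ hc, mul_assoc _ (1 + y) c, mul_comm (1 + y) c]
        gcongr
        exact (h y hy).1
      rw [h2]
      have h5 := mul_le_mul_of_nonneg_left (h3.trans h4) h0
      linarith

theorem HasLinearGrowth.lintegral_gainDual_ne_top (hl : HasLinearGrowth φ) (hφ : IsWeight φ)
    (hB : IsFragRate B) (hκ : IsFragKernel κ) {f : ℝ → ℝ}
    (hf : Integrable (fun x => B x * f x) (weightMeasure φ)) :
    ∫⁻ y, gainDual B κ (pos φ) y * ‖f y‖ₑ ≠ ∞ := by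
  obtain ⟨K, hK⟩ := hl.exists_gainDual_le hB hκ
  refine ne_top_of_le_ne_top (ENNReal.mul_ne_top (ENNReal.ofReal_ne_top (r := K))
    (hφ.integrable_iff.1 hf).2) ?_
  rw [← lintegral_const_mul' _ _ ENNReal.ofReal_ne_top]
  refine lintegral_mono fun y => ?_
  refine (mul_le_mul_left (hK y) _).trans_eq ?_
  rcases le_or_gt y 0 with hy | hy
  · simp [pos_of_nonpos _ hy]
  · rw [enorm_mul, pos_of_pos B hy, Real.enorm_of_nonneg (hB.nonneg y hy)]
    ring

theorem HasLinearGrowth.gain_lt_top (hl : HasLinearGrowth φ) (hφ : IsWeight φ)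
    (hB : IsFragRate B) (hκ : IsFragKernel κ) {f : ℝ → ℝ} (hfm : Measurable f)
    (hf : Integrable (fun x => B x * f x) (weightMeasure φ)) :
    ∀ᵐ x ∂halfLine, gain B κ (‖f ·‖ₑ) x < ∞ :=
  gain_lt_top_ae hB hκ (measurable_pos hφ.continuousOn) (fun _ hx => hφ.pos_ne_zero hx) hfm.enorm
    (hl.lintegral_gainDual_ne_top hφ hB hκ hf)

theorem HasLinearGrowth.integrable_fragPlus (hl : HasLinearGrowth φ) (hφ : IsWeight φ)
    (hB : IsFragRate B) (hκ : IsFragKernel κ) {f : ℝ → ℝ} (hfm : Measurable f)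
    (hf : Integrable (fun x => B x * f x) (weightMeasure φ)) :
    Integrable (fragPlus B κ f) (weightMeasure φ) := by
  refine hφ.integrable_iff.2 ⟨aestronglyMeasurable_fragPlus hB hκ hfm, ?_⟩
  refine ne_top_of_le_ne_top (hl.lintegral_gainDual_ne_top hφ hB hκ hf) ?_
  rw [← lintegral_mul_gain hB hκ (measurable_pos hφ.continuousOn) hfm.enorm]
  refine lintegral_pos_mul_mono ?_
  filter_upwards [ae_halfLine_pos] with x hx
  exact enorm_fragPlus_le hB hκ f hx

/-- The operator `𝓐₀ + 𝓕₊` as a linear relation on `L¹(φ)`. -/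
def operatorSubmodule (τ : ℝ → ℝ) (lam : ℝ) (hl : HasLinearGrowth φ) (hφ : IsWeight φ)
    (hB : IsFragRate B) (hκ : IsFragKernel κ) : Submodule ℝ (WL1 φ × WL1 φ) where
  carrier := operatorGraph τ B κ lam φ
  add_mem' := by
    rintro ⟨f, g⟩ ⟨f', g'⟩ ⟨d, hd, hfd, hBf, hg⟩ ⟨d', hd', hfd', hBf', hg'⟩
    have hadd : ⇑(f + f') =ᵐ[halfLine] fun x => f x + f' x := hφ.ae_iff.1 (Lp.coeFn_add f f')
    refine ⟨fun x => d x + d' x, hd.add hd',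
      (hfd.add hfd').congr hadd.symm (ae_eq_refl _), ?_, ?_⟩
    · refine (hBf.add hBf').congr (hφ.ae_iff.2 ?_)
      filter_upwards [hadd] with x hx
      simp only [Prod.fst_add, Pi.add_apply, hx]; ring
    · filter_upwards [hg, hg', hadd, hφ.ae_iff.1 (Lp.coeFn_add g g'), ae_halfLine_pos,
        fragPlus_congr_ae hB hκ hadd, hl.gain_lt_top hφ hB hκ (WL1.measurable f) hBf,
        hl.gain_lt_top hφ hB hκ (WL1.measurable f') hBf'] with x h1 h2 h3 h4 hx h5 h6 h7
      simp only [Prod.fst_add, Prod.snd_add]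
      rw [h4, Pi.add_apply, h5, h3, fragPlus_add hB hκ (WL1.measurable f) (WL1.measurable f') hx h6 h7]
      rw [h1, h2]; ring
  zero_mem' := by
    have h0 : ⇑(0 : WL1 φ) =ᵐ[halfLine] fun _ => 0 := hφ.ae_iff.1 (Lp.coeFn_zero _ _ _)
    refine ⟨fun _ => 0, integrable_zero _ _ _, ?_, ?_, ?_⟩
    · refine HasFluxDeriv.congr ?_ h0.symm (ae_eq_refl _)
      exact ⟨fun x _ => integrableOn_zero, by simp⟩
    · refine (integrable_zero _ _ _).congr (hφ.ae_iff.2 ?_)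
      filter_upwards [h0] with x hx
      rw [Prod.fst_zero, hx, mul_zero, Pi.zero_apply]
    · filter_upwards [h0, fragPlus_congr_ae hB hκ h0] with x h1 h2
      simp only [Prod.fst_zero, Prod.snd_zero]
      rw [h2, h1]
      simp [fragPlus]
  smul_mem' := by
    rintro c ⟨f, g⟩ ⟨d, hd, hfd, hBf, hg⟩
    have hmul : ⇑(c • f) =ᵐ[halfLine] fun x => c * f x := hφ.ae_iff.1 (Lp.coeFn_smul c f)
    refine ⟨fun x => c * d x, hd.const_mul c,
      (hfd.const_mul c).congr hmul.symm (ae_eq_refl _), ?_, ?_⟩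
    · refine (hBf.const_mul c).congr (hφ.ae_iff.2 ?_)
      filter_upwards [hmul] with x hx
      simp only [Prod.smul_fst, hx]; ring
    · filter_upwards [hg, hmul, hφ.ae_iff.1 (Lp.coeFn_smul c g), fragPlus_congr_ae hB hκ hmul]
        with x h1 h2 h3 h4
      simp only [Prod.smul_fst, Prod.smul_snd]
      rw [h3, Pi.smul_apply, h4, h2, fragPlus_const_mul]
      rw [h1, smul_eq_mul]; ring

theorem IsDualPerron.gainDual_eq (hφ : IsDualPerron τ B κ lam G φ) (hB : IsFragRate B)
    (hκ : IsFragKernel κ) {x : ℝ} (hx : 0 < x) :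
    gainDual B κ (GrowthFrag.pos φ) x = ENNReal.ofReal (B x * ∫ z, φ (z * x) ∂κ) := by
  unfold gainDual
  have h0 : ∀ᵐ z ∂κ, 0 ≤ φ (z * x) := hκ.ae_mem.mono fun z hz => hφ.nonneg _ (mul_pos hz.1 hx)
  rw [pos_of_pos B hx, ENNReal.ofReal_mul (hB.nonneg x hx),
    ofReal_integral_eq_lintegral_ofReal (hφ.integrable x hx) h0]
  congr 1
  refine lintegral_congr_ae (hκ.ae_mem.mono fun z hz => ?_)
  exact pos_of_pos φ (mul_pos hz.1 hx)

/-- With `h = s f - g`, Duhamel bounds `|f|` by the solution with source `|h| + 𝓕₊|f|`. The adjoint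
estimate with `θ = φ` produces the weight `s φ + 𝓕₊* φ` on the left, and duality makes the two gain
terms equal. -/
theorem IsDualPerron.isDissipative (hφ : IsDualPerron τ B κ lam G φ) (hl : HasLinearGrowth φ)
    (hτ : IsGrowthRate τ) (hB : IsFragRate B) (hκ : IsFragKernel κ) :
    IsDissipative (operatorSubmodule τ lam hl (hφ.isWeight hl) hB hκ) := by
  have hw := hφ.isWeight hl
  rintro ⟨f, g⟩ ⟨d, hd, hfd, hBf, hg⟩ s hs
  simp only at hfd hBf hg ⊢
  have hfm := WL1.measurable f
  set h : WL1 φ := s • f - g with hh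
  have hsf : ⇑(s • f) =ᵐ[halfLine] fun x => s * f x := hw.ae_iff.1 (Lp.coeFn_smul s f)
  have hhx : ∀ᵐ x ∂halfLine, h x = s * f x - g x := by
    filter_upwards [hw.ae_iff.1 (Lp.coeFn_sub (s • f) g), hsf] with x h1 h2
    rw [h1, Pi.sub_apply, h2]
  have hsolve : ∀ᵐ x ∂halfLine,
      ‖f x‖ₑ ≤ solve τ B (s + lam) (fun y => ‖h y‖ₑ + gain B κ (‖f ·‖ₑ) y) x := by
    have hae : (fun y => ‖d y + (s + lam + B y) * f y‖ₑ) =ᵐ[halfLine]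
        fun y => ‖h y + fragPlus B κ f y‖ₑ := by
      filter_upwards [hhx, hg] with y h1 h2
      rw [h1, h2]; congr 1; ring
    -- The triangle bound is available only on the positive axis; the minimum makes it valid
    -- everywhere without changing the class.
    have hae' : (fun y => min ‖h y + fragPlus B κ f y‖ₑ (‖h y‖ₑ + gain B κ (‖f ·‖ₑ) y)) =ᵐ[halfLine]
        fun y => ‖h y + fragPlus B κ f y‖ₑ := by
      filter_upwards [ae_halfLine_pos] with y hy
      refine min_eq_left ((enorm_add_le _ _).trans ?_)
      gcongr
      exact enorm_fragPlus_le hB hκ f hy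
    filter_upwards [hfd.enorm_le_solve (c := s + lam) hτ hB] with x hx
    rw [solve_congr_ae hae x, ← solve_congr_ae hae' x] at hx
    exact hx.trans (solve_mono (fun y => min_le_right _ _) x)
  have hψ : ∀ x, 0 < x → (s + lam + B x) * φ x - τ x * deriv φ x =
      s * φ x + B x * ∫ z, φ (z * x) ∂κ := fun x hx => by
    have := hφ.equation x hx
    linarith
  have hF0 : ∀ x, 0 < x → 0 ≤ B x * ∫ z, φ (z * x) ∂κ := fun x hx => hφ.gain_nonneg hκ hB hx
  have hψc : ContinuousOn (fun x => (s + lam + B x) * φ x - τ x * deriv φ x) (Ioi 0) :=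
    ((continuousOn_const.add hB.continuousOn).mul hφ.continuousOn).sub
      (hτ.continuousOn.mul hφ.continuousOn_deriv)
  have key := lintegral_pos_mul_solve_le (c := s + lam) (θ := φ) (θ' := deriv φ) hτ hB
    (fun x hx => hφ.hasDerivAt hx) hφ.nonneg (measurable_pos hψc)
    (fun x hx => by
      rw [hψ x hx]
      exact add_nonneg (mul_nonneg hs.le (hφ.nonneg x hx)) (hF0 x hx))
    (g := fun y => ‖h y‖ₑ + gain B κ (‖f ·‖ₑ) y)
    ((WL1.measurable h).enorm.add (measurable_gain hB hκ hfm.enorm))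
  have hφm := measurable_pos hφ.continuousOn
  have hsfm : Measurable fun x => ENNReal.ofReal s * (GrowthFrag.pos φ x * ‖f x‖ₑ) :=
    (hφm.mul hfm.enorm).const_mul _
  have hhm : Measurable fun x => GrowthFrag.pos φ x * ‖h x‖ₑ := hφm.mul (WL1.measurable h).enorm
  have hleft : ENNReal.ofReal s * ‖f‖ₑ + ∫⁻ y, gainDual B κ (GrowthFrag.pos φ) y * ‖f y‖ₑ ≤
      ∫⁻ x, GrowthFrag.pos (fun x => (s + lam + B x) * φ x - τ x * deriv φ x) x *
        solve τ B (s + lam) (fun y => ‖h y‖ₑ + gain B κ (‖f ·‖ₑ) y) x := by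
    refine le_trans (le_of_eq ?_) (lintegral_pos_mul_mono hsolve)
    rw [hw.enorm_eq, ← lintegral_const_mul' _ _ ENNReal.ofReal_ne_top,
      ← lintegral_add_left hsfm]
    refine lintegral_congr fun x => ?_
    rcases le_or_gt x 0 with hx | hx
    · simp [pos_of_nonpos _ hx, gainDual_of_nonpos _ hx]
    · rw [pos_of_pos _ hx, pos_of_pos _ hx, hφ.gainDual_eq hB hκ hx, hψ x hx,
        ENNReal.ofReal_add (mul_nonneg hs.le (hφ.nonneg x hx)) (hF0 x hx), ENNReal.ofReal_mul hs.le]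
      ring
  have hright : ∫⁻ x, GrowthFrag.pos φ x * (‖h x‖ₑ + gain B κ (‖f ·‖ₑ) x) =
      ‖h‖ₑ + ∫⁻ y, gainDual B κ (GrowthFrag.pos φ) y * ‖f y‖ₑ := by
    rw [hw.enorm_eq, ← lintegral_mul_gain hB hκ hφm hfm.enorm,
      ← lintegral_add_left hhm]
    refine lintegral_congr fun x => mul_add _ _ _
  have hfin := (hleft.trans key).trans_eq hright
  -- The cancellation is legitimate because `B f ∈ L¹(φ)` makes the total gain finite.
  rw [ENNReal.add_le_add_iff_right (hl.lintegral_gainDual_ne_top hw hB hκ hBf)] at hfin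
  rw [← Real.enorm_of_nonneg hs.le, ← enorm_smul, enorm_le_iff_norm_le, norm_smul,
    Real.norm_of_nonneg hs.le] at hfin
  exact hfin

end Operator

end

end GrowthFrag

/-! ### Density of the domain -/

namespace GrowthFrag

noncomputable section

section Domain

variable {τ B : ℝ → ℝ} {κ : Measure ℝ} {lam : ℝ} {φ : ℝ → ℝ}

theorem HasLinearGrowth.exists_mem_operatorGraph (hl : HasLinearGrowth φ) (hφ : IsWeight φ)
    (hB : IsFragRate B) (hκ : IsFragKernel κ) {f d : ℝ → ℝ} (hf : Integrable f (weightMeasure φ))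
    (hd : Integrable d (weightMeasure φ)) (hfd : HasFluxDeriv τ f d)
    (hBf : Integrable (fun x => B x * f x) (weightMeasure φ)) :
    ∃ p ∈ operatorGraph τ B κ lam φ, p.1 =ᵐ[halfLine] f ∧
      ∀ᵐ x ∂halfLine, p.2 x = -d x - lam * f x - B x * f x + fragPlus B κ f x := by
  set u : WL1 φ := (memLp_one_iff_integrable.2 hf).toLp f with hu
  have huf : ⇑u =ᵐ[halfLine] f := hφ.ae_iff.1 (MemLp.coeFn_toLp _)
  have hBu : Integrable (fun x => B x * u x) (weightMeasure φ) := by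
    refine hBf.congr (hφ.ae_iff.2 ?_)
    filter_upwards [huf] with x hx
    rw [hx]
  have hg : Integrable (fun x => -d x - lam * u x - B x * u x + fragPlus B κ u x)
      (weightMeasure φ) :=
    ((hd.neg.sub ((L1.integrable_coeFn u).const_mul lam)).sub hBu).add
      (hl.integrable_fragPlus hφ hB hκ (WL1.measurable u) hBu)
  have hgx := hφ.ae_iff.1 (MemLp.coeFn_toLp (memLp_one_iff_integrable.2 hg))
  refine ⟨(u, (memLp_one_iff_integrable.2 hg).toLp _),
    ⟨d, hd, hfd.congr huf.symm (ae_eq_refl _), hBu, hgx⟩, huf, ?_⟩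
  filter_upwards [hgx, huf, fragPlus_congr_ae hB hκ huf] with x h1 h2 h3
  rw [h1, h2, h3]

theorem isFiniteMeasureOnCompacts_weightMeasure {ψ : ℝ → ℝ}
    (h : ∀ X, 0 < X → IntegrableOn ψ (Ioc 0 X)) : IsFiniteMeasureOnCompacts (weightMeasure ψ) := by
  refine ⟨fun K hK => ?_⟩
  obtain ⟨X, hX⟩ := hK.bddAbove
  have hsub : K ∩ Ioi 0 ⊆ Ioc 0 (max X 1) := fun x hx => ⟨hx.2, (hX hx.1).trans (le_max_left _ _)⟩
  rw [weightMeasure_eq, withDensity_apply _ hK.measurableSet]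
  have h1 := (h (max X 1) (by positivity)).2
  refine lt_of_le_of_lt ?_ h1
  unfold pos
  rw [lintegral_indicator measurableSet_Ioi, Measure.restrict_restrict measurableSet_Ioi,
    inter_comm]
  refine (lintegral_mono_set hsub).trans (lintegral_mono fun x => ?_)
  exact Real.ofReal_le_enorm _

theorem HasLinearGrowth.integrableOn_div (hl : HasLinearGrowth φ) (hφ : IsWeight φ)
    (hτ : IsGrowthRate τ) (X : ℝ) : IntegrableOn (fun x => φ x / τ x) (Ioc 0 X) := by
  obtain ⟨c, C, hc, hC, h⟩ := hl
  refine ((hτ.integrableOn_inv X).const_mul (C * (1 + |X|))).mono' ?_ ?_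
  · exact ((hφ.continuousOn.div hτ.continuousOn fun x hx => (hτ.pos x hx).ne').mono
      Ioc_subset_Ioi_self).aestronglyMeasurable measurableSet_Ioc
  · filter_upwards [ae_restrict_mem measurableSet_Ioc] with x hx
    have h1 := hφ.pos x hx.1
    have h2 := hτ.pos x hx.1
    rw [Real.norm_of_nonneg (by positivity), div_eq_mul_one_div]
    gcongr
    refine (h x hx.1).2.trans ?_
    gcongr
    exact hx.2.trans (le_abs_self X)

theorem HasLinearGrowth.integrableOn (hl : HasLinearGrowth φ) (hφ : IsWeight φ) (X : ℝ) :
    IntegrableOn φ (Ioc 0 X) := by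
  obtain ⟨c, C, hc, hC, h⟩ := hl
  refine (integrableOn_const (C := C * (1 + |X|)) measure_Ioc_lt_top.ne).mono' ?_ ?_
  · exact (hφ.continuousOn.mono Ioc_subset_Ioi_self).aestronglyMeasurable measurableSet_Ioc
  · filter_upwards [ae_restrict_mem measurableSet_Ioc] with x hx
    rw [Real.norm_of_nonneg (hφ.pos x hx.1).le]
    refine (h x hx.1).2.trans ?_
    gcongr
    exact hx.2.trans (le_abs_self X)

theorem IsWeight.div (hφ : IsWeight φ) (hτ : IsGrowthRate τ) : IsWeight fun x => φ x / τ x :=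
  ⟨hφ.continuousOn.div hτ.continuousOn fun x hx => (hτ.pos x hx).ne',
    fun x hx => div_pos (hφ.pos x hx) (hτ.pos x hx)⟩

theorem pos_mul_enorm_div (hφ : IsWeight φ) (hτ : IsGrowthRate τ) (V : ℝ → ℝ) (x : ℝ) :
    pos φ x * ‖V x / τ x‖ₑ = pos (fun x => φ x / τ x) x * ‖V x‖ₑ := by
  rcases le_or_gt x 0 with hx | hx
  · simp [pos_of_nonpos _ hx]
  · have h1 := hτ.pos x hx
    rw [pos_of_pos _ hx, pos_of_pos _ hx, div_eq_mul_inv, enorm_mul,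
      Real.enorm_of_nonneg (inv_nonneg.2 h1.le), div_eq_mul_inv,
      ENNReal.ofReal_mul (hφ.pos x hx).le]
    ring

theorem hasFluxDeriv_div (hτ : IsGrowthRate τ) {V : ℝ → ℝ} (hV : ContDiff ℝ 1 V) (h0 : V 0 = 0) :
    HasFluxDeriv τ (fun x => V x / τ x) (deriv V) := by
  have hc := hV.continuous_deriv le_rfl
  refine ⟨fun x _ => (hc.integrableOn_Icc).mono_set Ioc_subset_Icc_self, ?_⟩
  filter_upwards [ae_halfLine_pos] with x hx
  rw [mul_div_cancel₀ _ (hτ.pos x hx).ne', ← intervalIntegral.integral_of_le hx.le,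
    intervalIntegral.integral_deriv_eq_sub
      (fun y _ => (hV.differentiable one_ne_zero).differentiableAt)
      (hc.intervalIntegrable _ _), h0, sub_zero]

theorem HasLinearGrowth.exists_mem_of_contDiff (hl : HasLinearGrowth φ) (hφ : IsWeight φ)
    (hτ : IsGrowthRate τ) (hB : IsFragRate B) (hκ : IsFragKernel κ) {V : ℝ → ℝ}
    (hV : ContDiff ℝ 1 V) (h0 : V 0 = 0) (hs : HasCompactSupport V) :
    ∃ p ∈ operatorGraph τ B κ lam φ, p.1 =ᵐ[halfLine] fun x => V x / τ x := by
  have h1 := isFiniteMeasureOnCompacts_weightMeasure fun X _ => hl.integrableOn hφ X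
  have h2 := isFiniteMeasureOnCompacts_weightMeasure fun X _ => hl.integrableOn_div hφ hτ X
  have hd : Integrable (deriv V) (weightMeasure φ) :=
    (hV.continuous_deriv le_rfl).integrable_of_hasCompactSupport hs.deriv
  have hVi : Integrable V (weightMeasure fun x => φ x / τ x) :=
    hV.continuous.integrable_of_hasCompactSupport hs
  have hVfin := ((hφ.div hτ).integrable_iff.1 hVi).2
  have hm : AEStronglyMeasurable (fun x => V x / τ x) halfLine :=
    (hV.continuous.continuousOn.div hτ.continuousOn
      fun x hx => (hτ.pos x hx).ne').aestronglyMeasurable measurableSet_Ioi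
  have hf : Integrable (fun x => V x / τ x) (weightMeasure φ) := by
    refine hφ.integrable_iff.2 ⟨hm, ?_⟩
    simpa only [pos_mul_enorm_div hφ hτ] using hVfin
  obtain ⟨X, hX⟩ := hs.isCompact.bddAbove
  obtain ⟨b, hb0, hb⟩ := hB.exists_le X
  have hBf : Integrable (fun x => B x * (V x / τ x)) (weightMeasure φ) := by
    refine (hf.norm.const_mul b).mono' ?_ ?_
    · exact hφ.aestronglyMeasurable_iff.2
        ((hB.continuousOn.aestronglyMeasurable measurableSet_Ioi).mul hm)
    · refine hφ.ae_iff.2 ?_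
      filter_upwards [ae_halfLine_pos] with x hx
      rw [norm_mul, Real.norm_of_nonneg (hB.nonneg x hx)]
      rcases le_or_gt x X with h | h
      · gcongr
        exact hb x hx h
      · have : V x = 0 := by
          by_contra hne
          exact absurd (hX (subset_tsupport V hne)) (not_le.2 h)
        simp [this]
  obtain ⟨p, hp, hp1, -⟩ := hl.exists_mem_operatorGraph (lam := lam) hφ hB hκ hf hd
    (hasFluxDeriv_div hτ hV h0) hBf
  exact ⟨p, hp, hp1⟩

/-- It amounts to approximating `τ f` in the weight `φ / τ`, which is integrable near the origin
because `1 / τ` is. A smooth compactly supported `g` does this, and the factor `1 - exp (-(n x))`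
enforces zero flux at the origin at small cost. -/
theorem HasLinearGrowth.dense_domain (hl : HasLinearGrowth φ) (hφ : IsWeight φ)
    (hτ : IsGrowthRate τ) (hB : IsFragRate B) (hκ : IsFragKernel κ) :
    Dense {f | ∃ g, (f, g) ∈ operatorSubmodule τ lam hl hφ hB hκ} := by
  intro f
  refine EMetric.mem_closure_iff.2 fun ε hε => ?_
  obtain ⟨δ, hδ0, hδ⟩ : ∃ δ : ℝ, 0 < δ ∧ ENNReal.ofReal δ + ENNReal.ofReal δ < ε := by
    obtain ⟨δ, hδ0, hδ⟩ := ENNReal.lt_iff_exists_real_btwn.1 hε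
    rw [ENNReal.ofReal_pos] at hδ
    refine ⟨δ / 2, by linarith [hδ.1], ?_⟩
    rw [← ENNReal.ofReal_add (by linarith [hδ.1]) (by linarith [hδ.1]), add_halves]
    exact hδ.2
  have hw := hφ.div hτ
  have hfin := isFiniteMeasureOnCompacts_weightMeasure fun X _ => hl.integrableOn_div hφ hτ X
  have hτf : Integrable (fun x => τ x * f x) (weightMeasure fun x => φ x / τ x) := by
    refine hw.integrable_iff.2 ⟨(hτ.continuousOn.aestronglyMeasurable measurableSet_Ioi).mul
      (WL1.measurable f).aestronglyMeasurable, ?_⟩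
    rw [← lintegral_congr fun x => pos_mul_enorm_div hφ hτ (fun x => τ x * f x) x,
      lintegral_pos_mul_congr (g := fun x => ‖f x‖ₑ)]
    · exact hφ.lintegral_ne_top f
    · filter_upwards [ae_halfLine_pos] with x hx
      rw [mul_div_cancel_left₀ _ (hτ.pos x hx).ne']
  obtain ⟨g, hgs, hg, hgε⟩ := MemLp.exist_eLpNorm_sub_le ENNReal.one_ne_top le_rfl
    (memLp_one_iff_integrable.2 hτf) hδ0
  rw [eLpNorm_one_eq_lintegral_enorm, hw.lintegral_eq] at hgε
  have hgi : Integrable g (weightMeasure fun x => φ x / τ x) :=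
    hg.continuous.integrable_of_hasCompactSupport hgs
  have hwm := measurable_pos hw.continuousOn
  have hlim : Tendsto (fun n : ℕ => ∫⁻ x, pos (fun x => φ x / τ x) x *
      ‖g x * Real.exp (-(n * x))‖ₑ) atTop (𝓝 (∫⁻ _ : ℝ, 0)) := by
    refine tendsto_lintegral_of_dominated_convergence
      (fun x => pos (fun x => φ x / τ x) x * ‖g x‖ₑ) (fun n => ?_) (fun n => ae_of_all _ fun x => ?_)
      (hw.integrable_iff.1 hgi).2 (ae_of_all _ fun x => ?_)
    · exact hwm.mul (hg.continuous.mul (by fun_prop)).measurable.enorm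
    · rcases le_or_gt x 0 with hx | hx
      · simp [pos_of_nonpos _ hx]
      · refine mul_le_mul_right ?_ _
        rw [enorm_le_iff_norm_le, norm_mul, Real.norm_of_nonneg (Real.exp_pos _).le]
        refine mul_le_of_le_one_right (norm_nonneg _) (Real.exp_le_one_iff.2 ?_)
        have : 0 ≤ (n : ℝ) * x := by positivity
        linarith
    · rcases le_or_gt x 0 with hx | hx
      · simp [pos_of_nonpos _ hx]
      · have h1 : Tendsto (fun n : ℕ => g x * Real.exp (-(n * x))) atTop (𝓝 (g x * 0)) := by
          refine Tendsto.const_mul _ (Real.tendsto_exp_neg_atTop_nhds_zero.comp ?_)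
          exact tendsto_natCast_atTop_atTop.atTop_mul_const hx
        have h2 := ENNReal.Tendsto.const_mul (a := pos (fun x => φ x / τ x) x) h1.enorm
          (Or.inr (pos_ne_top _ _))
        simpa using h2
  rw [lintegral_zero] at hlim
  obtain ⟨n, hn⟩ := (hlim.eventually_lt_const (ENNReal.ofReal_pos.2 hδ0)).exists
  set V : ℝ → ℝ := fun x => g x * (1 - Real.exp (-(n * x))) with hV
  have hVd : ContDiff ℝ 1 V := (hg.of_le (by simp)).mul (by fun_prop)
  obtain ⟨p, hp, hp1⟩ := hl.exists_mem_of_contDiff (lam := lam) hφ hτ hB hκ hVd (by simp [hV])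
    hgs.mul_right
  refine ⟨p.1, ⟨p.2, hp⟩, ?_⟩
  rw [edist_eq_enorm_sub, hφ.enorm_eq]
  refine lt_of_le_of_lt ?_ ((add_le_add hgε hn.le).trans_lt hδ)
  have hm1 : Measurable fun x => pos (fun x => φ x / τ x) x * ‖g x * Real.exp (-(n * x))‖ₑ :=
    hwm.mul (hg.continuous.mul (by fun_prop)).measurable.enorm
  rw [← lintegral_add_right _ hm1]
  simp only [← mul_add, Pi.sub_apply]
  calc ∫⁻ x, pos φ x * ‖(f - p.1) x‖ₑ
      = ∫⁻ x, pos φ x * ‖(τ x * f x - V x) / τ x‖ₑ := by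
        refine lintegral_pos_mul_congr ?_
        filter_upwards [hp1, hφ.ae_iff.1 (Lp.coeFn_sub f p.1), ae_halfLine_pos] with x h1 h2 h3
        have := (hτ.pos x h3).ne'
        rw [h2, Pi.sub_apply, h1]
        congr 1
        field_simp
    _ = ∫⁻ x, pos (fun x => φ x / τ x) x * ‖τ x * f x - V x‖ₑ := by
        simp only [pos_mul_enorm_div hφ hτ (fun x => τ x * f x - V x)]
    _ ≤ _ := by
        refine lintegral_mono fun x => ?_
        gcongr
        rw [show τ x * f x - V x = (τ x * f x - g x) + g x * Real.exp (-(n * x)) by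
          simp only [hV]; ring]
        exact enorm_add_le _ _

end Domain

end

end GrowthFrag

/-! ### Solving the resolvent equation with finite moments -/

namespace GrowthFrag

noncomputable section

section Resolvent

variable {τ B : ℝ → ℝ} {κ : Measure ℝ} {lam : ℝ} {φ : ℝ → ℝ}

/-- The weight `1 + x ^ α`, equivalent to `(1 + x) ^ α`. -/
def momentWeight (α : ℝ) : ℝ → ℝ := fun x => 1 + x ^ α

theorem one_le_momentWeight (α : ℝ) {x : ℝ} (hx : 0 < x) : 1 ≤ momentWeight α x := by
  have := Real.rpow_nonneg hx.le α
  unfold momentWeight; linarith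

theorem isWeight_momentWeight {α : ℝ} (hα : 0 < α) : IsWeight (momentWeight α) :=
  ⟨(continuousOn_one_add_rpow hα).mono Ioi_subset_Ici_self,
    fun _ hx => one_pos.trans_le (one_le_momentWeight α hx)⟩

theorem one_add_le_momentWeight {α x : ℝ} (hα : 1 < α) (hx : 0 < x) :
    1 + x ≤ 2 * momentWeight α x := by
  have h0 := Real.rpow_nonneg hx.le α
  unfold momentWeight
  rcases le_total x 1 with h | h
  · linarith
  · have := Real.rpow_le_rpow_of_exponent_le h hα.le
    rw [Real.rpow_one] at this
    linarith

theorem HasLinearGrowth.exists_le_momentWeight (hl : HasLinearGrowth φ) {α : ℝ} (hα : 1 < α) :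
    ∃ C, 0 < C ∧ ∀ x, 0 < x → φ x ≤ C * momentWeight α x := by
  obtain ⟨c, C, hc, hC, h⟩ := hl
  refine ⟨C * 2, by positivity, fun x hx => (h x hx).2.trans ?_⟩
  rw [mul_assoc]
  gcongr
  exact one_add_le_momentWeight hα hx

theorem lintegral_pos_mul_le_of_le {ψ χ : ℝ → ℝ} {K : ℝ} (hK : 0 ≤ K)
    (h : ∀ x, 0 < x → ψ x ≤ K * χ x) (f : ℝ → ℝ≥0∞) :
    ∫⁻ x, pos ψ x * f x ≤ ENNReal.ofReal K * ∫⁻ x, pos χ x * f x := by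
  rw [← lintegral_const_mul' _ _ ENNReal.ofReal_ne_top]
  refine lintegral_mono fun x => ?_
  rw [← mul_assoc, ← pos_const_mul hK]
  exact mul_le_mul_left (pos_mono h x) _

/-- The weight `(c + B) θ - τ θ'` controlled by the Duhamel operator. -/
def lossWeight (τ B : ℝ → ℝ) (c α : ℝ) : ℝ → ℝ := fun x =>
  (c + B x) * momentWeight α x - τ x * (α * x ^ (α - 1))

/-- For large `s` the zeroth-order term absorbs the transport term and leaves `(1 + b / ρ) W`. The
part `(b / ρ) W` pays for the constant `b` in the gain estimate, so the gain is a fraction `ρ < 1`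
of the whole loss weight. -/
theorem exists_lossWeight_bounds (hτ : IsGrowthRate τ) (hB : IsFragRate B) (hκ : IsFragKernel κ)
    (lam : ℝ) {α : ℝ} (hα : 1 < α) : ∃ ρ s₀ : ℝ, 0 < ρ ∧ ρ < 1 ∧ 0 < s₀ ∧
      ∀ s, s₀ ≤ s → ∀ x, 0 < x → momentWeight α x ≤ lossWeight τ B (s + lam) α x ∧
        B x * momentWeight α x ≤ lossWeight τ B (s + lam) α x ∧
        B x * ∫ z, momentWeight α (z * x) ∂κ ≤ ρ * lossWeight τ B (s + lam) α x := by
  obtain ⟨τ₁, hτ₁, hτ1⟩ := hτ.exists_le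
  obtain ⟨ρ, b, hρ0, hρ1, hb0, hb⟩ := exists_gain_one_add_rpow_le hB hκ hα
  refine ⟨ρ, |lam| + α * τ₁ + 1 + b / ρ, hρ0, hρ1, by positivity, fun s hs x hx => ?_⟩
  have h1 := IsGrowthRate.mul_deriv_rpow_le hτ₁ hτ1 hα hx
  have h2 := hb x hx
  have h3 := one_le_momentWeight α hx
  have h4 := hB.nonneg x hx
  have h5 := neg_abs_le lam
  unfold lossWeight
  change _ ≤ α * τ₁ * momentWeight α x at h1
  change B x * ∫ z, momentWeight α (z * x) ∂κ ≤ ρ * (B x * momentWeight α x) + b at h2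
  generalize momentWeight α x = w at *
  have h6 : (1 + b / ρ) * w ≤ (s + lam) * w - α * τ₁ * w := by
    rw [← sub_mul]; gcongr; linarith
  have h7 : 0 ≤ B x * w := by positivity
  have h8 : 0 ≤ b / ρ * w := by positivity
  have h9 : b ≤ ρ * (b / ρ * w) := by
    rw [← mul_assoc, mul_div_cancel₀ _ hρ0.ne']; nlinarith
  refine ⟨by linarith, by linarith, ?_⟩
  have h10 : ρ * (B x * w + b / ρ * w) ≤ ρ * ((s + lam + B x) * w - τ x * (α * x ^ (α - 1))) := by
    gcongr
    linarith
  linarith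

/-- The dual operator applied to the moment weight is negative at infinity and bounded above
elsewhere, hence dominated by a multiple of `φ`, which is bounded below. `D` does not depend on `s`;
this is the source of the linear growth in time. -/
theorem exists_adj_momentWeight_le (hτ : IsGrowthRate τ) (hB : IsFragRate B) (hκ : IsFragKernel κ)
    (lam : ℝ) (hl : HasLinearGrowth φ) {α : ℝ} (hα : 1 < α) : ∃ D : ℝ, 0 ≤ D ∧ ∀ s x : ℝ, 0 < x →
      s * momentWeight α x + B x * ∫ z, momentWeight α (z * x) ∂κ ≤
        lossWeight τ B (s + lam) α x + D * φ x := by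
  obtain ⟨τ₁, hτ₁, hτ1⟩ := hτ.exists_le
  obtain ⟨ρ, b, hρ0, hρ1, hb0, hb⟩ := exists_gain_one_add_rpow_le hB hκ hα
  obtain ⟨c, C, hc, hC, hφ⟩ := hl
  obtain ⟨X, hX⟩ := (eventually_adj_one_add_rpow_le (lam := lam) hτ hB hκ hα).exists_forall_of_atTop
  set E := (α * τ₁ + |lam|) * (1 + |X| ^ α) + b with hE
  have hE0 : 0 ≤ E := by
    have := Real.rpow_nonneg (abs_nonneg X) α
    positivity
  refine ⟨E / c, by positivity, fun s x hx => ?_⟩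
  have hφE : E ≤ E / c * φ x := by
    rw [div_mul_eq_mul_div, le_div_iff₀ hc]
    have := (hφ x hx).1
    have h1 : c ≤ φ x := by nlinarith
    gcongr
  have hadj : adj τ B κ lam (fun x => 1 + x ^ α) (fun x => α * x ^ (α - 1)) x ≤ E := by
    rcases le_total X x with h | h
    · linarith [hX x h]
    · have h1 := IsGrowthRate.mul_deriv_rpow_le hτ₁ hτ1 hα hx
      have h2 := hb x hx
      have h3 : x ^ α ≤ |X| ^ α :=
        Real.rpow_le_rpow hx.le (h.trans (le_abs_self X)) (by linarith)
      have h4 := Real.rpow_nonneg hx.le α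
      have h5 := hB.nonneg x hx
      unfold adj
      have h6 : -lam * (1 + x ^ α) ≤ |lam| * (1 + x ^ α) := by gcongr; exact neg_le_abs lam
      have h7 : (α * τ₁ + |lam|) * (1 + x ^ α) ≤ (α * τ₁ + |lam|) * (1 + |X| ^ α) := by gcongr
      have h8 : 0 ≤ (1 - ρ) * (B x * (1 + x ^ α)) :=
        mul_nonneg (by linarith) (by positivity)
      linarith
  unfold adj at hadj
  unfold lossWeight momentWeight
  linarith

theorem gainDual_momentWeight_le (hB : IsFragRate B) (hκ : IsFragKernel κ) {α x : ℝ} (hα : 0 < α)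
    (hx : 0 < x) : gainDual B κ (pos (momentWeight α)) x ≤
      ENNReal.ofReal (B x * ∫ z, momentWeight α (z * x) ∂κ) :=
  gainDual_pos_le hB hκ hx (hκ.integrable_comp (continuousOn_one_add_rpow hα) hx)
    (fun _ hz => zero_le_one.trans (one_le_momentWeight α (mul_pos hz.1 hx))) fun _ _ => le_rfl

/-- Picard iterates of the integral equation `f = solve (gain f + h)`. -/
def picard (τ B : ℝ → ℝ) (κ : Measure ℝ) (c : ℝ) (h : ℝ → ℝ≥0∞) : ℕ → ℝ → ℝ≥0∞
  | 0 => fun _ => 0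
  | n + 1 => solve τ B c fun x => gain B κ (picard τ B κ c h n) x + h x

section Picard

variable {c : ℝ} {h : ℝ → ℝ≥0∞}

theorem measurable_picard (hτ : IsGrowthRate τ) (hB : IsFragRate B) (hκ : IsFragKernel κ)
    (hh : Measurable h) : ∀ n, Measurable (picard τ B κ c h n)
  | 0 => measurable_const
  | n + 1 => measurable_solve hτ hB ((measurable_gain hB hκ (measurable_picard hτ hB hκ hh n)).add hh)

theorem picard_le_succ (n : ℕ) (x : ℝ) : picard τ B κ c h n x ≤ picard τ B κ c h (n + 1) x := by
  induction n generalizing x with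
  | zero => exact zero_le
  | succ n ih =>
    refine solve_mono (fun y => ?_) x
    gcongr
    exact gain_mono ih y

theorem monotone_picard : Monotone (picard τ B κ c h) :=
  monotone_nat_of_le_succ fun n x => picard_le_succ n x

theorem iSup_picard_eq (hτ : IsGrowthRate τ) (hB : IsFragRate B) (hκ : IsFragKernel κ)
    (hh : Measurable h) (x : ℝ) : ⨆ n, picard τ B κ c h n x =
      solve τ B c (fun x => gain B κ (fun y => ⨆ n, picard τ B κ c h n y) x + h x) x := by
  have hm := measurable_picard (c := c) hτ hB hκ hh
  have h1 : (fun x => gain B κ (fun y => ⨆ n, picard τ B κ c h n y) x + h x) =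
      fun x => ⨆ n, (gain B κ (picard τ B κ c h n) x + h x) := by
    ext y
    rw [gain_iSup hB hm monotone_picard, ENNReal.iSup_add]
  have hm' : ∀ n, Measurable fun x => gain B κ (picard τ B κ c h n) x + h x := fun n =>
    (measurable_gain hB hκ (hm n)).add hh
  rw [h1, solve_iSup hτ hB hm']
  · refine le_antisymm (iSup_le fun n => ?_) (iSup_le fun n => ?_)
    · exact (picard_le_succ n x).trans (le_iSup (fun n => solve τ B c
        (fun x => gain B κ (picard τ B κ c h n) x + h x) x) n)
    · exact le_iSup (fun n => picard τ B κ c h n x) (n + 1)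
  · intro m n hmn y
    simp only
    gcongr
    exact gain_mono (monotone_picard hmn) y

theorem measurable_lossWeight (hτ : IsGrowthRate τ) (hB : IsFragRate B) {α : ℝ} (hα : 0 < α) :
    Measurable (pos (lossWeight τ B c α)) := by
  refine measurable_pos (((continuousOn_const.add hB.continuousOn).mul
    (isWeight_momentWeight hα).continuousOn).sub (hτ.continuousOn.mul (continuousOn_const.mul ?_)))
  exact continuousOn_id.rpow_const fun x hx => Or.inl (ne_of_gt hx)

theorem lintegral_lossWeight_solve_le (hτ : IsGrowthRate τ) (hB : IsFragRate B)
    (hκ : IsFragKernel κ) {α : ℝ} (hα : 0 < α)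
    (h0 : ∀ x, 0 < x → momentWeight α x ≤ lossWeight τ B c α x) {f : ℝ → ℝ≥0∞} (hf : Measurable f)
    (hh : Measurable h) :
    ∫⁻ x, pos (lossWeight τ B c α) x * solve τ B c (fun x => gain B κ f x + h x) x ≤
      (∫⁻ x, gainDual B κ (pos (momentWeight α)) x * f x) +
        ∫⁻ x, pos (momentWeight α) x * h x := by
  have hw := isWeight_momentWeight hα
  have hwm := measurable_pos hw.continuousOn
  have hgm : Measurable fun x => gain B κ f x + h x := (measurable_gain hB hκ hf).add hh
  refine (lintegral_pos_mul_solve_le (θ := momentWeight α) hτ hB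
    (fun x hx => hasDerivAt_one_add_rpow α hx) (fun x hx => (hw.pos x hx).le)
    (measurable_lossWeight hτ hB hα) (fun x hx => (hw.pos x hx).le.trans (h0 x hx))
    hgm).trans_eq ?_
  have hm : Measurable fun x => pos (momentWeight α) x * h x := hwm.mul hh
  rw [← lintegral_mul_gain hB hκ hwm hf, ← lintegral_add_right _ hm]
  exact lintegral_congr fun x => mul_add _ _ _

/-- The constant `1 / (1 - ρ)` is the fixed point of `K = ρ * K + 1`, so the bound reproduces itself
along the iteration. -/
theorem lintegral_lossWeight_picard_le (hτ : IsGrowthRate τ) (hB : IsFragRate B)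
    (hκ : IsFragKernel κ) {α ρ : ℝ} (hα : 0 < α) (hρ0 : 0 < ρ) (hρ1 : ρ < 1)
    (h0 : ∀ x, 0 < x → momentWeight α x ≤ lossWeight τ B c α x)
    (h1 : ∀ x, gainDual B κ (pos (momentWeight α)) x ≤
      ENNReal.ofReal ρ * pos (lossWeight τ B c α) x) (hh : Measurable h) (n : ℕ) :
    ∫⁻ x, pos (lossWeight τ B c α) x * picard τ B κ c h n x ≤
      ENNReal.ofReal (1 / (1 - ρ)) * ∫⁻ x, pos (momentWeight α) x * h x := by
  have hm := measurable_picard (c := c) hτ hB hκ hh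
  induction n with
  | zero => simp [picard]
  | succ n ih =>
    refine (lintegral_lossWeight_solve_le hτ hB hκ hα h0 (hm n) hh).trans ?_
    have h2 : ∫⁻ x, gainDual B κ (pos (momentWeight α)) x * picard τ B κ c h n x ≤
        ENNReal.ofReal ρ * (ENNReal.ofReal (1 / (1 - ρ)) * ∫⁻ x, pos (momentWeight α) x * h x) := by
      refine le_trans ?_ (mul_le_mul_right ih _)
      rw [← lintegral_const_mul' _ _ ENNReal.ofReal_ne_top]
      refine lintegral_mono fun x => ?_
      rw [← mul_assoc]
      gcongr
      exact h1 x
    refine (add_le_add_left h2 _).trans_eq ?_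
    nth_rw 2 [← one_mul (∫⁻ x, pos (momentWeight α) x * h x)]
    have : 0 < 1 - ρ := by linarith
    rw [← mul_assoc, ← add_mul, ← ENNReal.ofReal_mul hρ0.le, ← ENNReal.ofReal_one,
      ← ENNReal.ofReal_add (by positivity) zero_le_one]
    congr 2
    field_simp
    ring

end Picard

/-- The supremum of the Picard iterates solves the integral equation, and its integral against the
loss weight is finite; this puts it in the domain. Testing with the moment weight `W` then bounds `s
∫ W f` by `∫ W h + D ∫ φ f`, and dissipativity bounds the last integral by `‖h‖ / s`. -/
theorem IsDualPerron.exists_resolvent_of_nonneg {G : ℝ → ℝ} (hφ : IsDualPerron τ B κ lam G φ)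
    (hl : HasLinearGrowth φ) (hτ : IsGrowthRate τ) (hB : IsFragRate B) (hκ : IsFragKernel κ) {α : ℝ}
    (hα : 1 < α) : ∃ D s₀ : ℝ, 0 ≤ D ∧ 0 < s₀ ∧ ∀ s, s₀ ≤ s → ∀ h : WL1 φ,
      (∀ᵐ x ∂halfLine, 0 ≤ h x) → ∫⁻ x, GrowthFrag.pos (momentWeight α) x * ‖h x‖ₑ ≠ ∞ →
      ∃ q ∈ operatorGraph τ B κ lam φ, s • q.1 - q.2 = h ∧
        ∫⁻ x, GrowthFrag.pos (momentWeight α) x * ‖(s • q.1) x‖ₑ ≤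
          (∫⁻ x, GrowthFrag.pos (momentWeight α) x * ‖h x‖ₑ) + ENNReal.ofReal (D / s * ‖h‖) := by
  have hα0 : 0 < α := by linarith
  have hw := hφ.isWeight hl
  have hW := isWeight_momentWeight hα0
  obtain ⟨ρ, s₀, hρ0, hρ1, hs₀, hloss⟩ := exists_lossWeight_bounds hτ hB hκ lam hα
  obtain ⟨D, hD0, hD⟩ := exists_adj_momentWeight_le hτ hB hκ lam hl hα
  obtain ⟨C, hC0, hC⟩ := hl.exists_le_momentWeight hα
  refine ⟨D, s₀, hD0, hs₀, fun s hs h hh0 hhfin => ?_⟩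
  have hs0 : 0 < s := hs₀.trans_le hs
  set c := s + lam with hc
  set ψ := lossWeight τ B c α with hψ
  have hψW : ∀ x, 0 < x → momentWeight α x ≤ ψ x := fun x hx => (hloss s hs x hx).1
  have hψ0 : ∀ x, 0 < x → 0 < ψ x := fun x hx => (hW.pos x hx).trans_le (hψW x hx)
  have hdual : ∀ x, gainDual B κ (GrowthFrag.pos (momentWeight α)) x ≤
      ENNReal.ofReal ρ * GrowthFrag.pos ψ x := fun x => by
    rcases le_or_gt x 0 with hx | hx
    · simp [gainDual_of_nonpos _ hx]
    · rw [pos_of_pos _ hx, ← ENNReal.ofReal_mul hρ0.le]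
      exact (gainDual_momentWeight_le hB hκ hα0 hx).trans
        (ENNReal.ofReal_le_ofReal (hloss s hs x hx).2.2)
  set H : ℝ → ℝ≥0∞ := fun x => ‖h x‖ₑ with hH
  have hHm : Measurable H := (WL1.measurable h).enorm
  have hpm := measurable_picard (c := c) hτ hB hκ hHm
  set f : ℝ → ℝ≥0∞ := fun x => ⨆ n, picard τ B κ c H n x with hf
  have hfm : Measurable f := Measurable.iSup hpm
  have hfeq : ∀ x, f x = solve τ B c (fun x => gain B κ f x + H x) x :=
    iSup_picard_eq hτ hB hκ hHm
  have hψm : Measurable (GrowthFrag.pos ψ) := measurable_lossWeight hτ hB hα0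
  have hWm := measurable_pos hW.continuousOn
  have hψf : ∫⁻ x, GrowthFrag.pos ψ x * f x ≠ ∞ := by
    have : ∫⁻ x, GrowthFrag.pos ψ x * f x = ⨆ n, ∫⁻ x, GrowthFrag.pos ψ x * picard τ B κ c H n x := by
      have hpm' : ∀ n, Measurable fun x => GrowthFrag.pos ψ x * picard τ B κ c H n x := fun n =>
        hψm.mul (hpm n)
      rw [← lintegral_iSup hpm'
        (fun m n hmn x => mul_le_mul_right (monotone_picard hmn x) _)]
      exact lintegral_congr fun x => ENNReal.mul_iSup _ _
    rw [this]
    exact ne_top_of_le_ne_top (ENNReal.mul_ne_top ENNReal.ofReal_ne_top hhfin) (iSup_le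
      fun n => lintegral_lossWeight_picard_le hτ hB hκ hα0 hρ0 hρ1 hψW hdual hHm n)
  have hdualf : ∫⁻ x, gainDual B κ (GrowthFrag.pos (momentWeight α)) x * f x ≠ ∞ := by
    refine ne_top_of_le_ne_top (ENNReal.mul_ne_top (ENNReal.ofReal_ne_top (r := ρ)) hψf) ?_
    rw [← lintegral_const_mul' _ _ ENNReal.ofReal_ne_top]
    refine lintegral_mono fun x => ?_
    rw [← mul_assoc]
    exact mul_le_mul_left (hdual x) _
  have hWg : ∫⁻ x, GrowthFrag.pos (momentWeight α) x * (gain B κ f x + H x) ≠ ∞ := by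
    have hm : Measurable fun x => GrowthFrag.pos (momentWeight α) x * H x := hWm.mul hHm
    simp only [mul_add]
    rw [lintegral_add_right _ hm, lintegral_mul_gain hB hκ hWm hfm]
    exact ENNReal.add_ne_top.2 ⟨hdualf, hhfin⟩
  have hgain_fin : ∀ᵐ x ∂halfLine, gain B κ f x < ∞ :=
    gain_lt_top_ae hB hκ hWm (fun _ hx => hW.pos_ne_zero hx) hfm hdualf
  have hf_fin : ∀ᵐ x ∂halfLine, f x < ∞ := by
    filter_upwards [ae_restrict_of_ae (ae_lt_top (hψm.mul hfm) hψf), ae_halfLine_pos] with x hx hx0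
    by_contra hcon
    rw [not_lt, top_le_iff] at hcon
    rw [Pi.mul_apply, hcon, pos_of_pos _ hx0, ENNReal.mul_top (by simpa using hψ0 x hx0)] at hx
    exact lt_irrefl _ hx
  set F : ℝ → ℝ := fun x => (f x).toReal with hF
  have hFm : Measurable F := hfm.ennreal_toReal
  have hFf : (‖F ·‖ₑ) =ᵐ[halfLine] f := by
    filter_upwards [hf_fin] with x hx
    rw [Real.enorm_of_nonneg ENNReal.toReal_nonneg, ENNReal.ofReal_toReal hx.ne]
  set g : ℝ → ℝ := fun x => (gain B κ f x + H x).toReal with hg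
  have hgm : Measurable g := ((measurable_gain hB hκ hfm).add hHm).ennreal_toReal
  have hgE : (‖g ·‖ₑ) =ᵐ[halfLine] fun x => gain B κ f x + H x := by
    filter_upwards [hgain_fin] with x hx
    rw [Real.enorm_of_nonneg ENNReal.toReal_nonneg,
      ENNReal.ofReal_toReal (ENNReal.add_ne_top.2 ⟨hx.ne, enorm_ne_top⟩)]
  have hgfin : ∫⁻ x, GrowthFrag.pos (momentWeight α) x * ‖g x‖ₑ ≠ ∞ := by
    rwa [lintegral_pos_mul_congr hgE]
  have hgint : Integrable g halfLine := by
    refine ⟨hgm.aestronglyMeasurable, ?_⟩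
    refine lt_of_le_of_lt ?_ hgfin.lt_top
    rw [lintegral_pos_mul]
    refine lintegral_mono_ae ?_
    filter_upwards [ae_halfLine_pos] with x hx
    refine le_mul_of_one_le_left' ?_
    rw [ENNReal.one_le_ofReal]
    exact one_le_momentWeight α hx
  have hflux := hasFluxDeriv_toReal_solve (c := c) (f := F) hτ hB
    (fun x _ => IntegrableOn.mono_set hgint Ioc_subset_Ioi_self)
    (fun x _ => ENNReal.toReal_nonneg) (by
      refine Eventually.of_forall fun x => ?_
      have : GrowthFrag.pos g =ᵐ[halfLine] fun x => gain B κ f x + H x := by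
        filter_upwards [hgE, ae_halfLine_pos] with y hy hy0
        rw [← hy, pos_of_pos _ hy0, Real.enorm_of_nonneg ENNReal.toReal_nonneg]
      rw [solve_congr_ae this, ← hfeq])
  have hφint : ∀ {u : ℝ → ℝ}, AEStronglyMeasurable u halfLine →
      ∫⁻ x, GrowthFrag.pos (momentWeight α) x * ‖u x‖ₑ ≠ ∞ → Integrable u (weightMeasure φ) :=
    fun {u} hu1 hu2 => hw.integrable_iff.2 ⟨hu1, ne_top_of_le_ne_top
      (ENNReal.mul_ne_top ENNReal.ofReal_ne_top hu2) (lintegral_pos_mul_le_of_le hC0.le hC _)⟩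
  have hWF : ∫⁻ x, GrowthFrag.pos (momentWeight α) x * f x ≠ ∞ := by
    refine ne_top_of_le_ne_top (ENNReal.mul_ne_top (ENNReal.ofReal_ne_top (r := 1)) hψf)
      (lintegral_pos_mul_le_of_le zero_le_one (fun x hx => ?_) _)
    rw [one_mul]; exact hψW x hx
  have hFint : Integrable F (weightMeasure φ) := hφint hFm.aestronglyMeasurable (by
    rwa [lintegral_pos_mul_congr hFf])
  have hBm : AEStronglyMeasurable B halfLine :=
    hB.continuousOn.aestronglyMeasurable measurableSet_Ioi
  have hBF : Integrable (fun x => B x * F x) (weightMeasure φ) := by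
    refine hφint (hBm.mul hFm.aestronglyMeasurable) ?_
    have h1 : ∫⁻ x, GrowthFrag.pos (momentWeight α) x * ‖B x * F x‖ₑ =
        ∫⁻ x, GrowthFrag.pos (fun x => B x * momentWeight α x) x * ‖F x‖ₑ := by
      refine lintegral_congr fun x => ?_
      rw [pos_mul_of_nonneg hB.nonneg]
      rcases le_or_gt x 0 with hx | hx
      · simp [pos_of_nonpos _ hx]
      · rw [enorm_mul, Real.enorm_of_nonneg (hB.nonneg x hx), pos_of_pos B hx]; ring
    rw [h1, lintegral_pos_mul_congr hFf]
    refine ne_top_of_le_ne_top (ENNReal.mul_ne_top (ENNReal.ofReal_ne_top (r := 1)) hψf)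
      (lintegral_pos_mul_le_of_le zero_le_one (fun x hx => ?_) _)
    rw [one_mul]; exact (hloss s hs x hx).2.1
  have hdint : Integrable (fun x => g x - (c + B x) * F x) (weightMeasure φ) := by
    refine ((hφint hgm.aestronglyMeasurable hgfin).sub ((hFint.const_mul c).add hBF)).congr
      (ae_of_all _ fun x => ?_)
    simp only [Pi.sub_apply, Pi.add_apply]
    ring
  obtain ⟨q, hq, hq1, hq2⟩ := hl.exists_mem_operatorGraph (lam := lam) hw hB hκ hFint hdint hflux hBF
  have hsq : ⇑(s • q.1) =ᵐ[halfLine] fun x => s * F x := by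
    filter_upwards [hw.ae_iff.1 (Lp.coeFn_smul s q.1), hq1] with x h1 h2
    rw [h1, Pi.smul_apply, h2, smul_eq_mul]
  have hres : s • q.1 - q.2 = h := by
    apply Lp.ext
    refine hw.ae_iff.2 ?_
    filter_upwards [hw.ae_iff.1 (Lp.coeFn_sub (s • q.1) q.2), hsq, hq2, ae_halfLine_pos,
      gain_congr_ae hB hκ hFf, hh0, hgain_fin] with x h1 h2 h3 hx h4 h5 h6
    rw [h1, Pi.sub_apply, h2, h3,
      fragPlus_eq_toReal hB hκ hFm (fun _ => ENNReal.toReal_nonneg) hx, h4]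
    have h7 : g x = (gain B κ f x).toReal + h x := by
      simp only [hg, hH]
      rw [ENNReal.toReal_add h6.ne enorm_ne_top, toReal_enorm, Real.norm_of_nonneg h5]
    rw [h7, hc]; ring
  refine ⟨q, hq, hres, ?_⟩
  have hdiss := hφ.isDissipative hl hτ hB hκ q hq s hs0
  rw [hres, ← le_div_iff₀' hs0] at hdiss
  have hφf : ∫⁻ x, GrowthFrag.pos φ x * f x ≤ ENNReal.ofReal (‖h‖ / s) := by
    have hqf : (fun x => ‖q.1 x‖ₑ) =ᵐ[halfLine] f := by
      filter_upwards [hq1, hFf] with x h1 h2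
      rw [h1, h2]
    rw [← lintegral_pos_mul_congr hqf, ← hw.enorm_eq, ← ofReal_norm]
    exact ENNReal.ofReal_le_ofReal hdiss
  have hpt : ∀ x, ENNReal.ofReal s * (GrowthFrag.pos (momentWeight α) x * f x) +
      gainDual B κ (GrowthFrag.pos (momentWeight α)) x * f x ≤
      GrowthFrag.pos ψ x * f x + ENNReal.ofReal D * (GrowthFrag.pos φ x * f x) := fun x => by
    rcases le_or_gt x 0 with hx | hx
    · simp [pos_of_nonpos _ hx, gainDual_of_nonpos _ hx]
    · rw [← mul_assoc, ← mul_assoc, ← add_mul, ← add_mul]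
      refine mul_le_mul_left ?_ _
      have h1 : 0 ≤ B x * ∫ z, momentWeight α (z * x) ∂κ := by
        refine mul_nonneg (hB.nonneg x hx) (integral_nonneg_of_ae (hκ.ae_mem.mono fun z hz => ?_))
        exact (hW.pos _ (mul_pos hz.1 hx)).le
      refine (add_le_add_right (gainDual_momentWeight_le hB hκ hα0 hx) _).trans ?_
      rw [pos_of_pos _ hx, pos_of_pos _ hx, pos_of_pos _ hx, ← ENNReal.ofReal_mul hs0.le,
        ← ENNReal.ofReal_mul hD0, ← ENNReal.ofReal_add (mul_nonneg hs0.le (hW.pos x hx).le) h1,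
        ← ENNReal.ofReal_add (hψ0 x hx).le (mul_nonneg hD0 (hw.pos x hx).le)]
      exact ENNReal.ofReal_le_ofReal (hD s x hx)
  have hint := lintegral_mono (μ := volume) hpt
  have hm1 : Measurable fun x => ENNReal.ofReal s * (GrowthFrag.pos (momentWeight α) x * f x) :=
    (hWm.mul hfm).const_mul _
  have hm2 : Measurable fun x => GrowthFrag.pos ψ x * f x := hψm.mul hfm
  rw [lintegral_add_left hm1, lintegral_add_left hm2, lintegral_const_mul' _ _ ENNReal.ofReal_ne_top,
    lintegral_const_mul' _ _ ENNReal.ofReal_ne_top] at hint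
  have hψle : ∫⁻ x, GrowthFrag.pos ψ x * f x ≤
      (∫⁻ x, gainDual B κ (GrowthFrag.pos (momentWeight α)) x * f x) + ∫⁻ x, GrowthFrag.pos (momentWeight α) x * H x := by
    refine le_trans (le_of_eq ?_) (lintegral_lossWeight_solve_le hτ hB hκ hα0 hψW hfm hHm)
    exact lintegral_congr fun x => by rw [← hfeq]
  have hfinal : ENNReal.ofReal s * (∫⁻ x, GrowthFrag.pos (momentWeight α) x * f x) ≤
      (∫⁻ x, GrowthFrag.pos (momentWeight α) x * H x) +
        ENNReal.ofReal D * ENNReal.ofReal (‖h‖ / s) := by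
    -- The total gain of the moment occurs on both sides and is finite, so it cancels.
    refine (ENNReal.add_le_add_iff_right hdualf).1 (hint.trans ?_)
    calc _ ≤ (∫⁻ x, gainDual B κ (GrowthFrag.pos (momentWeight α)) x * f x) +
          (∫⁻ x, GrowthFrag.pos (momentWeight α) x * H x) +
        ENNReal.ofReal D * ENNReal.ofReal (‖h‖ / s) := by
          gcongr
      _ = _ := by ring
  rw [← ENNReal.ofReal_mul hD0, mul_div_assoc', ← div_mul_eq_mul_div] at hfinal
  refine le_trans (le_of_eq ?_) hfinal
  rw [← lintegral_const_mul' _ _ ENNReal.ofReal_ne_top]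
  have h1 : (fun x => ‖(s • q.1) x‖ₑ) =ᵐ[halfLine] fun x => ENNReal.ofReal s * f x := by
    filter_upwards [hsq, hFf] with x h1 h2
    rw [h1, enorm_mul, h2, Real.enorm_of_nonneg hs0.le]
  rw [lintegral_pos_mul_congr h1]
  exact lintegral_congr fun x => by ring

end Resolvent

end

end GrowthFrag

/-! ### Moments along the semigroup -/

namespace GrowthFrag

noncomputable section

section Moment

variable {τ B : ℝ → ℝ} {κ : Measure ℝ} {lam α : ℝ} {G φ : ℝ → ℝ}

/-- The moment `∫ (1 + x ^ α) |f| dx`. -/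
def moment (α : ℝ) (f : ℝ → ℝ) : ℝ≥0∞ := ∫⁻ x, pos (momentWeight α) x * ‖f x‖ₑ

theorem moment_congr {f g : ℝ → ℝ} (h : f =ᵐ[halfLine] g) : moment α f = moment α g :=
  lintegral_pos_mul_congr (h.fun_comp fun y => ‖y‖ₑ)

theorem lintegral_pos_mul_add {ψ : ℝ → ℝ} (hψ : IsWeight ψ) {f g : ℝ → ℝ≥0∞} (hf : Measurable f) :
    ∫⁻ x, pos ψ x * (f x + g x) = (∫⁻ x, pos ψ x * f x) + ∫⁻ x, pos ψ x * g x := by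
  have : Measurable fun x => pos ψ x * f x := (measurable_pos hψ.continuousOn).mul hf
  rw [← lintegral_add_left this]
  exact lintegral_congr fun x => mul_add _ _ _

theorem moment_add_le (hφ : IsWeight φ) (hα : 0 < α) (f g : WL1 φ) :
    moment α (f + g : WL1 φ) ≤ moment α f + moment α g := by
  unfold moment
  rw [← lintegral_pos_mul_add (isWeight_momentWeight hα) (WL1.measurable f).enorm]
  refine lintegral_pos_mul_mono ?_
  filter_upwards [hφ.ae_iff.1 (Lp.coeFn_add f g)] with x hx
  rw [hx]
  exact enorm_add_le _ _

theorem moment_smul_le (hφ : IsWeight φ) {c : ℝ} (hc : 0 ≤ c) (f : WL1 φ) :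
    moment α (c • f : WL1 φ) ≤ ENNReal.ofReal c * moment α f := by
  unfold moment
  rw [← lintegral_const_mul' _ _ ENNReal.ofReal_ne_top]
  refine le_of_eq ((lintegral_pos_mul_congr (g := fun x => ENNReal.ofReal c * ‖f x‖ₑ) ?_).trans
    (lintegral_congr fun x => by ring))
  filter_upwards [hφ.ae_iff.1 (Lp.coeFn_smul c f)] with x hx
  rw [hx, Pi.smul_apply, enorm_smul, Real.enorm_of_nonneg hc]

/-- Fatou's lemma along an almost everywhere convergent subsequence. -/
theorem lowerSemicontinuous_moment (hφ : IsWeight φ) (hα : 0 < α) :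
    LowerSemicontinuous fun f : WL1 φ => moment α f := by
  have hw := isWeight_momentWeight hα
  rw [lowerSemicontinuous_iff_isClosed_preimage]
  intro y
  refine IsSeqClosed.isClosed fun u f hu hlim => ?_
  obtain ⟨ns, -, hns⟩ := (tendstoInMeasure_of_tendsto_Lp hlim).exists_seq_tendsto_ae
  have hm := measurable_pos hw.continuousOn
  simp only [mem_preimage, mem_Iic] at hu ⊢
  calc moment α f ≤ ∫⁻ x, liminf (fun n => pos (momentWeight α) x * ‖u (ns n) x‖ₑ) atTop := by
        refine (lintegral_pos_mul _ _).trans_le ?_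
        refine le_trans (lintegral_mono_ae ?_) (setLIntegral_le_lintegral (Ioi 0) _)
        filter_upwards [hφ.ae_iff.1 hns, ae_halfLine_pos] with x hx hx0
        rw [← pos_of_pos _ hx0]
        exact (ENNReal.Tendsto.const_mul hx.enorm (Or.inr (pos_ne_top _ _))).liminf_eq.ge
    _ ≤ liminf (fun n => moment α (u (ns n))) atTop :=
        lintegral_liminf_le fun n => hm.mul (WL1.measurable _).enorm
    _ ≤ liminf (fun _ : ℕ => y) atTop := liminf_le_liminf (Eventually.of_forall fun n => hu _)
    _ = y := liminf_const y

theorem tendsto_lintegral_Ioi {F : ℝ → ℝ≥0∞} (hF : Measurable F) (h : ∫⁻ x, F x ≠ ∞) :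
    Tendsto (fun n : ℕ => ∫⁻ x, (Ioi (n : ℝ)).indicator F x) atTop (𝓝 0) := by
  rw [← lintegral_zero (α := ℝ) (μ := volume)]
  refine tendsto_lintegral_of_dominated_convergence F
    (fun n => hF.indicator measurableSet_Ioi)
    (fun n => ae_of_all _ fun x => indicator_le_self _ _ x) h (ae_of_all _ fun x => ?_)
  refine tendsto_const_nhds.congr' ?_
  obtain ⟨N, hN⟩ := exists_nat_ge x
  filter_upwards [eventually_ge_atTop N] with n hn
  rw [indicator_of_notMem]
  simp only [mem_Ioi, not_lt]
  exact hN.trans (by exact_mod_cast hn)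

theorem HasLinearGrowth.exists_momentWeight_le (hl : HasLinearGrowth φ) (hα : 0 < α) (X : ℝ) :
    ∃ K, 0 < K ∧ ∀ x, 0 < x → x ≤ X → momentWeight α x ≤ K * φ x := by
  obtain ⟨c, C, hc, hC, h⟩ := hl
  have hX := Real.rpow_nonneg (abs_nonneg X) α
  refine ⟨(1 + |X| ^ α) / c, by positivity, fun x hx hxX => ?_⟩
  have h1 : x ^ α ≤ |X| ^ α := Real.rpow_le_rpow hx.le (hxX.trans (le_abs_self X)) hα.le
  have h2 := (h x hx).1
  rw [div_mul_eq_mul_div, le_div_iff₀ hc]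
  unfold momentWeight
  have h3 : c ≤ φ x := by nlinarith
  gcongr

theorem HasLinearGrowth.dense_moment (hl : HasLinearGrowth φ) (hφ : IsWeight φ) (hα : 0 < α) :
    Dense {f : WL1 φ | moment α f ≠ ∞} := by
  intro f
  have hfm := WL1.measurable f
  have hm := measurable_pos hφ.continuousOn
  have hlim := tendsto_lintegral_Ioi (F := fun x => pos φ x * ‖f x‖ₑ) (hm.mul hfm.enorm)
    (hφ.lintegral_ne_top f)
  refine EMetric.mem_closure_iff.2 fun ε hε => ?_
  obtain ⟨n, hn⟩ := (hlim.eventually_lt_const hε).exists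
  set u : WL1 φ := ((Lp.memLp f).indicator (measurableSet_Iic (a := (n : ℝ)))).toLp _ with hu
  have hux : ⇑u =ᵐ[halfLine] (Iic (n : ℝ)).indicator f := hφ.ae_iff.1 (MemLp.coeFn_toLp _)
  obtain ⟨K, hK0, hK⟩ := hl.exists_momentWeight_le hα n
  refine ⟨u, ?_, ?_⟩
  · rw [mem_ofPred_eq, moment_congr hux]
    refine ne_top_of_le_ne_top (ENNReal.mul_ne_top (ENNReal.ofReal_ne_top (r := K))
      (hφ.lintegral_ne_top f)) ?_
    rw [← lintegral_const_mul' _ _ ENNReal.ofReal_ne_top]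
    refine lintegral_mono fun x => ?_
    rcases le_or_gt x 0 with hx | hx
    · simp [pos_of_nonpos _ hx]
    · rcases le_or_gt x n with h | h
      · rw [indicator_of_mem (mem_Iic.2 h), ← mul_assoc, pos_of_pos _ hx, pos_of_pos _ hx,
          ← ENNReal.ofReal_mul hK0.le]
        gcongr
        exact hK x hx h
      · rw [indicator_of_notMem (by simpa using h)]
        simp
  · rw [edist_eq_enorm_sub, hφ.enorm_eq]
    refine lt_of_eq_of_lt ?_ hn
    have h1 : (fun x => ‖(f - u) x‖ₑ) =ᵐ[halfLine] (Ioi (n : ℝ)).indicator fun x => ‖f x‖ₑ := by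
      filter_upwards [hφ.ae_iff.1 (Lp.coeFn_sub f u), hux] with x h1 h2
      rw [h1, Pi.sub_apply, h2]
      rcases le_or_gt x n with h | h
      · rw [indicator_of_mem (mem_Iic.2 h), indicator_of_notMem (by simpa using h)]
        simp
      · rw [indicator_of_notMem (by simpa using h), indicator_of_mem (mem_Ioi.2 h), sub_zero]
    rw [lintegral_pos_mul_congr h1]
    refine lintegral_congr fun x => ?_
    by_cases h : x ∈ Ioi (n : ℝ) <;> simp [h]

theorem ae_posPart_negPart_eq (hφ : IsWeight φ) (h : WL1 φ) :
    ∀ᵐ x ∂halfLine, Lp.posPart h x = max (h x) 0 ∧ Lp.negPart h x = max (-h x) 0 := by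
  filter_upwards [hφ.ae_iff.1 (Lp.coeFn_posPart h), hφ.ae_iff.1 (Lp.coeFn_negPart_eq_max h)]
    with x h1 h2
  exact ⟨h1, h2⟩

theorem enorm_max_add_enorm_max (a : ℝ) : ‖max a 0‖ₑ + ‖max (-a) 0‖ₑ = ‖a‖ₑ := by
  rcases le_total a 0 with h | h
  · rw [max_eq_right h, max_eq_left (by linarith : 0 ≤ -a), enorm_zero, zero_add, enorm_neg]
  · rw [max_eq_left h, max_eq_right (by linarith : -a ≤ 0), enorm_zero, add_zero]

theorem lintegral_posPart_add_negPart {ψ : ℝ → ℝ} (hψ : IsWeight ψ) (hφ : IsWeight φ)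
    (h : WL1 φ) : (∫⁻ x, pos ψ x * ‖Lp.posPart h x‖ₑ) + ∫⁻ x, pos ψ x * ‖Lp.negPart h x‖ₑ =
      ∫⁻ x, pos ψ x * ‖h x‖ₑ := by
  rw [← lintegral_pos_mul_add hψ (WL1.measurable _).enorm]
  refine lintegral_pos_mul_congr ?_
  filter_upwards [ae_posPart_negPart_eq hφ h] with x hx
  rw [hx.1, hx.2, enorm_max_add_enorm_max]

/-- The resolvent equation is solvable for every right-hand side with finite moment, and the
resolvent almost contracts moments. -/
theorem IsDualPerron.exists_resolvent (hφ : IsDualPerron τ B κ lam G φ)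
    (hl : HasLinearGrowth φ) (hτ : IsGrowthRate τ) (hB : IsFragRate B) (hκ : IsFragKernel κ)
    (hα : 1 < α) : ∃ D : ℝ, 0 ≤ D ∧ ∀ᶠ s : ℝ in atTop, ∀ h : WL1 φ, moment α h ≠ ∞ →
      ∃ q ∈ operatorSubmodule τ lam hl (hφ.isWeight hl) hB hκ, s • q.1 - q.2 = h ∧
        moment α (s • q.1 : WL1 φ) ≤ moment α h + ENNReal.ofReal (D / s * ‖h‖) := by
  have hα0 : 0 < α := by linarith
  have hw := hφ.isWeight hl
  have hW := isWeight_momentWeight hα0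
  obtain ⟨D, s₀, hD0, hs₀, hres⟩ := hφ.exists_resolvent_of_nonneg hl hτ hB hκ hα
  refine ⟨D, hD0, ?_⟩
  filter_upwards [eventually_ge_atTop s₀] with s hs h hh
  have hs0 : 0 < s := hs₀.trans_le hs
  -- Both the moment and the norm are additive over positive and negative parts, so the estimates
  -- for the two parts add up with no loss in the constants.
  have hmom := lintegral_posPart_add_negPart hW hw h
  have hnorm := lintegral_posPart_add_negPart hw hw h
  rw [← hw.enorm_eq, ← hw.enorm_eq, ← hw.enorm_eq, ← ofReal_norm, ← ofReal_norm, ← ofReal_norm,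
    ← ENNReal.ofReal_add (norm_nonneg _) (norm_nonneg _),
    ENNReal.ofReal_eq_ofReal_iff (by positivity) (norm_nonneg _)] at hnorm
  have hpn := ae_posPart_negPart_eq hw h
  obtain ⟨q₁, hq₁, e₁, b₁⟩ := hres s hs (Lp.posPart h)
    (hpn.mono fun x hx => hx.1 ▸ le_max_right _ _)
    (ne_top_of_le_ne_top hh (le_self_add.trans_eq hmom))
  obtain ⟨q₂, hq₂, e₂, b₂⟩ := hres s hs (Lp.negPart h)
    (hpn.mono fun x hx => hx.2 ▸ le_max_right _ _)
    (ne_top_of_le_ne_top hh (le_add_self.trans_eq hmom))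
  refine ⟨q₁ - q₂, Submodule.sub_mem _ hq₁ hq₂, ?_, ?_⟩
  · have : Lp.posPart h - Lp.negPart h = h := by
      apply Lp.ext
      refine hw.ae_iff.2 ?_
      filter_upwards [hw.ae_iff.1 (Lp.coeFn_sub (Lp.posPart h) (Lp.negPart h)), hpn] with x h1 h2
      rw [h1, Pi.sub_apply, h2.1, h2.2]
      rcases le_total (h x) 0 with h3 | h3
      · rw [max_eq_right h3, max_eq_left (by linarith)]; ring
      · rw [max_eq_left h3, max_eq_right (by linarith)]; ring
    rw [← this, ← e₁, ← e₂, Prod.fst_sub, Prod.snd_sub]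
    module
  · have hsub : moment α (s • (q₁ - q₂).1 : WL1 φ) ≤
        moment α (s • q₁.1 : WL1 φ) + moment α (s • q₂.1 : WL1 φ) := by
      have h1 := moment_add_le hw hα0 (s • q₁.1) ((1 : ℝ) • (s • (-q₂.1)))
      have h2 : moment α ((1 : ℝ) • (s • (-q₂.1)) : WL1 φ) = moment α (s • q₂.1 : WL1 φ) := by
        unfold moment
        refine lintegral_pos_mul_congr ?_
        have e : (1 : ℝ) • (s • (-q₂.1)) = -(s • q₂.1) := by module
        filter_upwards [hw.ae_iff.1 (Lp.coeFn_neg (s • q₂.1))] with x hx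
        rw [e, hx, Pi.neg_apply, enorm_neg]
      rw [h2] at h1
      have e : s • (q₁ - q₂).1 = s • q₁.1 + (1 : ℝ) • (s • (-q₂.1)) := by
        rw [Prod.fst_sub]; module
      rwa [e]
    refine hsub.trans ((add_le_add b₁ b₂).trans_eq ?_)
    unfold moment
    rw [← hmom, ← hnorm, mul_add, ENNReal.ofReal_add (by positivity) (by positivity)]
    ring

/-- Data with finite moment are dense, so the range condition holds densely. Any exponent above `1`
serves; `2` is used. -/
theorem IsDualPerron.nonempty_resolventFamily (hφ : IsDualPerron τ B κ lam G φ)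
    (hl : HasLinearGrowth φ) (hτ : IsGrowthRate τ) (hB : IsFragRate B) (hκ : IsFragKernel κ) :
    Nonempty (ResolventFamily
      (operatorSubmodule τ lam hl (hφ.isWeight hl) hB hκ).topologicalClosure) := by
  have hw := hφ.isWeight hl
  refine (hφ.isDissipative hl hτ hB hκ).nonempty_resolventFamily
    (hl.dense_domain hw hτ hB hκ) ?_
  obtain ⟨D, -, hD⟩ := hφ.exists_resolvent hl hτ hB hκ one_lt_two
  filter_upwards [hD] with s hs
  refine (hl.dense_moment (α := 2) hw two_pos).mono fun h hh => ?_
  obtain ⟨q, hq, e, -⟩ := hs h hh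
  exact ⟨q, hq, e⟩

theorem IsDualPerron.exists_isGrowthFragSemigroup (hφ : IsDualPerron τ B κ lam G φ)
    (hl : HasLinearGrowth φ) (hτ : IsGrowthRate τ) (hB : IsFragRate B) (hκ : IsFragKernel κ) :
    ∃ T : ℝ≥0 → WL1 φ →L[ℝ] WL1 φ, IsGrowthFragSemigroup τ B κ lam φ T := by
  obtain ⟨r⟩ := hφ.nonempty_resolventFamily hl hτ hB hκ
  exact ⟨r.semigroup, r.isC0Semigroup, r.generatorGraph_semigroup⟩

/-- Along the semigroup, moments grow at most linearly in time. -/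
theorem IsDualPerron.exists_moment_le (hφ : IsDualPerron τ B κ lam G φ)
    (hl : HasLinearGrowth φ) (hτ : IsGrowthRate τ) (hB : IsFragRate B) (hκ : IsFragKernel κ)
    {T : ℝ≥0 → WL1 φ →L[ℝ] WL1 φ} (hT : IsGrowthFragSemigroup τ B κ lam φ T) (hα : 1 < α) :
    ∃ D : ℝ, 0 ≤ D ∧ ∀ (t : ℝ≥0) (f : WL1 φ),
      moment α (T t f) ≤ moment α f + ENNReal.ofReal (D * t * ‖f‖) := by
  have hw := hφ.isWeight hl
  have hα0 : 0 < α := by linarith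
  obtain ⟨r⟩ := hφ.nonempty_resolventFamily hl hτ hB hκ
  obtain ⟨D, hD0, hD⟩ := hφ.exists_resolvent hl hτ hB hκ hα
  refine ⟨D, hD0, r.apply_semigroup_le hT.1 hT.2 (p := fun f : WL1 φ => moment α f)
    (lowerSemicontinuous_moment hw hα0) (moment_add_le hw hα0)
    (fun c x hc => moment_smul_le hw hc x) hD0 ?_⟩
  filter_upwards [hD] with s hs h hh
  obtain ⟨q, hq, e, b⟩ := hs h hh.ne
  exact ⟨q, subset_closure hq, e, b⟩

end Moment

end

end GrowthFrag

/-! ### Restriction to `L¹_α` and strong continuity -/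

namespace GrowthFrag

noncomputable section

section Restriction

variable {τ B : ℝ → ℝ} {κ : Measure ℝ} {lam α : ℝ} {G φ : ℝ → ℝ}

theorem isWeight_powWeight (α : ℝ) : IsWeight (powWeight α) := by
  refine ⟨(continuousOn_const.add continuousOn_id).rpow_const fun x hx => Or.inl ?_,
    fun x hx => Real.rpow_pos_of_pos (by linarith) α⟩
  have : (0 : ℝ) < x := hx
  exact (by positivity : 1 + x ≠ 0)

theorem powWeight_le (hα : 0 < α) {x : ℝ} (hx : 0 < x) :
    powWeight α x ≤ 2 ^ α * momentWeight α x := by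
  have h0 := Real.rpow_nonneg hx.le α
  have h2 : (0 : ℝ) < 2 ^ α := by positivity
  unfold powWeight momentWeight
  rcases le_total x 1 with h | h
  · calc (1 + x) ^ α ≤ 2 ^ α := Real.rpow_le_rpow (by linarith) (by linarith) hα.le
      _ ≤ _ := le_mul_of_one_le_right h2.le (by linarith)
  · calc (1 + x) ^ α ≤ (2 * x) ^ α := Real.rpow_le_rpow (by linarith) (by linarith) hα.le
      _ = 2 ^ α * x ^ α := Real.mul_rpow zero_le_two hx.le
      _ ≤ _ := by gcongr; linarith

theorem momentWeight_le (hα : 0 < α) {x : ℝ} (hx : 0 < x) :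
    momentWeight α x ≤ 2 * powWeight α x := by
  unfold powWeight momentWeight
  have h1 : x ^ α ≤ (1 + x) ^ α := Real.rpow_le_rpow hx.le (by linarith) hα.le
  have h2 := Real.one_le_rpow (by linarith : 1 ≤ 1 + x) hα.le
  linarith

theorem lintegral_powWeight_le (hα : 0 < α) (f : ℝ → ℝ) :
    ∫⁻ x, pos (powWeight α) x * ‖f x‖ₑ ≤ ENNReal.ofReal (2 ^ α) * moment α f :=
  lintegral_pos_mul_le_of_le (by positivity) (fun _ hx => powWeight_le hα hx) _

theorem moment_le (hα : 0 < α) (f : ℝ → ℝ) :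
    moment α f ≤ ENNReal.ofReal 2 * ∫⁻ x, pos (powWeight α) x * ‖f x‖ₑ :=
  lintegral_pos_mul_le_of_le zero_le_two (fun _ hx => momentWeight_le hα hx) _

theorem memLp_powWeight_iff (hα : 0 < α) {f : ℝ → ℝ} :
    MemLp f 1 (weightMeasure (powWeight α)) ↔
      AEStronglyMeasurable f halfLine ∧ moment α f ≠ ∞ := by
  rw [memLp_one_iff_integrable, (isWeight_powWeight α).integrable_iff]
  refine and_congr_right fun _ => ⟨fun h => ?_, fun h => ?_⟩
  · exact ne_top_of_le_ne_top (ENNReal.mul_ne_top ENNReal.ofReal_ne_top h) (moment_le hα f)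
  · exact ne_top_of_le_ne_top (ENNReal.mul_ne_top ENNReal.ofReal_ne_top h)
      (lintegral_powWeight_le hα f)

theorem HasLinearGrowth.memLp_of_powWeight (hl : HasLinearGrowth φ) (hφ : IsWeight φ) (hα : 1 < α)
    {f : ℝ → ℝ} (hf : MemLp f 1 (weightMeasure (powWeight α))) : MemLp f 1 (weightMeasure φ) := by
  obtain ⟨C, hC0, hC⟩ := hl.exists_le_momentWeight hα
  obtain ⟨h1, h2⟩ := (memLp_powWeight_iff (by linarith)).1 hf
  rw [memLp_one_iff_integrable, hφ.integrable_iff]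
  exact ⟨h1, ne_top_of_le_ne_top (ENNReal.mul_ne_top ENNReal.ofReal_ne_top h2)
    (lintegral_pos_mul_le_of_le hC0.le hC _)⟩

/-- A linear map into one weighted space, with values in another one. -/
def changeWeight {E : Type*} [AddCommGroup E] [Module ℝ E] {ψ χ : ℝ → ℝ} (hψ : IsWeight ψ)
    (hχ : IsWeight χ) (L : E →ₗ[ℝ] WL1 χ) (h : ∀ f, MemLp (L f) 1 (weightMeasure ψ)) :
    E →ₗ[ℝ] WL1 ψ where
  toFun f := (h f).toLp _
  map_add' f g := by
    apply Lp.ext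
    refine hψ.ae_iff.2 ?_
    filter_upwards [hψ.ae_iff.1 (h (f + g)).coeFn_toLp, hψ.ae_iff.1 (h f).coeFn_toLp,
      hψ.ae_iff.1 (h g).coeFn_toLp, hχ.ae_iff.1 (Lp.coeFn_add (L f) (L g)),
      hψ.ae_iff.1 (Lp.coeFn_add ((h f).toLp _) ((h g).toLp _))] with x h1 h2 h3 h4 h5
    rw [h1, h5, Pi.add_apply, h2, h3, map_add, h4, Pi.add_apply]
  map_smul' c f := by
    apply Lp.ext
    refine hψ.ae_iff.2 ?_
    filter_upwards [hψ.ae_iff.1 (h (c • f)).coeFn_toLp, hψ.ae_iff.1 (h f).coeFn_toLp,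
      hχ.ae_iff.1 (Lp.coeFn_smul c (L f)),
      hψ.ae_iff.1 (Lp.coeFn_smul c ((h f).toLp _))] with x h1 h2 h4 h5
    rw [h1, RingHom.id_apply, h5, Pi.smul_apply, h2, map_smul, h4, Pi.smul_apply]

theorem changeWeight_ae {E : Type*} [AddCommGroup E] [Module ℝ E] {ψ χ : ℝ → ℝ} (hψ : IsWeight ψ)
    (hχ : IsWeight χ) (L : E →ₗ[ℝ] WL1 χ) (h : ∀ f, MemLp (L f) 1 (weightMeasure ψ)) (f : E) :
    changeWeight hψ hχ L h f =ᵐ[halfLine] L f :=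
  hψ.ae_iff.1 (h f).coeFn_toLp

theorem IsWeight.ext (hφ : IsWeight φ) {f g : WL1 φ} (h : f =ᵐ[halfLine] g) : f = g :=
  Lp.ext (hφ.ae_iff.2 h)

/-- The triangle inequality, with a defect that can be charged to either `a - b` or `b`: to the
difference at bounded sizes, to the tail of the limit at large ones. -/
theorem enorm_sub_add_le (a b : ℝ) : ‖a - b‖ₑ + ‖b‖ₑ ≤ ‖a‖ₑ + 2 * min ‖a - b‖ₑ ‖b‖ₑ := by
  rcases le_total ‖a - b‖ₑ ‖b‖ₑ with h | h
  · rw [min_eq_left h, two_mul, ← add_assoc, add_comm]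
    gcongr
    calc ‖b‖ₑ = ‖a - (a - b)‖ₑ := by rw [sub_sub_cancel]
      _ ≤ _ := enorm_sub_le
  · rw [min_eq_right h, two_mul, ← add_assoc]
    gcongr
    exact enorm_sub_le

/-- Convergence in `L¹(φ)` together with an asymptotic bound of the moments gives convergence of
the moment of the difference. -/
theorem HasLinearGrowth.moment_sub_add_le (hl : HasLinearGrowth φ) (hφ : IsWeight φ) (hα : 0 < α)
    (X : ℝ) : ∃ K : ℝ, ∀ u v : WL1 φ, moment α (u - v : WL1 φ) + moment α v ≤
      moment α u + 2 * (ENNReal.ofReal K * ‖u - v‖ₑ +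
        ∫⁻ x, (Ioi X).indicator (fun x => pos (momentWeight α) x * ‖v x‖ₑ) x) := by
  obtain ⟨K, hK0, hK⟩ := hl.exists_momentWeight_le hα X
  refine ⟨K, fun u v => ?_⟩
  have hW := isWeight_momentWeight hα
  have hWm := measurable_pos hW.continuousOn
  have hφm := measurable_pos hφ.continuousOn
  have hum := WL1.measurable u
  have hvm := WL1.measurable v
  have hdm := WL1.measurable (u - v)
  have m1 : Measurable fun x => pos (momentWeight α) x * ‖u x‖ₑ := hWm.mul hum.enorm
  have m2 : Measurable fun x => ENNReal.ofReal K * (pos φ x * ‖(u - v) x‖ₑ) :=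
    (hφm.mul hdm.enorm).const_mul _
  unfold moment
  rw [hφ.enorm_eq, ← lintegral_pos_mul_add hW hdm.enorm,
    ← lintegral_const_mul' _ _ ENNReal.ofReal_ne_top, ← lintegral_add_left m2,
    ← lintegral_const_mul' _ _ ENNReal.ofNat_ne_top, ← lintegral_add_left m1, lintegral_pos_mul]
  refine le_trans (lintegral_mono_ae ?_) (setLIntegral_le_lintegral (Ioi 0) _)
  filter_upwards [hφ.ae_iff.1 (Lp.coeFn_sub u v), ae_halfLine_pos] with x hx hx0
  rw [← pos_of_pos _ hx0, hx, Pi.sub_apply]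
  refine (mul_le_mul_right (enorm_sub_add_le _ _) _).trans ?_
  rw [mul_add, mul_left_comm]
  gcongr
  rcases le_or_gt x X with h | h
  · refine le_trans ?_ le_self_add
    rw [← mul_assoc, pos_of_pos _ hx0, pos_of_pos _ hx0, ← ENNReal.ofReal_mul hK0.le]
    gcongr
    · exact hK x hx0 h
    · exact min_le_left _ _
  · refine le_trans ?_ le_add_self
    rw [indicator_of_mem (mem_Ioi.2 h)]
    gcongr
    exact min_le_right _ _

/-- A cutoff `n` is fixed first to make the tail of `v` small; then `t → 0` removes both the moment
increment `D t ‖v‖` and the `L¹(φ)` distance below the cutoff. The finite moment of `v` is cancelled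
at the end. -/
theorem IsDualPerron.tendsto_moment (hφ : IsDualPerron τ B κ lam G φ)
    (hl : HasLinearGrowth φ) (hτ : IsGrowthRate τ) (hB : IsFragRate B) (hκ : IsFragKernel κ)
    {T : ℝ≥0 → WL1 φ →L[ℝ] WL1 φ} (hT : IsGrowthFragSemigroup τ B κ lam φ T) (hα : 1 < α)
    {v : WL1 φ} (hv : moment α v ≠ ∞) :
    Tendsto (fun t => moment α (T t v - v : WL1 φ)) (𝓝 0) (𝓝 0) := by
  have hw := hφ.isWeight hl
  have hα0 : 0 < α := by linarith
  obtain ⟨D, hD0, hD⟩ := hφ.exists_moment_le hl hτ hB hκ hT hα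
  have hWm := measurable_pos (isWeight_momentWeight hα0).continuousOn
  have htail := tendsto_lintegral_Ioi (hWm.mul (WL1.measurable v).enorm) hv
  refine ENNReal.tendsto_nhds_zero.2 fun ε hε => ?_
  have htail2 := ENNReal.Tendsto.const_mul (a := 2) htail (Or.inr ENNReal.ofNat_ne_top)
  rw [mul_zero] at htail2
  obtain ⟨n, hn⟩ := (htail2.eventually_lt_const hε).exists
  obtain ⟨K, hK⟩ := hl.moment_sub_add_le hw hα0 n
  set R := ∫⁻ x, (Ioi (n : ℝ)).indicator (fun x => GrowthFrag.pos (momentWeight α) x * ‖v x‖ₑ) x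
    with hR
  have hn' : 2 * R < ε := hn
  have h1 : Tendsto (fun t : ℝ≥0 => ENNReal.ofReal (D * t * ‖v‖)) (𝓝 0) (𝓝 0) := by
    have : Tendsto (fun t : ℝ≥0 => ENNReal.ofReal (D * t * ‖v‖)) (𝓝 0)
        (𝓝 (ENNReal.ofReal (D * (0 : ℝ≥0) * ‖v‖))) := by
      exact (ENNReal.continuous_ofReal.comp (by fun_prop :
        Continuous fun t : ℝ≥0 => D * t * ‖v‖)).tendsto 0
    simpa using this
  have h2 : Tendsto (fun t : ℝ≥0 => ‖T t v - v‖ₑ) (𝓝 0) (𝓝 0) := by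
    have := ((hT.1.strongly_continuous v).sub_const v).enorm
    simpa using this
  have h3 := ENNReal.Tendsto.const_mul (a := ENNReal.ofReal K) h2 (Or.inr ENNReal.ofReal_ne_top)
  rw [mul_zero] at h3
  have h4 := ENNReal.Tendsto.const_mul (a := 2) (h3.add_const R) (Or.inr ENNReal.ofNat_ne_top)
  have h5 := h1.add h4
  rw [zero_add, zero_add] at h5
  filter_upwards [h5.eventually_lt_const hn'] with t ht
  refine le_trans ?_ ht.le
  refine (ENNReal.add_le_add_iff_right hv).1 ((hK (T t v) v).trans ?_)
  calc _ ≤ moment α v + ENNReal.ofReal (D * t * ‖v‖) +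
        2 * (ENNReal.ofReal K * ‖T t v - v‖ₑ + R) := by
        gcongr
        exact hD t v
    _ = _ := by ring

/-- The restriction of the semigroup to `L¹_α`. -/
theorem IsDualPerron.exists_restriction (hφ : IsDualPerron τ B κ lam G φ)
    (hl : HasLinearGrowth φ) (hτ : IsGrowthRate τ) (hB : IsFragRate B) (hκ : IsFragKernel κ)
    {T : ℝ≥0 → WL1 φ →L[ℝ] WL1 φ} (hT : IsGrowthFragSemigroup τ B κ lam φ T) (hα : 1 < α) :
    ∃ S : ℝ≥0 → WL1 (powWeight α) →L[ℝ] WL1 (powWeight α),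
      (∀ (t : ℝ≥0) (f : WL1 (powWeight α)) (g : WL1 φ),
        f =ᵐ[halfLine] g → S t f =ᵐ[halfLine] T t g) ∧
      (∃ C : ℝ, 0 < C ∧ ∀ t : ℝ≥0, ‖S t‖ ≤ C * (1 + (t : ℝ))) ∧ IsC0Semigroup S := by
  have hw := hφ.isWeight hl
  have hα0 : 0 < α := by linarith
  have hp := isWeight_powWeight α
  obtain ⟨D, hD0, hD⟩ := hφ.exists_moment_le hl hτ hB hκ hT hα
  obtain ⟨C, hC0, hC⟩ := hl.exists_le_momentWeight hα
  set ι : WL1 (powWeight α) →ₗ[ℝ] WL1 φ := changeWeight hw hp LinearMap.id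
    fun f => hl.memLp_of_powWeight hw hα (Lp.memLp f)
  have hι : ∀ f, ι f =ᵐ[halfLine] f := changeWeight_ae hw hp _ _
  have hιm : ∀ f, moment α (ι f) ≤ ENNReal.ofReal (2 * ‖f‖) := fun f => by
    rw [moment_congr (hι f), ENNReal.ofReal_mul zero_le_two, ofReal_norm, hp.enorm_eq]
    exact moment_le hα0 f
  have hιn : ∀ f, ‖ι f‖ ≤ C * (2 * ‖f‖) := fun f => by
    rw [← ENNReal.ofReal_le_ofReal_iff (by positivity), ofReal_norm, hw.enorm_eq,
      ENNReal.ofReal_mul hC0.le]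
    exact (lintegral_pos_mul_le_of_le hC0.le hC _).trans (by gcongr; exact hιm f)
  have hTm : ∀ t f, moment α (T t (ι f)) ≤ ENNReal.ofReal (2 * ‖f‖ + D * t * (C * (2 * ‖f‖))) :=
    fun t f => by
      rw [ENNReal.ofReal_add (by positivity) (by positivity)]
      refine (hD t (ι f)).trans (add_le_add (hιm f) (ENNReal.ofReal_le_ofReal ?_))
      gcongr
      exact hιn f
  have hmem : ∀ (t : ℝ≥0) f, MemLp (T t (ι f)) 1 (weightMeasure (powWeight α)) := fun t f =>
    (memLp_powWeight_iff hα0).2 ⟨(WL1.measurable _).aestronglyMeasurable,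
      ne_top_of_le_ne_top ENNReal.ofReal_ne_top (hTm t f)⟩
  set S₀ : ℝ≥0 → WL1 (powWeight α) →ₗ[ℝ] WL1 (powWeight α) := fun t =>
    changeWeight hp hw ((T t).toLinearMap ∘ₗ ι) (hmem t)
  have hS₀ : ∀ t f, S₀ t f =ᵐ[halfLine] T t (ι f) := fun t => changeWeight_ae hp hw _ _
  -- The factor `2 ^ α` compares `(1 + x) ^ α` with the moment weight, the first `2` is the reverse
  -- comparison, and `2 * C` bounds the norm of the embedding `ι` into `L¹(φ)`.
  set M : ℝ := 2 ^ α * (2 + 2 * D * C) with hM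
  have hM0 : 0 < M := by positivity
  have hbound : ∀ (t : ℝ≥0) f, ‖S₀ t f‖ ≤ M * (1 + t) * ‖f‖ := fun t f => by
    rw [← ENNReal.ofReal_le_ofReal_iff (by positivity), ofReal_norm, hp.enorm_eq]
    refine (lintegral_powWeight_le hα0 _).trans ?_
    rw [moment_congr (hS₀ t f)]
    refine (mul_le_mul_right (hTm t f) _).trans ?_
    rw [← ENNReal.ofReal_mul (by positivity)]
    apply ENNReal.ofReal_le_ofReal
    have h1 : 0 ≤ 2 * t * ‖f‖ := by positivity
    have h2 : 0 ≤ 2 * D * C * ‖f‖ := by positivity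
    have h3 : 2 * ‖f‖ + D * t * (C * (2 * ‖f‖)) ≤ (2 + 2 * D * C) * ((1 + t) * ‖f‖) := by linarith
    have h4 := mul_le_mul_of_nonneg_left h3 (by positivity : (0 : ℝ) ≤ 2 ^ α)
    rw [hM]
    linarith
  set S : ℝ≥0 → WL1 (powWeight α) →L[ℝ] WL1 (powWeight α) := fun t =>
    (S₀ t).mkContinuous (M * (1 + t)) (hbound t)
  have hS : ∀ t f, S t f =ᵐ[halfLine] T t (ι f) := hS₀
  have hιS : ∀ t f, ι (S t f) = T t (ι f) := fun t f => hw.ext ((hι _).trans (hS t f))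
  refine ⟨S, fun t f g hfg => ?_, ⟨M, hM0, fun t => ?_⟩, ?_, ?_, fun f => ?_⟩
  · have : ι f = g := hw.ext ((hι f).trans hfg)
    rw [← this]
    exact hS t f
  · exact LinearMap.mkContinuous_norm_le _ (by positivity) _
  · ext1 f
    refine hp.ext ((hS 0 f).trans ?_)
    rw [hT.1.map_zero]
    exact hι f
  · intro s t
    ext1 f
    refine hp.ext ((hS (s + t) f).trans ?_)
    rw [hT.1.map_add, ContinuousLinearMap.comp_apply, ContinuousLinearMap.comp_apply, ← hιS t f]
    exact (hS s (S t f)).symm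
  · rw [tendsto_iff_edist_tendsto_0]
    have hlim := hφ.tendsto_moment hl hτ hB hκ hT hα
      (ne_top_of_le_ne_top ENNReal.ofReal_ne_top (hιm f))
    have hlim2 := ENNReal.Tendsto.const_mul (a := ENNReal.ofReal (2 ^ α)) hlim
      (Or.inr ENNReal.ofReal_ne_top)
    rw [mul_zero] at hlim2
    refine tendsto_of_tendsto_of_tendsto_of_le_of_le tendsto_const_nhds hlim2
      (fun _ => zero_le) fun t => ?_
    rw [edist_eq_enorm_sub, hp.enorm_eq]
    refine (lintegral_powWeight_le hα0 _).trans_eq ?_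
    congr 1
    apply moment_congr
    filter_upwards [hp.ae_iff.1 (Lp.coeFn_sub (S t f) f), hw.ae_iff.1 (Lp.coeFn_sub (T t (ι f)) (ι f)),
      hS t f, hι f] with x h1 h2 h3 h4
    rw [h1, h2, Pi.sub_apply, Pi.sub_apply, h3, h4]

end Restriction

end

end GrowthFrag

theorem lemma2p6 (τ B : ℝ → ℝ) (κ : Measure ℝ)
    (hτ : GrowthFrag.IsGrowthRate τ) (hB : GrowthFrag.IsFragRate B)
    (hκ : GrowthFrag.IsFragKernel κ)
    (lam : ℝ) (G φ : ℝ → ℝ)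
    (hG : GrowthFrag.IsDirectPerron τ B κ lam G)
    (hφ : GrowthFrag.IsDualPerron τ B κ lam G φ) :
    (∃ T : ℝ≥0 → GrowthFrag.WL1 φ →L[ℝ] GrowthFrag.WL1 φ,
      GrowthFrag.IsGrowthFragSemigroup τ B κ lam φ T) ∧
    ∀ T : ℝ≥0 → GrowthFrag.WL1 φ →L[ℝ] GrowthFrag.WL1 φ,
      GrowthFrag.IsGrowthFragSemigroup τ B κ lam φ T →
      ∀ α : ℝ, 1 < α →
        -- `L¹_α` is contained in `L¹(φ)`
        (∀ f : ℝ → ℝ, MemLp f 1 (GrowthFrag.weightMeasure (GrowthFrag.powWeight α)) →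
          MemLp f 1 (GrowthFrag.weightMeasure φ)) ∧
        -- `L¹_α` is invariant under the semigroup
        (∀ (t : ℝ≥0) (f : GrowthFrag.WL1 φ),
          MemLp f 1 (GrowthFrag.weightMeasure (GrowthFrag.powWeight α)) →
          MemLp (T t f) 1 (GrowthFrag.weightMeasure (GrowthFrag.powWeight α))) ∧
        -- the restriction is a strongly continuous semigroup on `L¹_α`, with linear growth bound
        ∃ S : ℝ≥0 → GrowthFrag.WL1 (GrowthFrag.powWeight α) →L[ℝ]
            GrowthFrag.WL1 (GrowthFrag.powWeight α),
          (∀ (t : ℝ≥0) (f : GrowthFrag.WL1 (GrowthFrag.powWeight α)) (g : GrowthFrag.WL1 φ),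
            f =ᵐ[GrowthFrag.halfLine] g → S t f =ᵐ[GrowthFrag.halfLine] T t g) ∧
          (∃ C : ℝ, 0 < C ∧ ∀ t : ℝ≥0, ‖S t‖ ≤ C * (1 + (t : ℝ))) ∧
          GrowthFrag.IsC0Semigroup S := by
  have hl := hφ.hasLinearGrowth hτ hB hκ hG
  refine ⟨hφ.exists_isGrowthFragSemigroup hl hτ hB hκ, fun T hT α hα =>
    ⟨fun f hf => hl.memLp_of_powWeight (hφ.isWeight hl) hα hf, fun t f hf => ?_,
      hφ.exists_restriction hl hτ hB hκ hT hα⟩⟩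
  have hα0 : 0 < α := by linarith
  obtain ⟨D, -, hD⟩ := hφ.exists_moment_le hl hτ hB hκ hT hα
  exact (GrowthFrag.memLp_powWeight_iff hα0).2
    ⟨(GrowthFrag.WL1.measurable _).aestronglyMeasurable, ne_top_of_le_ne_top
      (ENNReal.add_ne_top.2 ⟨((GrowthFrag.memLp_powWeight_iff hα0).1 hf).2, ENNReal.ofReal_ne_top⟩)
      (hD t f)⟩
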